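/- Conventions. Manifolds are smooth, Hausdorff, paracompact, without boundary, and may be modelled on a real Banach space; $M$ is a finite-dimensional second countable manifold. A *surjection admitting local sections* is a smooth surjection with a smooth local section through every point of its source (a surjective submersion), so that all fibre products below are manifolds. For $\pi\colon X\to M$ write $X^{[p]}=X\times_M\cdots\times_M X$. A *bundle gerbe* $(P,Y,N)$ consists of a surjection $Y\to N$ admitting local sections, a smooth principal $\mathbb C^\times$-bundle $P\to Y\times_N Y$, and an associative smooth $\mathbb C^\times$-bundle isomorphism (product) $P_{(y_2,y_3)}\otimes P_{(y_1,y_2)}\to P_{(y_1,y_3)}$; it has an identity section $e(y)\in P_{(y,y)}$. A *morphism* $(\hat f,f)\colon (P,Y,N)\to(P',Y',N)$ is a smooth map $f\colon Y\to Y'$ over $N$ and a smooth $\mathbb C^\times$-bundle map $\hat f\colon P\to P'$ over $f\times f$ that respects the products. A *transformation* $\theta\colon f\Rightarrow g$ is a smooth section $y\mapsto\hat\theta(y)\in P'_{(f(y),g(y))}$ with $\hat\theta(y_2)\hat f(u)=\hat g(u)\hat\theta(y_1)$ for $u\in P_{(y_1,y_2)}$ (that is, a section that descends to $N$). A *bundle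 2-gerbe* $(Q,Y,X,M)$ consists of a surjection $\pi\colon X\to M$ admitting local sections, a bundle gerbe $(Q,Y,X^{[2]})$, a bundle gerbe morphism $m$ over $X^{[3]}$, given fibrewise by $Y_{(x_2,x_3)}\times Y_{(x_1,x_2)}\to Y_{(x_1,x_3)}$, $(y_{23},y_{12})\mapsto y_{23}\circ y_{12}$, and $\hat m\colon Q_{(y_{23},y_{23}')}\otimes Q_{(y_{12},y_{12}')}\to Q_{(y_{23}\circ y_{12},\,y_{23}'\circ y_{12}')}$, and a transformation $a\colon m(m\otimes 1)\Rightarrow m(1\otimes m)$ over $X^{[4]}$, satisfying the pentagon identity $$\hat m(e(y_{45})\otimes a(y_{34},y_{23},y_{12}))\;a(y_{45},y_{34}\circ y_{23},y_{12})\;\hat m(a(y_{45},y_{34},y_{23})\otimes e(y_{12}))=a(y_{45},y_{34},y_{23}\circ y_{12})\;a(y_{45}\circ y_{34},y_{23},y_{12})$$ over $X^{[5]}$. *Four class.* Choose an open cover $\{U_i\}$ of $M$, smooth sections $s_i\colon U_i\to X$ of $\pi$, smooth maps $\sigma_{ij}\colon U_{ij}\to Y$ lifting $(s_i,s_j)\colon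 U_{ij}\to X^{[2]}$, and smooth sections $\rho_{ijk}(x)\in Q_{(\sigma_{jk}(x)\circ\sigma_{ij}(x),\,\sigma_{ik}(x))}$ over $U_{ijk}$ (such choices exist on suitable covers). Define $g_{ijkl}\colon U_{ijkl}\to\mathbb C^\times$ by $$\rho_{ijl}\,\hat m(\rho_{jkl}\otimes e(\sigma_{ij}))=g_{ijkl}\cdot\rho_{ikl}\,\hat m(e(\sigma_{kl})\otimes\rho_{ijk})\,a(\sigma_{kl},\sigma_{jk},\sigma_{ij}).$$ Then $g$ is a smooth $\mathbb C^\times$-valued Čech 3-cocycle, and the four class of $Q$ is the image of $[g]$ under $\check H^3(M;\underline{\mathbb C}^\times_M)\cong H^4(M;\mathbb Z)$ (Čech cohomology, the isomorphism coming from the exponential sequence): if $g_{ijkl}=\exp(2\pi i f_{ijkl})$ with $f_{ijkl}$ smooth on $U_{ijkl}$, it is the class of the integral Čech 4-cocycle $\delta(f)$. *Triviality.* $Q$ is *trivial* if there are a bundle gerbe $(L,Z,X)$ on $X$, a bundle gerbe morphism $\eta\colon\pi_1^{-1}L\otimes Q\to\pi_2^{-1}L$ over $X^{[2]}$, given fibrewise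 by $Z_{x_2}\times Y_{(x_1,x_2)}\to Z_{x_1}$, $(z,y)\mapsto\eta(z,y)$, and $\hat\eta\colon L_{(z,z')}\otimes Q_{(y,y')}\to L_{(\eta(z,y),\eta(z',y'))}$, and a transformation $\theta\colon\pi_2^{-1}\eta\,(1\otimes m)\Rightarrow\pi_3^{-1}\eta\,(\pi_1^{-1}\eta\otimes1)$ over $X^{[3]}$, with components $\theta(z,y_{23},y_{12})\in L_{(\eta(z,\,y_{23}\circ y_{12}),\;\eta(\eta(z,y_{23}),\,y_{12}))}$, such that $\delta(\theta)=a$ over $X^{[4]}$, that is, $$\theta(\eta(z,y_{34}),y_{23},y_{12})\;\theta(z,y_{34},y_{23}\circ y_{12})\;\hat\eta(e(z)\otimes a(y_{34},y_{23},y_{12}))=\hat\eta(\theta(z,y_{34},y_{23})\otimes e(y_{12}))\;\theta(z,y_{34}\circ y_{23},y_{12}).$$ **Proposition.** Every bundle 2-gerbe $(Q,Y,X,M)$ has a four class in $H^4(M;\mathbb Z)$, obtained as above from some choices, and its four class, computed from any choices as above, vanishes if and only if $Q$ is trivial. (It is not assumed that $Y\to X^{[2]}$ is a fibration.) -/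

import Mathlib

open Set
open scoped Manifold ContDiff

universe u

/-! ## Smooth manifolds -/

/-- A smooth manifold without boundary, possibly infinite-dimensional: a space with a smooth atlas
modelled on a real Banach space. Metrizability is the usual requirement that the
manifold be Hausdorff and paracompact. -/
structure SmoothManifold : Type (u + 1) where
  carrier : Type u
  model : Type u
  [normedAddCommGroup : NormedAddCommGroup model]
  [normedSpace : NormedSpace ℝ model]
  [completeSpace : CompleteSpace model]
  [topologicalSpace : TopologicalSpace carrier]
  [metrizableSpace : TopologicalSpace.MetrizableSpace carrier]
  [chartedSpace : ChartedSpace model carrier]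
  [isManifold : IsManifold 𝓘(ℝ, model) ∞ carrier]

namespace SmoothManifold

instance : CoeSort SmoothManifold.{u} (Type u) := ⟨SmoothManifold.carrier⟩

attribute [instance] normedAddCommGroup normedSpace completeSpace topologicalSpace
  metrizableSpace chartedSpace isManifold

/-- The model with corners of a manifold (there is no boundary). -/
noncomputable abbrev I (X : SmoothManifold.{u}) : ModelWithCorners ℝ X.model X.model := 𝓘(ℝ, X.model)

end SmoothManifold

/-! ## Surjections admitting local sections and principal `ℂˣ`-bundles

All fibre products occurring below are subsets of products of manifolds; since the maps involved
are submersions, they are submanifolds, and a function on such a subset is smooth exactly if it is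
`ContMDiffOn` there. A map given only on a fibre product is written as a function on the whole
product, whose values off the fibre product play no role. Accordingly the base of a bundle or of a
bundle gerbe is a subset `S` of a manifold `B` (with `S = univ` if the base is `B` itself). -/

section Base

variable {E H B : Type u} [NormedAddCommGroup E] [NormedSpace ℝ E] [TopologicalSpace H]
  [TopologicalSpace B] [ChartedSpace H B]

/-- `f : Y → B` is a smooth surjection onto `S ⊆ B` which admits smooth local sections through
every point of `Y` (that is, a surjective submersion onto `S`). -/
structure AdmitsLocalSections (Y : SmoothManifold.{u}) (I : ModelWithCorners ℝ E H) (S : Set B)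
    (f : Y → B) : Prop where
  smooth : ContMDiff Y.I I ∞ f
  range_eq : range f = S
  exists_section : ∀ y : Y, ∃ U : Set B, IsOpen U ∧ f y ∈ U ∧ ∃ s : B → Y,
    ContMDiffOn I Y.I ∞ s (U ∩ S) ∧ s (f y) = y ∧ ∀ b ∈ U ∩ S, f (s b) = b

/-- A smooth principal `ℂˣ`-bundle `proj : P → S` over `S ⊆ B`: the group `ℂˣ` acts on `P`, freely
and transitively on the fibres, and there are equivariant fibre coordinates
`coord i : P|_(S ∩ dom i) → ℂˣ` over open sets covering `S`, whose transition functions are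
smooth. The local trivialisations
`(proj, coord i) : P|_(S ∩ dom i) ≃ (S ∩ dom i) × ℂˣ` are the smooth structure of `P`. -/
structure PrincipalBundle (I : ModelWithCorners ℝ E H) (S : Set B) : Type (u + 1) where
  P : Type u
  proj : P → B
  range_proj : range proj = S
  act : ℂˣ → P → P
  one_act : ∀ p, act 1 p = p
  mul_act : ∀ c d p, act (c * d) p = act c (act d p)
  proj_act : ∀ c p, proj (act c p) = proj p
  existsUnique_act : ∀ p q, proj p = proj q → ∃! c, act c p = q
  ι : Type u
  dom : ι → Set B
  isOpen_dom : ∀ i, IsOpen (dom i)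
  cover : ∀ b ∈ S, ∃ i, b ∈ dom i
  coord : ι → P → ℂˣ
  coord_act : ∀ i c p, proj p ∈ dom i → coord i (act c p) = c * coord i p
  smooth_transition : ∀ i j, ∃ t : B → ℂˣ, ContMDiffOn I 𝓘(ℝ, ℂ) ∞ t (S ∩ (dom i ∩ dom j)) ∧
    ∀ p, proj p ∈ dom i ∩ dom j → coord j p = t (proj p) * coord i p

/-- A map `f` from a subset `T` of a manifold to the total space of a principal `ℂˣ`-bundle is
smooth if its components in the local trivialisations are. -/
structure PrincipalBundle.SmoothInto {I : ModelWithCorners ℝ E H} {S : Set B}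
    (R : PrincipalBundle I S) {E' H' A : Type u} [NormedAddCommGroup E'] [NormedSpace ℝ E']
    [TopologicalSpace H'] [TopologicalSpace A] [ChartedSpace H' A] (J : ModelWithCorners ℝ E' H')
    (f : A → R.P) (T : Set A) : Prop where
  proj : ContMDiffOn J I ∞ (fun x => R.proj (f x)) T
  coord : ∀ i, ContMDiffOn J 𝓘(ℝ, ℂ) ∞ (fun x => R.coord i (f x))
    (T ∩ {x | R.proj (f x) ∈ R.dom i})

/-! ## Bundle gerbes -/

/-- A bundle gerbe `(P, Y, S)` over `S ⊆ B`: a surjection `π : Y → S` admitting local sections, a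
principal `ℂˣ`-bundle `P` over `Y ×_S Y`, and an associative smooth isomorphism
`P_(y₂,y₃) ⊗ P_(y₁,y₂) → P_(y₁,y₃)` (a bi-equivariant map `mul`).

An element of `P_(y,y')` is thought of as an arrow from `src = y` to `tgt = y'`, and `mul u v` is
the composite "`u` after `v`". Smoothness of a map such as `mul`, defined on a fibre product of
total spaces of bundles, means that it takes smooth families to smooth families. -/
structure BundleGerbe (I : ModelWithCorners ℝ E H) (S : Set B) : Type (u + 1) where
  Y : SmoothManifold.{u}
  π : Y → B
  admitsLocalSections : AdmitsLocalSections Y I S π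
  bundle : PrincipalBundle (Y.I.prod Y.I) {w : Y × Y | π w.1 = π w.2}
  mul : bundle.P → bundle.P → bundle.P
  proj_mul : ∀ u v, (bundle.proj u).1 = (bundle.proj v).2 →
    bundle.proj (mul u v) = ((bundle.proj v).1, (bundle.proj u).2)
  act_mul : ∀ c u v, (bundle.proj u).1 = (bundle.proj v).2 →
    mul (bundle.act c u) v = bundle.act c (mul u v)
  mul_act : ∀ c u v, (bundle.proj u).1 = (bundle.proj v).2 →
    mul u (bundle.act c v) = bundle.act c (mul u v)
  smooth_mul : ∀ (N : SmoothManifold.{u}) (T : Set N) (u v : N → bundle.P),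
    bundle.SmoothInto N.I u T → bundle.SmoothInto N.I v T →
    (∀ x ∈ T, (bundle.proj (u x)).1 = (bundle.proj (v x)).2) →
    bundle.SmoothInto N.I (fun x => mul (u x) (v x)) T
  mul_assoc : ∀ u v w, (bundle.proj u).1 = (bundle.proj v).2 →
    (bundle.proj v).1 = (bundle.proj w).2 → mul (mul u v) w = mul u (mul v w)

namespace BundleGerbe

variable {I : ModelWithCorners ℝ E H} {S : Set B} (G : BundleGerbe I S)

/-- The total space of the `ℂˣ`-bundle of a bundle gerbe. -/
abbrev P : Type u := G.bundle.P

/-- The action of `ℂˣ`. -/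
abbrev act (c : ℂˣ) (u : G.P) : G.P := G.bundle.act c u

/-- The source `y` of `u ∈ P_(y,y')`. -/
abbrev src (u : G.P) : G.Y := (G.bundle.proj u).1

/-- The target `y'` of `u ∈ P_(y,y')`. -/
abbrev tgt (u : G.P) : G.Y := (G.bundle.proj u).2

/-- A map into the total space of the `ℂˣ`-bundle is smooth. -/
abbrev SmoothInto {E' H' A : Type u} [NormedAddCommGroup E'] [NormedSpace ℝ E']
    [TopologicalSpace H'] [TopologicalSpace A] [ChartedSpace H' A] (J : ModelWithCorners ℝ E' H')
    (f : A → G.P) (T : Set A) : Prop := G.bundle.SmoothInto J f T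

theorem exists_identity (y : G.Y) : ∃ e : G.P, (G.src e = y ∧ G.tgt e = y) ∧
    (∀ u, G.src u = y → G.mul u e = u) ∧ ∀ u, G.tgt u = y → G.mul e u = u := by
  have hy : ((y, y) : G.Y × G.Y) ∈ {w : G.Y × G.Y | G.π w.1 = G.π w.2} := rfl
  rw [← G.bundle.range_proj] at hy
  obtain ⟨p, hp⟩ := hy
  have hpp : G.bundle.proj (G.mul p p) = G.bundle.proj p := by
    rw [G.proj_mul p p (by rw [hp]), hp]
  obtain ⟨c, hc, -⟩ := G.bundle.existsUnique_act _ _ hpp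
  -- the element `e = c • p` is idempotent
  set e := G.bundle.act c p with he
  have hep : G.bundle.proj e = (y, y) := by rw [he, G.bundle.proj_act, hp]
  have hee : G.mul e e = e := by
    rw [he, G.act_mul c p _ (by simp only [G.bundle.proj_act, hp]), G.mul_act c p p (by rw [hp]),
      hc]
  refine ⟨e, ⟨by simp only [src, hep], by simp only [tgt, hep]⟩, fun u hu => ?_, fun u hu => ?_⟩
  · have h1 : (G.bundle.proj u).1 = (G.bundle.proj e).2 := by rw [hep]; exact hu
    have h2 : G.bundle.proj u = G.bundle.proj (G.mul u e) := by
      rw [G.proj_mul u e h1, hep]; exact Prod.ext hu rfl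
    obtain ⟨d, hd, -⟩ := G.bundle.existsUnique_act _ _ h2
    have h3 : G.mul (G.mul u e) e = G.mul u e := by
      rw [G.mul_assoc u e e h1 (by rw [hep]), hee]
    have h4 : G.bundle.act d (G.mul u e) = G.mul u e := by
      conv_rhs => rw [← h3, ← hd, G.act_mul d u e h1]
    obtain ⟨_, _, h5⟩ := G.bundle.existsUnique_act (G.mul u e) (G.mul u e) rfl
    have h6 : d = 1 := (h5 d h4).trans (h5 1 (G.bundle.one_act _)).symm
    rw [← hd, h6, G.bundle.one_act]
  · have h1 : (G.bundle.proj e).1 = (G.bundle.proj u).2 := by rw [hep]; exact hu.symm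
    have h2 : G.bundle.proj u = G.bundle.proj (G.mul e u) := by
      rw [G.proj_mul e u h1, hep]; exact Prod.ext rfl hu
    obtain ⟨d, hd, -⟩ := G.bundle.existsUnique_act _ _ h2
    have h3 : G.mul e (G.mul e u) = G.mul e u := by
      rw [← G.mul_assoc e e u (by rw [hep]) h1, hee]
    have h4 : G.bundle.act d (G.mul e u) = G.mul e u := by
      conv_rhs => rw [← h3, ← hd, G.mul_act d e u h1]
    obtain ⟨_, _, h5⟩ := G.bundle.existsUnique_act (G.mul e u) (G.mul e u) rfl
    have h6 : d = 1 := (h5 d h4).trans (h5 1 (G.bundle.one_act _)).symm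
    rw [← hd, h6, G.bundle.one_act]

/-- The identity section `e` of a bundle gerbe, `e y ∈ P_(y,y)`. -/
noncomputable def e (y : G.Y) : G.P := Classical.choose (G.exists_identity y)

end BundleGerbe

end Base

/-! ## Bundle 2-gerbes -/

/-- A bundle 2-gerbe `(Q, Y, X, M)`. -/
structure Bundle2Gerbe (M : SmoothManifold.{u}) : Type (u + 1) where
  X : SmoothManifold.{u}
  π : X → M
  admitsLocalSections : AdmitsLocalSections X M.I univ π
  /-- the bundle gerbe `(Q, Y, X^[2])` -/
  Q : BundleGerbe (X.I.prod X.I) {w : X × X | π w.1 = π w.2}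
  /-- the map `Y_(x₂,x₃) × Y_(x₁,x₂) → Y_(x₁,x₃)` of the bundle gerbe morphism
  `m : π₁⁻¹Q ⊗ π₃⁻¹Q → π₂⁻¹Q` -/
  m : Q.Y → Q.Y → Q.Y
  proj_m : ∀ y y', (Q.π y).1 = (Q.π y').2 → Q.π (m y y') = ((Q.π y').1, (Q.π y).2)
  smooth_m : ContMDiffOn (Q.Y.I.prod Q.Y.I) Q.Y.I ∞ (fun w : Q.Y × Q.Y => m w.1 w.2)
    {w | (Q.π w.1).1 = (Q.π w.2).2}
  /-- the map on `ℂˣ`-bundles of the bundle gerbe morphism `m`, as a bi-equivariant map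
  `Q_(y₂₃,y₂₃') × Q_(y₁₂,y₁₂') → Q_(m(y₂₃,y₁₂),m(y₂₃',y₁₂'))` -/
  mhat : Q.P → Q.P → Q.P
  src_mhat : ∀ u v, (Q.π (Q.src u)).1 = (Q.π (Q.src v)).2 →
    Q.src (mhat u v) = m (Q.src u) (Q.src v)
  tgt_mhat : ∀ u v, (Q.π (Q.src u)).1 = (Q.π (Q.src v)).2 →
    Q.tgt (mhat u v) = m (Q.tgt u) (Q.tgt v)
  act_mhat : ∀ c u v, (Q.π (Q.src u)).1 = (Q.π (Q.src v)).2 →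
    mhat (Q.act c u) v = Q.act c (mhat u v)
  mhat_act : ∀ c u v, (Q.π (Q.src u)).1 = (Q.π (Q.src v)).2 →
    mhat u (Q.act c v) = Q.act c (mhat u v)
  smooth_mhat : ∀ (N : SmoothManifold.{u}) (T : Set N) (u v : N → Q.P),
    Q.SmoothInto N.I u T → Q.SmoothInto N.I v T →
    (∀ x ∈ T, (Q.π (Q.src (u x))).1 = (Q.π (Q.src (v x))).2) →
    Q.SmoothInto N.I (fun x => mhat (u x) (v x)) T
  /-- `m` commutes with the bundle gerbe products -/
  mhat_mul : ∀ u' u v' v, Q.src u' = Q.tgt u → Q.src v' = Q.tgt v →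
    (Q.π (Q.src u)).1 = (Q.π (Q.src v)).2 →
    mhat (Q.mul u' u) (Q.mul v' v) = Q.mul (mhat u' v') (mhat u v)
  /-- the associator transformation `a : m(m ∘ 1) ⇒ m(1 ∘ m)`, through its lift to a section of
  the bundle with fibres `Q_(m(m(y₃₄,y₂₃),y₁₂),m(y₃₄,m(y₂₃,y₁₂)))` over `Y ∘ Y ∘ Y` -/
  a : Q.Y → Q.Y → Q.Y → Q.P
  proj_a : ∀ y₃₄ y₂₃ y₁₂, (Q.π y₃₄).1 = (Q.π y₂₃).2 → (Q.π y₂₃).1 = (Q.π y₁₂).2 →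
    Q.src (a y₃₄ y₂₃ y₁₂) = m (m y₃₄ y₂₃) y₁₂ ∧ Q.tgt (a y₃₄ y₂₃ y₁₂) = m y₃₄ (m y₂₃ y₁₂)
  smooth_a : Q.SmoothInto (Q.Y.I.prod (Q.Y.I.prod Q.Y.I))
    (fun w : Q.Y × Q.Y × Q.Y => a w.1 w.2.1 w.2.2)
    {w | (Q.π w.1).1 = (Q.π w.2.1).2 ∧ (Q.π w.2.1).1 = (Q.π w.2.2).2}
  /-- the section `a` is compatible with the descent isomorphism, that is, it descends to a
  section over `X^[4]` of the `ℂˣ`-bundle of transformations -/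
  descent_a : ∀ u₃₄ u₂₃ u₁₂, (Q.π (Q.src u₃₄)).1 = (Q.π (Q.src u₂₃)).2 →
    (Q.π (Q.src u₂₃)).1 = (Q.π (Q.src u₁₂)).2 →
    Q.mul (a (Q.tgt u₃₄) (Q.tgt u₂₃) (Q.tgt u₁₂)) (mhat (mhat u₃₄ u₂₃) u₁₂) =
      Q.mul (mhat u₃₄ (mhat u₂₃ u₁₂)) (a (Q.src u₃₄) (Q.src u₂₃) (Q.src u₁₂))
  /-- the coherency condition `δ(a) = 1` over `X^[5]` -/
  coherence_a : ∀ y₄₅ y₃₄ y₂₃ y₁₂, (Q.π y₄₅).1 = (Q.π y₃₄).2 →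
    (Q.π y₃₄).1 = (Q.π y₂₃).2 → (Q.π y₂₃).1 = (Q.π y₁₂).2 →
    Q.mul (mhat (Q.e y₄₅) (a y₃₄ y₂₃ y₁₂))
        (Q.mul (a y₄₅ (m y₃₄ y₂₃) y₁₂) (mhat (a y₄₅ y₃₄ y₂₃) (Q.e y₁₂))) =
      Q.mul (a y₄₅ y₃₄ (m y₂₃ y₁₂)) (a (m y₄₅ y₃₄) y₂₃ y₁₂)

namespace Bundle2Gerbe

variable {M : SmoothManifold.{u}} (𝒬 : Bundle2Gerbe M)

/-- A trivialisation of a bundle 2-gerbe: a bundle gerbe `L` on `X`, a bundle gerbe morphism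
`η : π₁⁻¹L ⊗ Q → π₂⁻¹L` over `X^[2]` and a transformation
`θ : η₁ ⇒ η₂` over `X^[3]`, where `η₁ = π₂⁻¹η (1 ⊗ m)` and `η₂ = π₃⁻¹η (π₁⁻¹η ⊗ 1)`, with
`δ(θ) = a` over `X^[4]`. -/
structure Trivialisation : Type (u + 1) where
  /-- the bundle gerbe `(L, Z, X)`, with `Z = L.Y` -/
  L : BundleGerbe 𝒬.X.I (univ : Set 𝒬.X)
  /-- the map `Z_(x₂) × Y_(x₁,x₂) → Z_(x₁)` of `η` -/
  η : L.Y → 𝒬.Q.Y → L.Y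
  proj_η : ∀ z y, L.π z = (𝒬.Q.π y).2 → L.π (η z y) = (𝒬.Q.π y).1
  smooth_η : ContMDiffOn (L.Y.I.prod 𝒬.Q.Y.I) L.Y.I ∞ (fun w : L.Y × 𝒬.Q.Y => η w.1 w.2)
    {w | L.π w.1 = (𝒬.Q.π w.2).2}
  /-- the map on `ℂˣ`-bundles `L_(z,z') × Q_(y,y') → L_(η(z,y),η(z',y'))` of `η` -/
  ηhat : L.P → 𝒬.Q.P → L.P
  src_ηhat : ∀ l u, L.π (L.src l) = (𝒬.Q.π (𝒬.Q.src u)).2 →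
    L.src (ηhat l u) = η (L.src l) (𝒬.Q.src u)
  tgt_ηhat : ∀ l u, L.π (L.src l) = (𝒬.Q.π (𝒬.Q.src u)).2 →
    L.tgt (ηhat l u) = η (L.tgt l) (𝒬.Q.tgt u)
  act_ηhat : ∀ c l u, L.π (L.src l) = (𝒬.Q.π (𝒬.Q.src u)).2 →
    ηhat (L.act c l) u = L.act c (ηhat l u)
  ηhat_act : ∀ c l u, L.π (L.src l) = (𝒬.Q.π (𝒬.Q.src u)).2 →
    ηhat l (𝒬.Q.act c u) = L.act c (ηhat l u)
  smooth_ηhat : ∀ (N : SmoothManifold.{u}) (T : Set N) (l : N → L.P) (u : N → 𝒬.Q.P),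
    L.SmoothInto N.I l T → 𝒬.Q.SmoothInto N.I u T →
    (∀ x ∈ T, L.π (L.src (l x)) = (𝒬.Q.π (𝒬.Q.src (u x))).2) →
    L.SmoothInto N.I (fun x => ηhat (l x) (u x)) T
  /-- `η` commutes with the bundle gerbe products -/
  ηhat_mul : ∀ l' l u' u, L.src l' = L.tgt l → 𝒬.Q.src u' = 𝒬.Q.tgt u →
    L.π (L.src l) = (𝒬.Q.π (𝒬.Q.src u)).2 →
    ηhat (L.mul l' l) (𝒬.Q.mul u' u) = L.mul (ηhat l' u') (ηhat l u)
  /-- the transformation `θ : η₁ ⇒ η₂`, through its lift to a section of the bundle with fibres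
  `L_(η(z,m(y₂₃,y₁₂)),η(η(z,y₂₃),y₁₂))`, for `z ∈ Z_(x₃)` -/
  θ : L.Y → 𝒬.Q.Y → 𝒬.Q.Y → L.P
  proj_θ : ∀ z y₂₃ y₁₂, L.π z = (𝒬.Q.π y₂₃).2 → (𝒬.Q.π y₂₃).1 = (𝒬.Q.π y₁₂).2 →
    L.src (θ z y₂₃ y₁₂) = η z (𝒬.m y₂₃ y₁₂) ∧ L.tgt (θ z y₂₃ y₁₂) = η (η z y₂₃) y₁₂
  smooth_θ : L.SmoothInto (L.Y.I.prod (𝒬.Q.Y.I.prod 𝒬.Q.Y.I))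
    (fun w : L.Y × 𝒬.Q.Y × 𝒬.Q.Y => θ w.1 w.2.1 w.2.2)
    {w | L.π w.1 = (𝒬.Q.π w.2.1).2 ∧ (𝒬.Q.π w.2.1).1 = (𝒬.Q.π w.2.2).2}
  /-- the section `θ` descends to `X^[3]` -/
  descent_θ : ∀ l u₂₃ u₁₂, L.π (L.src l) = (𝒬.Q.π (𝒬.Q.src u₂₃)).2 →
    (𝒬.Q.π (𝒬.Q.src u₂₃)).1 = (𝒬.Q.π (𝒬.Q.src u₁₂)).2 →
    L.mul (θ (L.tgt l) (𝒬.Q.tgt u₂₃) (𝒬.Q.tgt u₁₂)) (ηhat l (𝒬.mhat u₂₃ u₁₂)) =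
      L.mul (ηhat (ηhat l u₂₃) u₁₂) (θ (L.src l) (𝒬.Q.src u₂₃) (𝒬.Q.src u₁₂))
  /-- the coherency condition `δ(θ) = a` over `X^[4]`: the two composites
  `η(z,m(m(y₃₄,y₂₃),y₁₂)) → η(η(η(z,y₃₄),y₂₃),y₁₂)` agree, for `z ∈ Z_(x₄)` -/
  coherence_θ : ∀ z y₃₄ y₂₃ y₁₂, L.π z = (𝒬.Q.π y₃₄).2 → (𝒬.Q.π y₃₄).1 = (𝒬.Q.π y₂₃).2 →
    (𝒬.Q.π y₂₃).1 = (𝒬.Q.π y₁₂).2 →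
    L.mul (θ (η z y₃₄) y₂₃ y₁₂)
        (L.mul (θ z y₃₄ (𝒬.m y₂₃ y₁₂)) (ηhat (L.e z) (𝒬.a y₃₄ y₂₃ y₁₂))) =
      L.mul (ηhat (θ z y₃₄ y₂₃) (𝒬.Q.e y₁₂)) (θ z (𝒬.m y₃₄ y₂₃) y₁₂)

/-- A bundle 2-gerbe is trivial if it has a trivialisation. -/
def IsTrivial : Prop := Nonempty 𝒬.Trivialisation

end Bundle2Gerbe

/-! ## Čech cohomology with integer coefficients -/

/-- An open cover of `M` indexed by its points, with `x ∈ U x`. Every open cover is refined by such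
a cover, and among these covers "finer" means `V x ⊆ U x` for all `x`, so that the Čech cohomology
of `M` is the direct limit over them. -/
structure PointedCover (M : Type u) [TopologicalSpace M] : Type u where
  U : M → Set M
  isOpen_U : ∀ x, IsOpen (U x)
  mem_U : ∀ x, x ∈ U x

namespace PointedCover

variable {M : Type u} [TopologicalSpace M]

/-- `𝒰 ≤ 𝒱` if `𝒱` is finer than `𝒰`. -/
instance : Preorder (PointedCover M) where
  le 𝒰 𝒱 := ∀ x, 𝒱.U x ⊆ 𝒰.U x
  le_refl _ _ := Subset.rfl
  le_trans _ _ _ h h' x := (h' x).trans (h x)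

/-- The intersection `U_(σ 0) ∩ ⋯ ∩ U_(σ p)`. -/
def inter (𝒰 : PointedCover M) {p : ℕ} (σ : Fin (p + 1) → M) : Set M := ⋂ j, 𝒰.U (σ j)

theorem inter_mono {𝒰 𝒱 : PointedCover M} (h : 𝒰 ≤ 𝒱) {p : ℕ} (σ : Fin (p + 1) → M) :
    𝒱.inter σ ⊆ 𝒰.inter σ := iInter_mono fun j => h (σ j)

theorem inter_face (𝒰 : PointedCover M) {p : ℕ} (τ : Fin (p + 2) → M) (j : Fin (p + 2)) :
    𝒰.inter τ ⊆ 𝒰.inter (τ ∘ j.succAbove) :=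
  subset_iInter fun i => iInter_subset (fun k => 𝒰.U (τ k)) (j.succAbove i)

end PointedCover

section Cech

variable {M : Type u} [TopologicalSpace M]

/-- Restriction of locally constant integer-valued functions to a smaller set. -/
noncomputable def restrictLC {S T : Set M} (h : S ⊆ T) :
    LocallyConstant T ℤ →+ LocallyConstant S ℤ :=
  LocallyConstant.comapAddMonoidHom ⟨inclusion h, continuous_inclusion h⟩

/-- Čech cochains of degree `p` with coefficients in the constant sheaf `ℤ`. -/
abbrev CechCochain (𝒰 : PointedCover M) (p : ℕ) : Type u :=
  (σ : Fin (p + 1) → M) → LocallyConstant (𝒰.inter σ) ℤ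

/-- The Čech differential. -/
noncomputable def cechD (𝒰 : PointedCover M) (p : ℕ) :
    CechCochain 𝒰 p →+ CechCochain 𝒰 (p + 1) where
  toFun c τ := ∑ j : Fin (p + 2),
    (-1 : ℤ) ^ (j : ℕ) • restrictLC (𝒰.inter_face τ j) (c (τ ∘ j.succAbove))
  map_zero' := by funext τ; simp
  map_add' c d := by funext τ; simp [Finset.sum_add_distrib]

/-- Restriction of cochains to a finer cover. -/
noncomputable def cechRestrict {𝒰 𝒱 : PointedCover M} (h : 𝒰 ≤ 𝒱) (p : ℕ) :
    CechCochain 𝒰 p →+ CechCochain 𝒱 p where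
  toFun c σ := restrictLC (PointedCover.inter_mono h σ) (c σ)
  map_zero' := by funext σ; simp
  map_add' c d := by funext σ; simp

theorem cechD_restrict {𝒰 𝒱 : PointedCover M} (h : 𝒰 ≤ 𝒱) (p : ℕ) (c : CechCochain 𝒰 p) :
    cechD 𝒱 p (cechRestrict h p c) = cechRestrict h (p + 1) (cechD 𝒰 p c) := by
  funext τ
  simp only [cechD, cechRestrict, AddMonoidHom.coe_mk, ZeroHom.coe_mk, map_sum, map_zsmul]
  rfl

/-- Čech cocycles of degree `p`. -/
noncomputable abbrev cechZ (𝒰 : PointedCover M) (p : ℕ) : AddSubgroup (CechCochain 𝒰 p) :=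
  (cechD 𝒰 p).ker

/-- The Čech cohomology group of degree `p + 1` of a cover. -/
abbrev CechCoverH (𝒰 : PointedCover M) (p : ℕ) : Type u :=
  cechZ 𝒰 (p + 1) ⧸ ((cechD 𝒰 p).range.addSubgroupOf (cechZ 𝒰 (p + 1)))

/-- Restriction of cocycles to a finer cover. -/
noncomputable def cechZRestrict {𝒰 𝒱 : PointedCover M} (h : 𝒰 ≤ 𝒱) (p : ℕ) :
    cechZ 𝒰 p →+ cechZ 𝒱 p :=
  ((cechRestrict h p).comp (cechZ 𝒰 p).subtype).codRestrict (cechZ 𝒱 p) fun c => by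
    have hc : cechD 𝒰 p c = 0 := c.2
    simp [AddMonoidHom.mem_ker, cechD_restrict, hc]

/-- Restriction of Čech cohomology classes to a finer cover. -/
noncomputable def cechHRestrict (p : ℕ) (𝒰 𝒱 : PointedCover M) (h : 𝒰 ≤ 𝒱) :
    CechCoverH 𝒰 p →+ CechCoverH 𝒱 p :=
  QuotientAddGroup.map _ _ (cechZRestrict h (p + 1)) (by
    rintro ⟨c, hc⟩ ⟨b, hb⟩
    refine ⟨cechRestrict h p b, ?_⟩
    rw [cechD_restrict, hb]
    rfl)

variable (M) in
open Classical in
/-- The Čech cohomology group `H^(p+1)(M; ℤ)`: the direct limit over all open covers. -/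
abbrev CechH (p : ℕ) : Type u :=
  AddCommGroup.DirectLimit (fun 𝒰 : PointedCover M => CechCoverH 𝒰 p) (cechHRestrict p)

open Classical in
/-- The class in `H^(p+1)(M; ℤ)` of a cocycle. -/
noncomputable def cechClass (p : ℕ) (𝒰 : PointedCover M) (n : cechZ 𝒰 (p + 1)) : CechH M p :=
  AddCommGroup.DirectLimit.of (fun 𝒰 : PointedCover M => CechCoverH 𝒰 p) (cechHRestrict p) 𝒰
    (QuotientAddGroup.mk n)

end Cech

/-- The group `H⁴(M; ℤ)`. -/
abbrev IntegralH4 (M : Type u) [TopologicalSpace M] : Type u := CechH M 3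

/-! ## The four class of a bundle 2-gerbe -/

namespace Bundle2Gerbe

variable {M : SmoothManifold.{u}} (𝒬 : Bundle2Gerbe M)

/-- The choices which give rise to a `ℂˣ`-valued Čech 3-cocycle `g` of a bundle 2-gerbe:
an open cover `U`, sections `s i : U_i → X`, sections `σ i j` over `U_ij` of the pullback of
`Y → X^[2]` along `(s i, s j)`, and sections `ρ i j k` over `U_ijk` of the pullback
of `Q` along `(m(σ j k, σ i j), σ i k)`.
With `σ_jk ∘ σ_ij = m(σ_jk, σ_ij)`, there are two arrows
`(σ_kl ∘ σ_jk) ∘ σ_ij → σ_il`, one through `σ_jl ∘ σ_ij` and one through `σ_kl ∘ σ_ik`; the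
function `g_ijkl : U_ijkl → ℂˣ` is their ratio. -/
structure CechData (𝒰 : PointedCover M) : Type u where
  s : M → M → 𝒬.X
  smooth_s : ∀ i, ContMDiffOn M.I 𝒬.X.I ∞ (s i) (𝒰.U i)
  proj_s : ∀ i, ∀ x ∈ 𝒰.U i, 𝒬.π (s i x) = x
  σ : M → M → M → 𝒬.Q.Y
  smooth_σ : ∀ i j, ContMDiffOn M.I 𝒬.Q.Y.I ∞ (σ i j) (𝒰.U i ∩ 𝒰.U j)
  proj_σ : ∀ i j, ∀ x ∈ 𝒰.U i ∩ 𝒰.U j, 𝒬.Q.π (σ i j x) = (s i x, s j x)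
  ρ : M → M → M → M → 𝒬.Q.P
  smooth_ρ : ∀ i j k, 𝒬.Q.SmoothInto M.I (ρ i j k) (𝒰.U i ∩ 𝒰.U j ∩ 𝒰.U k)
  proj_ρ : ∀ i j k, ∀ x ∈ 𝒰.U i ∩ 𝒰.U j ∩ 𝒰.U k,
    𝒬.Q.src (ρ i j k x) = 𝒬.m (σ j k x) (σ i j x) ∧ 𝒬.Q.tgt (ρ i j k x) = σ i k x
  g : (Fin 4 → M) → M → ℂˣ
  g_spec : ∀ i j k l, ∀ x ∈ 𝒰.U i ∩ 𝒰.U j ∩ 𝒰.U k ∩ 𝒰.U l,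
    𝒬.Q.mul (ρ i j l x) (𝒬.mhat (ρ j k l x) (𝒬.Q.e (σ i j x))) =
      𝒬.Q.act (g ![i, j, k, l] x)
        (𝒬.Q.mul (ρ i k l x) (𝒬.Q.mul (𝒬.mhat (𝒬.Q.e (σ k l x)) (ρ i j k x))
          (𝒬.a (σ k l x) (σ j k x) (σ i j x))))

/-- `c ∈ H⁴(M; ℤ)` is the four class of the bundle 2-gerbe `𝒬`: it is the image, under the
isomorphism from the Čech cohomology group `H³(M; ℂˣ)` of smooth `ℂˣ`-valued functions
to `H⁴(M; ℤ)` given by the exponential sequence, of the class of a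
3-cocycle `g` of `𝒬`. Explicitly, `g_ijkl = exp(2πi f_ijkl)` for smooth functions `f_ijkl` on
`U_ijkl`, and `c` is the class of the integral 4-cocycle `n = δ(f)`. -/
def IsFourClass (c : IntegralH4 M) : Prop :=
  ∃ (𝒰 : PointedCover M) (D : 𝒬.CechData 𝒰) (f : (Fin 4 → M) → M → ℂ) (n : cechZ 𝒰 4),
    (∀ τ, ContMDiffOn M.I 𝓘(ℝ, ℂ) ∞ (f τ) (𝒰.inter τ)) ∧
    (∀ τ, ∀ x ∈ 𝒰.inter τ, (D.g τ x : ℂ) = Complex.exp (2 * Real.pi * Complex.I * f τ x)) ∧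
    (∀ (τ : Fin 5 → M) (x : 𝒰.inter τ),
      ((n.1 τ x : ℤ) : ℂ) = ∑ j : Fin 5, (-1 : ℂ) ^ (j : ℕ) * f (τ ∘ j.succAbove) x) ∧
    c = cechClass 3 𝒰 n

end Bundle2Gerbe

/-! Coordinates. In each fibre of a bundle gerbe choose, without regard to continuity, a base point
and arrows issuing from it. An arrow is then determined by its source, its target and a phase in
`ℂˣ`, and phases add under composition (`phase_mul`, `ext_phase`). A pairing such as `mhat` adds
phases up to a function `ν` of the end points (`exists_pairing_phase`). The descent condition on the
associator says that its phase, corrected by `ν`, is a function `α` on `X^[4]`, and the pentagon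
identity says `δα = 0` (`α_coherence`). Identities between arrows thus become identities in an
abelian group. Smoothness is proved separately: the maps in question are composites of smooth
operations, or ratios of such composites (`SmoothInto.ratio`).

Existence. As `Y → X^[2]` need not be a fibration, the lifts `σ`, the sections `ρ` and the
logarithms of `g` exist only locally on the intersections of a cover. `exists_refinement` turns such
local choices into choices on all intersections of a finer cover. In coordinates `g = δR - α(s)`,
where `R` is the corrected phase of `ρ` (`ofMul_g_add_α`). Hence `g` is a cocycle and `δf` is
integral.

Trivial implies zero. A trivialisation yields a function `β` on `X^[3]` with `δβ = α`
(`β_coherence`), so that `g = δ(R - β(s))`. Corrected by the coboundary of a 1-cochain, `R - β(s)`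
becomes a smooth cochain `h`, a ratio of two arrows of `L`, still with `δh = g` (`contMDiffOn_h`,
`ofMul_g`). Then `f - δ(log h)` is an integral cochain with coboundary `δf`.

Zero implies trivial. If `δf = δb` with `b` integral, a partition of unity gives `f - b = δk` with
`k` smooth (`exists_smooth_primitive`), and dividing `ρ` by `exp(2πik)` makes `g = 1`. Now let the
fibre of `Z` over `x` consist of arrows from `x` to some `s i`, each written as a point of `Y_(x,w)`
followed by the value at `w` of a local section of `Y`. The fibre of `L` at `(z, z')` is `Q_(σ_ij ∘
z, z')`, and the product is formed with `ρ` and `a`. Its associativity rests on `g = 1`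
(`twist_cocycle`). `Y` acts on `Z` by precomposition, `θ` is an inverse associator, and `δ(θ) = a`
comes down to the pentagon identity (`coherence_θ`). -/

open Filter Topology

/-! ## Smooth maps into principal bundles -/

section Bundles

variable {E H B : Type u} [NormedAddCommGroup E] [NormedSpace ℝ E] [TopologicalSpace H]
  [TopologicalSpace B] [ChartedSpace H B] {I : ModelWithCorners ℝ E H} {S : Set B}

/-- A map which is smooth near every point of `T` within `T` is smooth on `T`. -/
theorem contMDiffOn_of_forall_isOpen {E₁ H₁ A₁ E₂ H₂ A₂ : Type*} [NormedAddCommGroup E₁]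
    [NormedSpace ℝ E₁] [TopologicalSpace H₁] [TopologicalSpace A₁] [ChartedSpace H₁ A₁]
    [NormedAddCommGroup E₂] [NormedSpace ℝ E₂] [TopologicalSpace H₂] [TopologicalSpace A₂]
    [ChartedSpace H₂ A₂] {J₁ : ModelWithCorners ℝ E₁ H₁} {J₂ : ModelWithCorners ℝ E₂ H₂}
    {f : A₁ → A₂} {T : Set A₁}
    (h : ∀ x ∈ T, ∃ O, IsOpen O ∧ x ∈ O ∧ ContMDiffOn J₁ J₂ ∞ f (T ∩ O)) :
    ContMDiffOn J₁ J₂ ∞ f T := by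
  intro x hx
  obtain ⟨O, hO, hxO, hf⟩ := h x hx
  exact (hf x ⟨hx, hxO⟩).mono_of_mem_nhdsWithin
    (inter_mem_nhdsWithin T (hO.mem_nhds hxO))

/-- The domains are arbitrary subsets, so preimages of chart domains are only relatively open; `O`
is an ambient open set with the right trace. -/
theorem ContinuousOn.exists_isOpen_inter {X₁ X₂ : Type*} [TopologicalSpace X₁]
    [TopologicalSpace X₂] {f : X₁ → X₂} {T : Set X₁} (hf : ContinuousOn f T) {D : Set X₂}
    (hD : IsOpen D) : ∃ O, IsOpen O ∧ ∀ x ∈ T, (x ∈ O ↔ f x ∈ D) := by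
  obtain ⟨O, hO, h⟩ := continuousOn_iff'.1 hf D hD
  refine ⟨O, hO, fun x hx => ?_⟩
  have := Set.ext_iff.1 h x
  simp only [mem_inter_iff, mem_preimage, hx, and_true] at this
  exact this.symm

namespace PrincipalBundle

variable {R : PrincipalBundle I S} {E' H' A : Type u} [NormedAddCommGroup E'] [NormedSpace ℝ E']
    [TopologicalSpace H'] [TopologicalSpace A] [ChartedSpace H' A] {J : ModelWithCorners ℝ E' H'}
    {E'' H'' A' : Type u} [NormedAddCommGroup E''] [NormedSpace ℝ E'']
    [TopologicalSpace H''] [TopologicalSpace A'] [ChartedSpace H'' A']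
    {J' : ModelWithCorners ℝ E'' H''} {f g : A → R.P} {T T' : Set A}

theorem proj_mem (R : PrincipalBundle I S) (p : R.P) : R.proj p ∈ S := by
  have := mem_range_self (f := R.proj) p
  rwa [R.range_proj] at this

theorem act_injective (R : PrincipalBundle I S) (p : R.P) :
    Function.Injective fun c => R.act c p := fun c d h => by
  obtain ⟨_, _, h'⟩ := R.existsUnique_act p (R.act d p) (R.proj_act d p).symm
  exact (h' c h).trans (h' d rfl).symm

theorem exists_coord_eq_one (R : PrincipalBundle I S) {b : B} (hb : b ∈ S) (i : R.ι) :
    ∃ p, R.proj p = b ∧ (b ∈ R.dom i → R.coord i p = 1) := by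
  rw [← R.range_proj] at hb
  obtain ⟨p, rfl⟩ := hb
  refine ⟨R.act (R.coord i p)⁻¹ p, R.proj_act _ _, fun h => ?_⟩
  rw [R.coord_act _ _ _ h, inv_mul_cancel]

namespace SmoothInto

theorem mono (h : R.SmoothInto J f T) (hT : T' ⊆ T) : R.SmoothInto J f T' :=
  ⟨h.proj.mono hT, fun i => (h.coord i).mono (inter_subset_inter_left _ hT)⟩

theorem congr (h : R.SmoothInto J f T) (hg : ∀ x ∈ T, g x = f x) : R.SmoothInto J g T := by
  refine ⟨h.proj.congr fun x hx => by rw [hg x hx], fun i => ?_⟩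
  refine ((h.coord i).mono ?_).congr fun x hx => by rw [hg x hx.1]
  rintro x ⟨hx, hx'⟩
  exact ⟨hx, by
    change R.proj (f x) ∈ R.dom i
    rwa [← hg x hx]⟩

theorem comp {φ : A' → A} {T' : Set A'} (h : R.SmoothInto J f T) (hφ : ContMDiffOn J' J ∞ φ T')
    (hT : MapsTo φ T' T) : R.SmoothInto J' (fun x => f (φ x)) T' :=
  ⟨h.proj.comp hφ hT, fun i => (h.coord i).comp (hφ.mono inter_subset_left)
    fun _ hx => ⟨hT hx.1, hx.2⟩⟩

theorem of_local (h : ∀ x ∈ T, ∃ O, IsOpen O ∧ x ∈ O ∧ R.SmoothInto J f (T ∩ O)) :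
    R.SmoothInto J f T := by
  refine ⟨contMDiffOn_of_forall_isOpen fun x hx => ?_,
    fun i => contMDiffOn_of_forall_isOpen fun x hx => ?_⟩
  · obtain ⟨O, hO, hxO, hf⟩ := h x hx
    exact ⟨O, hO, hxO, hf.proj⟩
  · obtain ⟨O, hO, hxO, hf⟩ := h x hx.1
    exact ⟨O, hO, hxO, (hf.coord i).mono fun y hy => ⟨⟨hy.1.1, hy.2⟩, hy.1.2⟩⟩

/-- Transition functions are smooth, so one trivialisation containing the image decides about all
the others. -/
theorem of_coord (i : R.ι) (hp : ContMDiffOn J I ∞ (fun x => R.proj (f x)) T)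
    (hi : ∀ x ∈ T, R.proj (f x) ∈ R.dom i)
    (hc : ContMDiffOn J 𝓘(ℝ, ℂ) ∞ (fun x => R.coord i (f x)) T) : R.SmoothInto J f T := by
  refine ⟨hp, fun j => ?_⟩
  obtain ⟨t, ht, htp⟩ := R.smooth_transition i j
  refine ContMDiffOn.congr (f := fun x => t (R.proj (f x)) * R.coord i (f x)) ?_
    fun x hx => htp _ ⟨hi x hx.1, hx.2⟩
  exact (ht.comp (hp.mono inter_subset_left) fun x hx =>
    ⟨R.proj_mem _, hi x hx.1, hx.2⟩).mul (hc.mono inter_subset_left)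

/-- Near any point of its domain a smooth map is contained in one local trivialisation. -/
theorem exists_coord (h : R.SmoothInto J f T) {x : A} (hx : x ∈ T) : ∃ (i : R.ι) (O : Set A),
    IsOpen O ∧ x ∈ O ∧ (∀ y ∈ T ∩ O, R.proj (f y) ∈ R.dom i) ∧
      ContMDiffOn J 𝓘(ℝ, ℂ) ∞ (fun y => R.coord i (f y)) (T ∩ O) := by
  obtain ⟨i, hi⟩ := R.cover _ (R.proj_mem (f x))
  obtain ⟨O, hO, h'⟩ := h.proj.continuousOn.exists_isOpen_inter (R.isOpen_dom i)
  exact ⟨i, O, hO, (h' x hx).2 hi, fun y hy => (h' y hy.1).1 hy.2,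
    (h.coord i).mono fun y hy => ⟨hy.1, (h' y hy.1).1 hy.2⟩⟩

theorem act (h : R.SmoothInto J f T) {c : A → ℂˣ} (hc : ContMDiffOn J 𝓘(ℝ, ℂ) ∞ c T) :
    R.SmoothInto J (fun x => R.act (c x) (f x)) T := by
  refine ⟨by simpa only [R.proj_act] using h.proj, fun i => ?_⟩
  simp only [R.proj_act]
  exact ((hc.mono inter_subset_left).mul (h.coord i)).congr fun x hx => R.coord_act _ _ _ hx.2

/-- In a local trivialisation the factor is the quotient of two fibre coordinates. This is how
factors obtained pointwise, such as `g` and `h`, are seen to be smooth. -/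
theorem ratio (hf : R.SmoothInto J f T) (hg : R.SmoothInto J g T) {c : A → ℂˣ}
    (hc : ∀ x ∈ T, g x = R.act (c x) (f x)) : ContMDiffOn J 𝓘(ℝ, ℂ) ∞ c T := by
  refine contMDiffOn_of_forall_isOpen fun x hx => ?_
  obtain ⟨i, O, hO, hxO, hi, hfi⟩ := hf.exists_coord hx
  have hp : ∀ y ∈ T, R.proj (g y) = R.proj (f y) := fun y hy => by rw [hc y hy, R.proj_act]
  refine ⟨O, hO, hxO, ContMDiffOn.congr (f := fun y => R.coord i (g y) / R.coord i (f y)) ?_ ?_⟩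
  · exact ((hg.coord i).mono fun y hy =>
      ⟨hy.1, by
        change R.proj (g y) ∈ R.dom _
        rw [hp y hy.1]
        exact hi y hy⟩).div hfi
  · intro y hy
    rw [hc y hy.1, R.coord_act _ _ _ (hi y hy), mul_div_cancel_right]

end SmoothInto

/-- Take the points with fibre coordinate 1 in a trivialisation around `b x`. -/
theorem exists_local_section (R : PrincipalBundle I S) {b : A → B} (hb : ContMDiffOn J I ∞ b T)
    (hS : MapsTo b T S) {x : A} (hx : x ∈ T) : ∃ (O : Set A) (p : A → R.P), IsOpen O ∧ x ∈ O ∧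
      (∀ y ∈ T, R.proj (p y) = b y) ∧ R.SmoothInto J p (T ∩ O) := by
  classical
  obtain ⟨i, hi⟩ := R.cover _ (hS hx)
  obtain ⟨O, hO, h'⟩ := hb.continuousOn.exists_isOpen_inter (R.isOpen_dom i)
  have : Nonempty R.P := ⟨(R.exists_coord_eq_one (hS hx) i).choose⟩
  choose! p hp hp1 using fun b (hb : b ∈ S) => R.exists_coord_eq_one hb i
  have hpb : ∀ y ∈ T, R.proj (p (b y)) = b y := fun y hy => hp _ (hS hy)
  refine ⟨O, fun y => p (b y), hO, (h' x hx).2 hi, hpb, SmoothInto.of_coord i ?_ ?_ ?_⟩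
  · exact (hb.mono inter_subset_left).congr fun y hy => hpb y hy.1
  · intro y hy
    rw [hpb y hy.1]
    exact (h' y hy.1).1 hy.2
  · exact contMDiffOn_const.congr fun y hy => hp1 _ (hS hy.1) ((h' y hy.1).1 hy.2)

/-- To prove that `f` is smooth it suffices to express it, locally, as a smooth map up to a smooth
factor. -/
theorem SmoothInto.of_ratio (h : ∀ x ∈ T, ∃ (O : Set A) (p : A → R.P) (c : A → ℂˣ), IsOpen O ∧
    x ∈ O ∧ R.SmoothInto J p (T ∩ O) ∧ ContMDiffOn J 𝓘(ℝ, ℂ) ∞ c (T ∩ O) ∧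
      ∀ y ∈ T ∩ O, f y = R.act (c y) (p y)) : R.SmoothInto J f T :=
  .of_local fun x hx => by
    obtain ⟨O, p, c, hO, hxO, hp, hc, hf⟩ := h x hx
    exact ⟨O, hO, hxO, (hp.act hc).congr hf⟩

end PrincipalBundle

end Bundles

/-! ## Algebra of bundle gerbes in coordinates -/

namespace BundleGerbe

variable {E H B : Type u} [NormedAddCommGroup E] [NormedSpace ℝ E] [TopologicalSpace H]
  [TopologicalSpace B] [ChartedSpace H B] {I : ModelWithCorners ℝ E H} {S : Set B}
  (G : BundleGerbe I S)

theorem π_src (u : G.P) : G.π (G.src u) = G.π (G.tgt u) := G.bundle.proj_mem u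

theorem src_e (y : G.Y) : G.src (G.e y) = y := (Classical.choose_spec (G.exists_identity y)).1.1

theorem tgt_e (y : G.Y) : G.tgt (G.e y) = y := (Classical.choose_spec (G.exists_identity y)).1.2

theorem e_mul (u : G.P) : G.mul (G.e (G.tgt u)) u = u :=
  (Classical.choose_spec (G.exists_identity (G.tgt u))).2.2 u rfl

theorem src_act (c : ℂˣ) (u : G.P) : G.src (G.act c u) = G.src u := by
  simp only [src, G.bundle.proj_act]

theorem tgt_act (c : ℂˣ) (u : G.P) : G.tgt (G.act c u) = G.tgt u := by
  simp only [tgt, G.bundle.proj_act]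

variable {G} in
theorem src_mul {u v : G.P} (h : G.src u = G.tgt v) : G.src (G.mul u v) = G.src v := by
  simp only [src, G.proj_mul u v h]

variable {G} in
theorem tgt_mul {u v : G.P} (h : G.src u = G.tgt v) : G.tgt (G.mul u v) = G.tgt u := by
  simp only [tgt, G.proj_mul u v h]

theorem exists_arrow {y y' : G.Y} (h : G.π y = G.π y') : ∃ u, G.src u = y ∧ G.tgt u = y' := by
  have hy : ((y, y') : G.Y × G.Y) ∈ {w : G.Y × G.Y | G.π w.1 = G.π w.2} := h
  rw [← G.bundle.range_proj] at hy
  obtain ⟨p, hp⟩ := hy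
  exact ⟨p, by simp only [src, hp], by simp only [tgt, hp]⟩

theorem exists_act {u v : G.P} (h : G.src u = G.src v) (h' : G.tgt u = G.tgt v) :
    ∃ c, v = G.act c u := by
  obtain ⟨c, hc, -⟩ := G.bundle.existsUnique_act u v (Prod.ext h h')
  exact ⟨c, hc.symm⟩

theorem exists_link (y : G.Y) :
    ∃ u, G.src u = @Function.invFun _ _ ⟨y⟩ G.π (G.π y) ∧ G.tgt u = y :=
  G.exists_arrow (@Function.invFun_eq _ _ ⟨y⟩ G.π (G.π y) ⟨y, rfl⟩)

/-- An arrow to `y` from a point which depends on the fibre of `y` only. -/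
noncomputable def link (y : G.Y) : G.P := Classical.choose (G.exists_link y)

theorem tgt_link (y : G.Y) : G.tgt (G.link y) = y := (Classical.choose_spec (G.exists_link y)).2

theorem src_link_eq {y y' : G.Y} (h : G.π y = G.π y') :
    G.src (G.link y) = G.src (G.link y') := by
  rw [link, link, (Classical.choose_spec (G.exists_link y)).1,
    (Classical.choose_spec (G.exists_link y')).1, h]

theorem exists_phase (u : G.P) :
    ∃ c, G.mul u (G.link (G.src u)) = G.act c (G.link (G.tgt u)) := by
  have h := G.tgt_link (G.src u)
  refine G.exists_act ?_ ?_
  · rw [src_mul h.symm]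
    exact G.src_link_eq (G.π_src u).symm
  · rw [tgt_mul h.symm, tgt_link]

/-- The coordinate of an arrow with respect to a (not continuous) trivialisation of the groupoid
of a bundle gerbe over its base. -/
noncomputable def phase (u : G.P) : Additive ℂˣ :=
  Additive.ofMul (Classical.choose (G.exists_phase u))

theorem mul_link (u : G.P) :
    G.mul u (G.link (G.src u)) = G.act (G.phase u).toMul (G.link (G.tgt u)) :=
  Classical.choose_spec (G.exists_phase u)

theorem act_act (c d : ℂˣ) (u : G.P) : G.act c (G.act d u) = G.act (c * d) u :=
  (G.bundle.mul_act c d u).symm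

theorem phase_eq {u : G.P} {c : ℂˣ}
    (h : G.mul u (G.link (G.src u)) = G.act c (G.link (G.tgt u))) :
    G.phase u = Additive.ofMul c := by
  rw [mul_link] at h
  exact congrArg Additive.ofMul (G.bundle.act_injective _ h)

theorem phase_act (c : ℂˣ) (u : G.P) : G.phase (G.act c u) = Additive.ofMul c + G.phase u := by
  refine G.phase_eq (c := c * (G.phase u).toMul) ?_
  rw [src_act, tgt_act, G.act_mul _ _ _ (G.tgt_link _).symm, mul_link]
  exact act_act ..

-- By associativity the link at the source passes first through `v` and then through `u`, and each
-- passage splits off one phase.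
variable {G} in
theorem phase_mul {u v : G.P} (h : G.src u = G.tgt v) :
    G.phase (G.mul u v) = G.phase u + G.phase v := by
  refine G.phase_eq (c := (G.phase u).toMul * (G.phase v).toMul) ?_
  rw [src_mul h, tgt_mul h, G.mul_assoc _ _ _ h (G.tgt_link _).symm, mul_link,
    G.mul_act _ _ _ (h.trans (G.tgt_link _).symm), ← h, mul_link]
  exact (act_act ..).trans (by rw [mul_comm])

theorem phase_e (y : G.Y) : G.phase (G.e y) = 0 := by
  refine G.phase_eq (c := 1) ?_
  have := G.e_mul (G.link y)
  rw [tgt_link] at this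
  rw [src_e, tgt_e, this]
  exact (G.bundle.one_act _).symm

-- `ℂˣ` acts transitively on the arrows with given end points and shifts the phase. Later identities
-- between arrows are reduced in this way to identities in `Additive ℂˣ`.
variable {G} in
theorem ext_phase {u v : G.P} (h : G.src u = G.src v) (h' : G.tgt u = G.tgt v)
    (h'' : G.phase u = G.phase v) : u = v := by
  obtain ⟨c, rfl⟩ := G.exists_act h h'
  rw [phase_act, right_eq_add] at h''
  rw [show c = 1 from h'']
  exact (G.bundle.one_act u).symm

theorem exists_inv (u : G.P) :
    ∃ v, G.src v = G.tgt u ∧ G.tgt v = G.src u ∧ G.phase v = -G.phase u := by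
  obtain ⟨v, hv, hv'⟩ := G.exists_arrow (G.π_src u).symm
  refine ⟨G.act (-G.phase u - G.phase v).toMul v, ?_, ?_, ?_⟩
  · rw [src_act, hv]
  · rw [tgt_act, hv']
  · rw [phase_act, ofMul_toMul, sub_add_cancel]

/-- The inverse of an arrow. -/
noncomputable def inv (u : G.P) : G.P := Classical.choose (G.exists_inv u)

theorem src_inv (u : G.P) : G.src (G.inv u) = G.tgt u := (Classical.choose_spec (G.exists_inv u)).1

theorem tgt_inv (u : G.P) : G.tgt (G.inv u) = G.src u :=
  (Classical.choose_spec (G.exists_inv u)).2.1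

theorem phase_inv (u : G.P) : G.phase (G.inv u) = -G.phase u :=
  (Classical.choose_spec (G.exists_inv u)).2.2

/-! ### Smoothness -/

variable {G} {N : SmoothManifold.{u}} {T : Set N}

theorem contMDiffOn_src {f : N → G.P} (h : G.SmoothInto N.I f T) :
    ContMDiffOn N.I G.Y.I ∞ (fun x => G.src (f x)) T :=
  fun x hx => ((contMDiffWithinAt_prod_iff _).1 (h.proj x hx)).1

theorem contMDiffOn_tgt {f : N → G.P} (h : G.SmoothInto N.I f T) :
    ContMDiffOn N.I G.Y.I ∞ (fun x => G.tgt (f x)) T :=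
  fun x hx => ((contMDiffWithinAt_prod_iff _).1 (h.proj x hx)).2

theorem exists_local_arrow {f g : N → G.Y} (hf : ContMDiffOn N.I G.Y.I ∞ f T)
    (hg : ContMDiffOn N.I G.Y.I ∞ g T) (hfg : ∀ x ∈ T, G.π (f x) = G.π (g x)) {x : N}
    (hx : x ∈ T) : ∃ (O : Set N) (p : N → G.P), IsOpen O ∧ x ∈ O ∧
      (∀ y ∈ T, G.src (p y) = f y ∧ G.tgt (p y) = g y) ∧ G.SmoothInto N.I p (T ∩ O) := by
  obtain ⟨O, p, hO, hxO, hp, hps⟩ :=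
    G.bundle.exists_local_section (hf.prodMk hg) (fun x hx => hfg x hx) hx
  exact ⟨O, p, hO, hxO, fun y hy => Prod.ext_iff.1 (hp y hy), hps⟩

/-- Both `e` and `phase` come from arbitrary choices. But for a smooth local family `p` of loops, `p
· p = c p` with a factor `c` that is smooth as a ratio, and `e = c⁻¹ p`. -/
theorem smoothInto_e {f : N → G.Y} (hf : ContMDiffOn N.I G.Y.I ∞ f T) :
    G.SmoothInto N.I (fun x => G.e (f x)) T := by
  refine PrincipalBundle.SmoothInto.of_ratio fun x hx => ?_
  obtain ⟨O, p, hO, hxO, hp, hps⟩ := exists_local_arrow hf hf (fun _ _ => rfl) hx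
  have hpp : ∀ y ∈ T, G.src (p y) = G.tgt (p y) := fun y hy =>
    (hp y hy).1.trans (hp y hy).2.symm
  have h : ∀ y ∈ T ∩ O, G.mul (p y) (p y) = G.act (G.phase (p y)).toMul (p y) := by
    intro y hy
    refine ext_phase ?_ ?_ ?_
    · rw [src_mul (hpp y hy.1), src_act]
    · rw [tgt_mul (hpp y hy.1), tgt_act]
    · rw [phase_mul (hpp y hy.1), phase_act, ofMul_toMul]
  refine ⟨O, p, fun y => ((G.phase (p y)).toMul)⁻¹, hO, hxO, hps,
    (hps.ratio (G.smooth_mul _ _ _ _ hps hps fun y hy => hpp y hy.1) h).inv, fun y hy => ?_⟩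
  refine ext_phase ?_ ?_ ?_
  · rw [src_e]
    exact (hp y hy.1).1.symm.trans (G.src_act _ _).symm
  · rw [tgt_e]
    exact (hp y hy.1).2.symm.trans (G.tgt_act _ _).symm
  · rw [phase_e, phase_act, ofMul_inv, ofMul_toMul, neg_add_cancel]

/-- For a smooth local family `p` of arrows in the opposite direction, `p · f = c e` with `c` smooth
as a ratio, and the inverse is `c⁻¹ p`. -/
theorem smoothInto_inv {f : N → G.P} (hf : G.SmoothInto N.I f T) :
    G.SmoothInto N.I (fun x => G.inv (f x)) T := by
  refine PrincipalBundle.SmoothInto.of_ratio fun x hx => ?_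
  obtain ⟨O, p, hO, hxO, hp, hps⟩ := exists_local_arrow (contMDiffOn_tgt hf) (contMDiffOn_src hf)
    (fun y _ => (G.π_src (f y)).symm) hx
  have hpf : ∀ y ∈ T, G.src (p y) = G.tgt (f y) := fun y hy => (hp y hy).1
  have h : ∀ y ∈ T ∩ O, G.mul (p y) (f y) =
      G.act (G.phase (p y) + G.phase (f y)).toMul (G.e (G.src (f y))) := by
    intro y hy
    refine ext_phase ?_ ?_ ?_
    · rw [src_mul (hpf y hy.1), src_act, src_e]
    · rw [tgt_mul (hpf y hy.1), tgt_act, tgt_e, (hp y hy.1).2]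
    · rw [phase_mul (hpf y hy.1), phase_act, ofMul_toMul, phase_e, add_zero]
  have hf' := hf.mono (inter_subset_left (t := O))
  refine ⟨O, p, fun y => ((G.phase (p y) + G.phase (f y)).toMul)⁻¹, hO, hxO, hps,
    ((smoothInto_e (contMDiffOn_src hf')).ratio
      (G.smooth_mul _ _ _ _ hps hf' fun y hy => hpf y hy.1) h).inv, fun y hy => ?_⟩
  refine ext_phase ?_ ?_ ?_
  · rw [src_inv]
    exact (hp y hy.1).1.symm.trans (G.src_act _ _).symm
  · rw [tgt_inv]
    exact (hp y hy.1).2.symm.trans (G.tgt_act _ _).symm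
  · rw [phase_inv, phase_act, ofMul_inv, ofMul_toMul, neg_add, neg_add_cancel_comm]

end BundleGerbe

/-- The coordinate expression of a pairing of bundle gerbes (a bundle gerbe morphism
`G₁ ⊗ G₂ → G₃`) is determined by a function on pairs of points. -/
theorem BundleGerbe.exists_pairing_phase {E₁ H₁ B₁ E₂ H₂ B₂ E₃ H₃ B₃ : Type u}
    [NormedAddCommGroup E₁] [NormedSpace ℝ E₁] [TopologicalSpace H₁] [TopologicalSpace B₁]
    [ChartedSpace H₁ B₁] [NormedAddCommGroup E₂] [NormedSpace ℝ E₂] [TopologicalSpace H₂]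
    [TopologicalSpace B₂] [ChartedSpace H₂ B₂] [NormedAddCommGroup E₃] [NormedSpace ℝ E₃]
    [TopologicalSpace H₃] [TopologicalSpace B₃] [ChartedSpace H₃ B₃]
    {I₁ : ModelWithCorners ℝ E₁ H₁} {I₂ : ModelWithCorners ℝ E₂ H₂}
    {I₃ : ModelWithCorners ℝ E₃ H₃} {S₁ : Set B₁} {S₂ : Set B₂} {S₃ : Set B₃}
    (G₁ : BundleGerbe I₁ S₁) (G₂ : BundleGerbe I₂ S₂) (G₃ : BundleGerbe I₃ S₃)
    (r : B₁ → B₂ → Prop) (φ : G₁.Y → G₂.Y → G₃.Y) (φhat : G₁.P → G₂.P → G₃.P)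
    (src_φ : ∀ u v, r (G₁.π (G₁.src u)) (G₂.π (G₂.src v)) →
      G₃.src (φhat u v) = φ (G₁.src u) (G₂.src v))
    (tgt_φ : ∀ u v, r (G₁.π (G₁.src u)) (G₂.π (G₂.src v)) →
      G₃.tgt (φhat u v) = φ (G₁.tgt u) (G₂.tgt v))
    (act_φ : ∀ c u v, r (G₁.π (G₁.src u)) (G₂.π (G₂.src v)) →
      φhat (G₁.act c u) v = G₃.act c (φhat u v))
    (φ_act : ∀ c u v, r (G₁.π (G₁.src u)) (G₂.π (G₂.src v)) →
      φhat u (G₂.act c v) = G₃.act c (φhat u v))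
    (φ_mul : ∀ u' u v' v, G₁.src u' = G₁.tgt u → G₂.src v' = G₂.tgt v →
      r (G₁.π (G₁.src u)) (G₂.π (G₂.src v)) →
      φhat (G₁.mul u' u) (G₂.mul v' v) = G₃.mul (φhat u' v') (φhat u v)) :
    ∃ ν : G₁.Y → G₂.Y → Additive ℂˣ, ∀ u v, r (G₁.π (G₁.src u)) (G₂.π (G₂.src v)) →
      G₃.phase (φhat u v) = G₁.phase u + G₂.phase v + ν (G₁.tgt u) (G₂.tgt v) -
        ν (G₁.src u) (G₂.src v) := by
  refine ⟨fun y y' => G₃.phase (φhat (G₁.link y) (G₂.link y')), fun u v h => ?_⟩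
  have hl : r (G₁.π (G₁.src (G₁.link (G₁.src u)))) (G₂.π (G₂.src (G₂.link (G₂.src v)))) := by
    rwa [π_src, π_src, tgt_link, tgt_link]
  have hl' : r (G₁.π (G₁.src (G₁.link (G₁.tgt u)))) (G₂.π (G₂.src (G₂.link (G₂.tgt v)))) := by
    rwa [π_src, π_src, tgt_link, tgt_link, ← π_src, ← π_src]
  have h₁ := (G₁.tgt_link (G₁.src u)).symm
  have h₂ := (G₂.tgt_link (G₂.src v)).symm
  -- The composites of `u` and `v` with links are multiples of links. Compatibility with products
  -- therefore expresses the phase of `φhat u v` through values of `φhat` on pairs of links.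
  have h₃ := φ_mul u _ v _ h₁ h₂ hl
  rw [mul_link, mul_link, act_φ, φ_act _ _ _ hl'] at h₃
  swap
  · rwa [src_act]
  have h₄ := congrArg G₃.phase h₃
  rw [phase_mul, phase_act, phase_act, ofMul_toMul, ofMul_toMul] at h₄
  · rw [eq_sub_iff_add_eq, ← h₄, add_assoc]
  · rw [src_φ _ _ h, tgt_φ _ _ hl, ← h₁, ← h₂]

/-! ## Algebra of bundle 2-gerbes in coordinates -/

namespace Bundle2Gerbe

open BundleGerbe

variable {M : SmoothManifold.{u}} (𝒬 : Bundle2Gerbe M)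

theorem π_fst_eq (y : 𝒬.Q.Y) : 𝒬.π (𝒬.Q.π y).1 = 𝒬.π (𝒬.Q.π y).2 := by
  have h : 𝒬.Q.π y ∈ range 𝒬.Q.π := mem_range_self y
  rwa [𝒬.Q.admitsLocalSections.range_eq] at h

variable {𝒬} in
theorem exists_Y {x x' : 𝒬.X} (h : 𝒬.π x = 𝒬.π x') : ∃ y, 𝒬.Q.π y = (x, x') := by
  have h' : ((x, x') : 𝒬.X × 𝒬.X) ∈ {w : 𝒬.X × 𝒬.X | 𝒬.π w.1 = 𝒬.π w.2} := h
  rwa [← 𝒬.Q.admitsLocalSections.range_eq] at h'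

theorem exists_ν : ∃ ν : 𝒬.Q.Y → 𝒬.Q.Y → Additive ℂˣ, ∀ u v,
    (𝒬.Q.π (𝒬.Q.src u)).1 = (𝒬.Q.π (𝒬.Q.src v)).2 →
      𝒬.Q.phase (𝒬.mhat u v) = 𝒬.Q.phase u + 𝒬.Q.phase v + ν (𝒬.Q.tgt u) (𝒬.Q.tgt v) -
        ν (𝒬.Q.src u) (𝒬.Q.src v) :=
  exists_pairing_phase 𝒬.Q 𝒬.Q 𝒬.Q (fun b b' => b.1 = b'.2) 𝒬.m 𝒬.mhat 𝒬.src_mhat 𝒬.tgt_mhat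
    𝒬.act_mhat 𝒬.mhat_act 𝒬.mhat_mul

/-- The coordinate expression of the multiplication of a bundle 2-gerbe. -/
noncomputable def ν : 𝒬.Q.Y → 𝒬.Q.Y → Additive ℂˣ := Classical.choose 𝒬.exists_ν

variable {𝒬} in
theorem phase_mhat {u v : 𝒬.Q.P} (h : (𝒬.Q.π (𝒬.Q.src u)).1 = (𝒬.Q.π (𝒬.Q.src v)).2) :
    𝒬.Q.phase (𝒬.mhat u v) = 𝒬.Q.phase u + 𝒬.Q.phase v + 𝒬.ν (𝒬.Q.tgt u) (𝒬.Q.tgt v) -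
      𝒬.ν (𝒬.Q.src u) (𝒬.Q.src v) := Classical.choose_spec 𝒬.exists_ν u v h

/-- The coordinate expression of the associator, normalised so as to depend on the base points
only. -/
noncomputable def assocDefect (y₃₄ y₂₃ y₁₂ : 𝒬.Q.Y) : Additive ℂˣ :=
  𝒬.Q.phase (𝒬.a y₃₄ y₂₃ y₁₂) + 𝒬.ν (𝒬.m y₃₄ y₂₃) y₁₂ + 𝒬.ν y₃₄ y₂₃ - 𝒬.ν y₃₄ (𝒬.m y₂₃ y₁₂) -
    𝒬.ν y₂₃ y₁₂

/-- This is the descent condition on `a` read in phases: those of the three arrows occur on both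
sides and cancel, leaving the `ν`-terms at the two ends. -/
theorem assocDefect_tgt {u₃₄ u₂₃ u₁₂ : 𝒬.Q.P}
    (h : (𝒬.Q.π (𝒬.Q.src u₃₄)).1 = (𝒬.Q.π (𝒬.Q.src u₂₃)).2)
    (h' : (𝒬.Q.π (𝒬.Q.src u₂₃)).1 = (𝒬.Q.π (𝒬.Q.src u₁₂)).2) :
    𝒬.assocDefect (𝒬.Q.tgt u₃₄) (𝒬.Q.tgt u₂₃) (𝒬.Q.tgt u₁₂) =
      𝒬.assocDefect (𝒬.Q.src u₃₄) (𝒬.Q.src u₂₃) (𝒬.Q.src u₁₂) := by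
  have ht : (𝒬.Q.π (𝒬.Q.tgt u₃₄)).1 = (𝒬.Q.π (𝒬.Q.tgt u₂₃)).2 := by rwa [← π_src, ← π_src]
  have ht' : (𝒬.Q.π (𝒬.Q.tgt u₂₃)).1 = (𝒬.Q.π (𝒬.Q.tgt u₁₂)).2 := by rwa [← π_src, ← π_src]
  have h₁ : (𝒬.Q.π (𝒬.Q.src (𝒬.mhat u₃₄ u₂₃))).1 = (𝒬.Q.π (𝒬.Q.src u₁₂)).2 := by
    rw [𝒬.src_mhat _ _ h, 𝒬.proj_m _ _ h]; exact h'
  have h₂ : (𝒬.Q.π (𝒬.Q.src u₃₄)).1 = (𝒬.Q.π (𝒬.Q.src (𝒬.mhat u₂₃ u₁₂))).2 := by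
    rw [𝒬.src_mhat _ _ h', 𝒬.proj_m _ _ h']; exact h
  have key := congrArg 𝒬.Q.phase (𝒬.descent_a u₃₄ u₂₃ u₁₂ h h')
  rw [phase_mul, phase_mul, phase_mhat h₁, phase_mhat h, phase_mhat h₂, phase_mhat h',
    𝒬.src_mhat _ _ h, 𝒬.src_mhat _ _ h', 𝒬.tgt_mhat _ _ h, 𝒬.tgt_mhat _ _ h'] at key
  · rw [assocDefect, assocDefect]
    grind
  · rw [𝒬.src_mhat _ _ h₂, 𝒬.src_mhat _ _ h', (𝒬.proj_a _ _ _ h h').2]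
  · rw [𝒬.tgt_mhat _ _ h₁, 𝒬.tgt_mhat _ _ h, (𝒬.proj_a _ _ _ ht ht').1]

open Classical in
/-- A point of `Y` over a given point of `X^[2]`. -/
noncomputable def point (x x' : 𝒬.X) : 𝒬.Q.Y :=
  if h : 𝒬.π x = 𝒬.π x' then (exists_Y h).choose else (exists_Y (Eq.refl (𝒬.π x))).choose

variable {𝒬} in
theorem π_point {x x' : 𝒬.X} (h : 𝒬.π x = 𝒬.π x') : 𝒬.Q.π (𝒬.point x x') = (x, x') := by
  rw [point, dif_pos h]
  exact (exists_Y h).choose_spec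

/-- The associator in coordinates, a function on `X^[4]`. -/
noncomputable def α (x₁ x₂ x₃ x₄ : 𝒬.X) : Additive ℂˣ :=
  𝒬.assocDefect (𝒬.point x₃ x₄) (𝒬.point x₂ x₃) (𝒬.point x₁ x₂)

variable {𝒬}

/-- Arrows to the reference points `point` over the same base points carry the defect over, by
`assocDefect_tgt`. -/
theorem phase_a {y₃₄ y₂₃ y₁₂ : 𝒬.Q.Y} (h : (𝒬.Q.π y₃₄).1 = (𝒬.Q.π y₂₃).2)
    (h' : (𝒬.Q.π y₂₃).1 = (𝒬.Q.π y₁₂).2) :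
    𝒬.Q.phase (𝒬.a y₃₄ y₂₃ y₁₂) =
      𝒬.α (𝒬.Q.π y₁₂).1 (𝒬.Q.π y₁₂).2 (𝒬.Q.π y₂₃).2 (𝒬.Q.π y₃₄).2 - 𝒬.ν (𝒬.m y₃₄ y₂₃) y₁₂ -
        𝒬.ν y₃₄ y₂₃ + 𝒬.ν y₃₄ (𝒬.m y₂₃ y₁₂) + 𝒬.ν y₂₃ y₁₂ := by
  have key : 𝒬.assocDefect y₃₄ y₂₃ y₁₂ =
      𝒬.α (𝒬.Q.π y₁₂).1 (𝒬.Q.π y₁₂).2 (𝒬.Q.π y₂₃).2 (𝒬.Q.π y₃₄).2 := by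
    have e₃₄ := π_point (𝒬.π_fst_eq y₃₄)
    have e₂₃ := π_point (𝒬.π_fst_eq y₂₃)
    have e₁₂ := π_point (𝒬.π_fst_eq y₁₂)
    obtain ⟨u₃₄, rfl, hu₃₄⟩ := 𝒬.Q.exists_arrow e₃₄.symm
    obtain ⟨u₂₃, rfl, hu₂₃⟩ := 𝒬.Q.exists_arrow e₂₃.symm
    obtain ⟨u₁₂, rfl, hu₁₂⟩ := 𝒬.Q.exists_arrow e₁₂.symm
    rw [α, ← 𝒬.assocDefect_tgt h h', hu₃₄, hu₂₃, hu₁₂, h, h']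
  rw [← key, assocDefect]
  abel

/-- In the phases of the pentagon identity, taken at any points of `Y` over consecutive pairs, all
`ν`-terms cancel; what remains is `δα = 0`. -/
theorem α_coherence {x₁ x₂ x₃ x₄ x₅ : 𝒬.X} (h₂ : 𝒬.π x₁ = 𝒬.π x₂) (h₃ : 𝒬.π x₁ = 𝒬.π x₃)
    (h₄ : 𝒬.π x₁ = 𝒬.π x₄) (h₅ : 𝒬.π x₁ = 𝒬.π x₅) :
    𝒬.α x₂ x₃ x₄ x₅ + 𝒬.α x₁ x₂ x₄ x₅ + 𝒬.α x₁ x₂ x₃ x₄ =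
      𝒬.α x₁ x₃ x₄ x₅ + 𝒬.α x₁ x₂ x₃ x₅ := by
  obtain ⟨y₁₂, h₁₂⟩ := exists_Y h₂
  obtain ⟨y₂₃, h₂₃⟩ := exists_Y (h₂.symm.trans h₃)
  obtain ⟨y₃₄, h₃₄⟩ := exists_Y (h₃.symm.trans h₄)
  obtain ⟨y₄₅, h₄₅⟩ := exists_Y (h₄.symm.trans h₅)
  have c₁₃ : (𝒬.Q.π y₂₃).1 = (𝒬.Q.π y₁₂).2 := by rw [h₂₃, h₁₂]
  have c₂₄ : (𝒬.Q.π y₃₄).1 = (𝒬.Q.π y₂₃).2 := by rw [h₃₄, h₂₃]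
  have c₃₅ : (𝒬.Q.π y₄₅).1 = (𝒬.Q.π y₃₄).2 := by rw [h₄₅, h₃₄]
  have h₁₃ := 𝒬.proj_m _ _ c₁₃
  have h₂₄ := 𝒬.proj_m _ _ c₂₄
  have h₃₅ := 𝒬.proj_m _ _ c₃₅
  rw [h₁₂, h₂₃] at h₁₃
  rw [h₂₃, h₃₄] at h₂₄
  rw [h₃₄, h₄₅] at h₃₅
  have d₁ : (𝒬.Q.π (𝒬.m y₃₄ y₂₃)).1 = (𝒬.Q.π y₁₂).2 := by rw [h₂₄, h₁₂]
  have d₂ : (𝒬.Q.π y₄₅).1 = (𝒬.Q.π (𝒬.m y₃₄ y₂₃)).2 := by rw [h₄₅, h₂₄]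
  have d₃ : (𝒬.Q.π y₃₄).1 = (𝒬.Q.π (𝒬.m y₂₃ y₁₂)).2 := by rw [h₃₄, h₁₃]
  have d₄ : (𝒬.Q.π (𝒬.m y₄₅ y₃₄)).1 = (𝒬.Q.π y₂₃).2 := by rw [h₃₅, h₂₃]
  have p₁ := 𝒬.proj_a _ _ _ c₂₄ c₁₃
  have p₂ := 𝒬.proj_a _ _ _ d₂ d₁
  have p₃ := 𝒬.proj_a _ _ _ c₃₅ c₂₄
  have p₄ := 𝒬.proj_a _ _ _ c₃₅ d₃
  have p₅ := 𝒬.proj_a _ _ _ d₄ c₁₃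
  have q₁ : (𝒬.Q.π (𝒬.Q.src (𝒬.Q.e y₄₅))).1 = (𝒬.Q.π (𝒬.Q.src (𝒬.a y₃₄ y₂₃ y₁₂))).2 := by
    rw [src_e, p₁.1, h₄₅, 𝒬.proj_m _ _ d₁, h₂₄]
  have q₂ : (𝒬.Q.π (𝒬.Q.src (𝒬.a y₄₅ y₃₄ y₂₃))).1 = (𝒬.Q.π (𝒬.Q.src (𝒬.Q.e y₁₂))).2 := by
    rw [src_e, p₃.1, h₁₂, 𝒬.proj_m _ _ d₄, h₂₃]
  have r₁ : 𝒬.Q.src (𝒬.a y₄₅ (𝒬.m y₃₄ y₂₃) y₁₂) =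
      𝒬.Q.tgt (𝒬.mhat (𝒬.a y₄₅ y₃₄ y₂₃) (𝒬.Q.e y₁₂)) := by
    rw [𝒬.tgt_mhat _ _ q₂, tgt_e, p₃.2, p₂.1]
  have key := congrArg 𝒬.Q.phase (𝒬.coherence_a y₄₅ y₃₄ y₂₃ y₁₂ c₃₅ c₂₄ c₁₃)
  rw [phase_mul, phase_mul r₁, phase_mul, phase_mhat q₁, phase_mhat q₂, phase_e, phase_e,
    src_e, src_e, tgt_e, tgt_e, p₁.1, p₁.2, p₃.1, p₃.2, phase_a c₂₄ c₁₃, phase_a d₂ d₁,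
    phase_a c₃₅ c₂₄, phase_a c₃₅ d₃, phase_a d₄ c₁₃] at key
  · simp only [h₁₂, h₂₃, h₃₄, h₄₅, h₁₃, h₂₄, h₃₅] at key
    grind
  · rw [p₄.1, p₅.2]
  · rw [tgt_mul r₁, 𝒬.src_mhat _ _ q₁, src_e, p₁.1, p₂.2]

namespace Trivialisation

variable (t : 𝒬.Trivialisation)

theorem exists_κ : ∃ κ : t.L.Y → 𝒬.Q.Y → Additive ℂˣ, ∀ l u,
    t.L.π (t.L.src l) = (𝒬.Q.π (𝒬.Q.src u)).2 →
      t.L.phase (t.ηhat l u) = t.L.phase l + 𝒬.Q.phase u + κ (t.L.tgt l) (𝒬.Q.tgt u) -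
        κ (t.L.src l) (𝒬.Q.src u) :=
  exists_pairing_phase t.L 𝒬.Q t.L (fun b b' => b = b'.2) t.η t.ηhat t.src_ηhat t.tgt_ηhat
    t.act_ηhat t.ηhat_act t.ηhat_mul

/-- The coordinate expression of the morphism `η` of a trivialisation. -/
noncomputable def κ : t.L.Y → 𝒬.Q.Y → Additive ℂˣ := Classical.choose t.exists_κ

variable {t} in
theorem phase_ηhat {l : t.L.P} {u : 𝒬.Q.P} (h : t.L.π (t.L.src l) = (𝒬.Q.π (𝒬.Q.src u)).2) :
    t.L.phase (t.ηhat l u) = t.L.phase l + 𝒬.Q.phase u + t.κ (t.L.tgt l) (𝒬.Q.tgt u) -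
      t.κ (t.L.src l) (𝒬.Q.src u) := Classical.choose_spec t.exists_κ l u h

/-- The coordinate expression of the transformation `θ` of a trivialisation, normalised so as to
depend on the base points only. -/
noncomputable def defect (z : t.L.Y) (y₂₃ y₁₂ : 𝒬.Q.Y) : Additive ℂˣ :=
  t.L.phase (t.θ z y₂₃ y₁₂) + t.κ z (𝒬.m y₂₃ y₁₂) + 𝒬.ν y₂₃ y₁₂ - t.κ (t.η z y₂₃) y₁₂ -
    t.κ z y₂₃

/-- The counterpart of `assocDefect_tgt`, obtained from the descent condition on `θ`. -/
theorem defect_tgt {l : t.L.P} {u₂₃ u₁₂ : 𝒬.Q.P}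
    (h : t.L.π (t.L.src l) = (𝒬.Q.π (𝒬.Q.src u₂₃)).2)
    (h' : (𝒬.Q.π (𝒬.Q.src u₂₃)).1 = (𝒬.Q.π (𝒬.Q.src u₁₂)).2) :
    t.defect (t.L.tgt l) (𝒬.Q.tgt u₂₃) (𝒬.Q.tgt u₁₂) =
      t.defect (t.L.src l) (𝒬.Q.src u₂₃) (𝒬.Q.src u₁₂) := by
  have ht : t.L.π (t.L.tgt l) = (𝒬.Q.π (𝒬.Q.tgt u₂₃)).2 := by rwa [← π_src, ← π_src]
  have ht' : (𝒬.Q.π (𝒬.Q.tgt u₂₃)).1 = (𝒬.Q.π (𝒬.Q.tgt u₁₂)).2 := by rwa [← π_src, ← π_src]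
  have h₁ : t.L.π (t.L.src l) = (𝒬.Q.π (𝒬.Q.src (𝒬.mhat u₂₃ u₁₂))).2 := by
    rw [𝒬.src_mhat _ _ h', 𝒬.proj_m _ _ h']; exact h
  have h₂ : t.L.π (t.L.src (t.ηhat l u₂₃)) = (𝒬.Q.π (𝒬.Q.src u₁₂)).2 := by
    rw [t.src_ηhat _ _ h, t.proj_η _ _ h]; exact h'
  have key := congrArg t.L.phase (t.descent_θ l u₂₃ u₁₂ h h')
  rw [phase_mul, phase_mul, phase_ηhat h₁, phase_ηhat h₂, phase_ηhat h, phase_mhat h',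
    𝒬.src_mhat _ _ h', 𝒬.tgt_mhat _ _ h', t.src_ηhat _ _ h, t.tgt_ηhat _ _ h] at key
  · rw [defect, defect]
    grind
  · rw [t.src_ηhat _ _ h₂, t.src_ηhat _ _ h, (t.proj_θ _ _ _ h h').2]
  · rw [t.tgt_ηhat _ _ h₁, 𝒬.tgt_mhat _ _ h', (t.proj_θ _ _ _ ht ht').1]

theorem exists_Z (x : 𝒬.X) : ∃ z, t.L.π z = x := by
  rw [← mem_range, t.L.admitsLocalSections.range_eq]
  trivial

/-- The transformation `θ` in coordinates, a function on `X^[3]`. -/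
noncomputable def β (x₁ x₂ x₃ : 𝒬.X) : Additive ℂˣ :=
  t.defect (t.exists_Z x₃).choose (𝒬.point x₂ x₃) (𝒬.point x₁ x₂)

variable {t}

theorem phase_θ {z : t.L.Y} {y₂₃ y₁₂ : 𝒬.Q.Y} (h : t.L.π z = (𝒬.Q.π y₂₃).2)
    (h' : (𝒬.Q.π y₂₃).1 = (𝒬.Q.π y₁₂).2) :
    t.L.phase (t.θ z y₂₃ y₁₂) = t.β (𝒬.Q.π y₁₂).1 (𝒬.Q.π y₁₂).2 (𝒬.Q.π y₂₃).2 -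
      t.κ z (𝒬.m y₂₃ y₁₂) - 𝒬.ν y₂₃ y₁₂ + t.κ (t.η z y₂₃) y₁₂ + t.κ z y₂₃ := by
  have key : t.defect z y₂₃ y₁₂ = t.β (𝒬.Q.π y₁₂).1 (𝒬.Q.π y₁₂).2 (𝒬.Q.π y₂₃).2 := by
    have e := (t.exists_Z (t.L.π z)).choose_spec
    have e₂₃ := π_point (𝒬.π_fst_eq y₂₃)
    have e₁₂ := π_point (𝒬.π_fst_eq y₁₂)
    obtain ⟨l, rfl, hl⟩ := t.L.exists_arrow e.symm
    obtain ⟨u₂₃, rfl, hu₂₃⟩ := 𝒬.Q.exists_arrow e₂₃.symm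
    obtain ⟨u₁₂, rfl, hu₁₂⟩ := 𝒬.Q.exists_arrow e₁₂.symm
    rw [β, ← t.defect_tgt h h', hl, hu₂₃, hu₁₂, h, h']
  rw [← key, defect]
  abel

/-- The condition `δ(θ) = a` read in phases: the `ν`- and `κ`-terms cancel and `δβ = α` remains. -/
theorem β_coherence {x₁ x₂ x₃ x₄ : 𝒬.X} (h₂ : 𝒬.π x₁ = 𝒬.π x₂) (h₃ : 𝒬.π x₁ = 𝒬.π x₃)
    (h₄ : 𝒬.π x₁ = 𝒬.π x₄) :
    t.β x₁ x₂ x₃ + t.β x₁ x₃ x₄ + 𝒬.α x₁ x₂ x₃ x₄ = t.β x₂ x₃ x₄ + t.β x₁ x₂ x₄ := by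
  obtain ⟨y₁₂, h₁₂⟩ := exists_Y h₂
  obtain ⟨y₂₃, h₂₃⟩ := exists_Y (h₂.symm.trans h₃)
  obtain ⟨y₃₄, h₃₄⟩ := exists_Y (h₃.symm.trans h₄)
  obtain ⟨z, hz⟩ := t.exists_Z x₄
  have c₁₃ : (𝒬.Q.π y₂₃).1 = (𝒬.Q.π y₁₂).2 := by rw [h₂₃, h₁₂]
  have c₂₄ : (𝒬.Q.π y₃₄).1 = (𝒬.Q.π y₂₃).2 := by rw [h₃₄, h₂₃]
  have c₃ : t.L.π z = (𝒬.Q.π y₃₄).2 := by rw [hz, h₃₄]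
  have h₁₃ := 𝒬.proj_m _ _ c₁₃
  have h₂₄ := 𝒬.proj_m _ _ c₂₄
  have hz' := t.proj_η _ _ c₃
  rw [h₁₂, h₂₃] at h₁₃
  rw [h₂₃, h₃₄] at h₂₄
  rw [h₃₄] at hz'
  have d₁ : (𝒬.Q.π (𝒬.m y₃₄ y₂₃)).1 = (𝒬.Q.π y₁₂).2 := by rw [h₂₄, h₁₂]
  have d₂ : t.L.π z = (𝒬.Q.π (𝒬.m y₃₄ y₂₃)).2 := by rw [hz, h₂₄]
  have d₃ : (𝒬.Q.π y₃₄).1 = (𝒬.Q.π (𝒬.m y₂₃ y₁₂)).2 := by rw [h₃₄, h₁₃]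
  have d₄ : t.L.π (t.η z y₃₄) = (𝒬.Q.π y₂₃).2 := by rw [hz', h₂₃]
  have p₁ := 𝒬.proj_a _ _ _ c₂₄ c₁₃
  have p₂ := t.proj_θ _ _ _ d₂ d₁
  have p₃ := t.proj_θ _ _ _ c₃ c₂₄
  have p₄ := t.proj_θ _ _ _ c₃ d₃
  have p₅ := t.proj_θ _ _ _ d₄ c₁₃
  have q₁ : t.L.π (t.L.src (t.L.e z)) = (𝒬.Q.π (𝒬.Q.src (𝒬.a y₃₄ y₂₃ y₁₂))).2 := by
    rw [src_e, p₁.1, hz, 𝒬.proj_m _ _ d₁, h₂₄]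
  have q₂ : t.L.π (t.L.src (t.θ z y₃₄ y₂₃)) = (𝒬.Q.π (𝒬.Q.src (𝒬.Q.e y₁₂))).2 := by
    rw [src_e, p₃.1, h₁₂, t.proj_η _ _ d₂, h₂₄]
  have r₁ : t.L.src (t.θ z y₃₄ (𝒬.m y₂₃ y₁₂)) =
      t.L.tgt (t.ηhat (t.L.e z) (𝒬.a y₃₄ y₂₃ y₁₂)) := by
    rw [t.tgt_ηhat _ _ q₁, tgt_e, p₁.2, p₄.1]
  have key := congrArg t.L.phase (t.coherence_θ z y₃₄ y₂₃ y₁₂ c₃ c₂₄ c₁₃)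
  rw [phase_mul, phase_mul r₁, phase_mul, phase_ηhat q₁, phase_ηhat q₂, phase_e, phase_e,
    src_e, src_e, tgt_e, tgt_e, p₁.1, p₁.2, p₃.1, p₃.2, phase_a c₂₄ c₁₃, phase_θ d₂ d₁,
    phase_θ c₃ c₂₄, phase_θ c₃ d₃, phase_θ d₄ c₁₃] at key
  · simp only [h₁₂, h₂₃, h₃₄, h₁₃, h₂₄] at key
    grind
  · rw [t.src_ηhat _ _ q₂, src_e, p₃.1, p₂.2]
  · rw [tgt_mul r₁, p₄.2, p₅.1]

end Trivialisation

end Bundle2Gerbe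

/-! ## Refinements of pointed covers -/

namespace PointedCover

variable {M : Type u} [TopologicalSpace M]

/-- On a paracompact space, choices which can be made locally on the `(p + 1)`-fold intersections
of a cover can be made on all `(p + 1)`-fold intersections of a suitable refinement. -/
theorem exists_refinement [TopologicalSpace.MetrizableSpace M] (𝒰 : PointedCover M) {p : ℕ}
    (P : (Fin (p + 1) → M) → Set M → Prop)
    (mono : ∀ τ O O', O' ⊆ O → P τ O → P τ O') (empty : ∀ τ, P τ ∅)
    (loc : ∀ τ, ∀ x ∈ 𝒰.inter τ, ∃ O, IsOpen O ∧ x ∈ O ∧ P τ O) :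
    ∃ (𝒱 : PointedCover M) (r : M → M), (∀ x, 𝒱.U x ⊆ 𝒰.U (r x)) ∧
      ∀ τ, P (r ∘ τ) (𝒱.inter τ) := by
  let := TopologicalSpace.metrizableSpaceMetric M
  -- `W` is a locally finite refinement with the same index set and `C` a shrinking of it. The
  -- closures of the `C i` are again locally finite, so only finitely many tuples are relevant at a
  -- given point.
  obtain ⟨W, hWo, hWU, hWf, hWs⟩ := precise_refinement 𝒰.U 𝒰.isOpen_U
    (iUnion_eq_univ_iff.2 fun x => ⟨x, 𝒰.mem_U x⟩)
  obtain ⟨C, hCU, hCo, hCW⟩ := exists_iUnion_eq_closure_subset hWo hWf.point_finite hWU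
  have hCf : LocallyFinite fun i => closure (C i) := hWf.subset hCW
  choose r hr using fun x => iUnion_eq_univ_iff.1 hCU x
  choose! O hO hxO hPO using loc
  let F (x : M) : Set (Fin (p + 1) → M) := {τ | ∀ i, x ∈ closure (C (τ i))}
  have hF : ∀ x, (F x).Finite := fun x => Set.Finite.pi' fun _ => hCf.point_finite x
  have hFU : ∀ x, ∀ τ ∈ F x, x ∈ 𝒰.inter τ := fun x τ hτ =>
    mem_iInter.2 fun i => hWs _ (hCW _ (hτ i))
  -- Removing the closures that miss `x` guarantees that `x` lies in the closure of every `C i` that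
  -- meets `V x`.
  let V (x : M) : Set M := interior (C (r x) ∩ ((⋂ i, ⋂ _ : x ∉ closure (C i), (closure (C i))ᶜ) ∩
    ⋂ τ ∈ F x, O τ x))
  have hV : ∀ x, V x ⊆ C (r x) ∩ ((⋂ i, ⋂ _ : x ∉ closure (C i), (closure (C i))ᶜ) ∩
    ⋂ τ ∈ F x, O τ x) := fun x => interior_subset
  refine ⟨⟨V, fun x => isOpen_interior, fun x => mem_interior_iff_mem_nhds.2 ?_⟩, r,
    fun x y hy => hWs _ (hCW _ (subset_closure (hV x hy).1)), fun τ => ?_⟩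
  · exact inter_mem ((hCo _).mem_nhds (hr x)) (inter_mem
      (hCf.iInter_compl_mem_nhds (fun _ => isClosed_closure) x)
      ((biInter_mem (hF x)).2 fun τ hτ => (hO τ x (hFU x τ hτ)).mem_nhds (hxO τ x (hFU x τ hτ))))
  · rcases eq_empty_or_nonempty (inter ⟨V, fun x => isOpen_interior, _⟩ τ) with h | ⟨y, hy⟩
    · rw [h]
      exact empty _
    · have hyV : ∀ i, y ∈ V (τ i) := mem_iInter.1 hy
      -- The common point `y` shows that each `C (r (τ i))` meets `V (τ 0)`, so `V (τ 0)` was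
      -- already chosen inside the good neighbourhood for the tuple `r ∘ τ`.
      have hτ : r ∘ τ ∈ F (τ 0) := by
        intro i
        by_contra h
        exact mem_iInter₂.1 (hV _ (hyV 0)).2.1 (r (τ i)) h (subset_closure (hV _ (hyV i)).1)
      refine mono _ _ _ ?_ (hPO (r ∘ τ) (τ 0) (hFU _ _ hτ))
      intro z hz
      exact mem_iInter₂.1 (hV _ (mem_iInter.1 hz 0)).2.2 _ hτ

theorem isOpen_inter (𝒰 : PointedCover M) {p : ℕ} (τ : Fin (p + 1) → M) : IsOpen (𝒰.inter τ) :=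
  isOpen_iInter_of_finite fun _ => 𝒰.isOpen_U _

theorem mem_inter {𝒰 : PointedCover M} {p : ℕ} {τ : Fin (p + 1) → M} {x : M} :
    x ∈ 𝒰.inter τ ↔ ∀ i, x ∈ 𝒰.U (τ i) := mem_iInter

end PointedCover

/-! ## Smooth functions and their logarithms -/

section Exp

/-- Near `x` the quotient `g y / g x` stays in the slit plane, where the principal logarithm is
smooth; a logarithm of `g x` is added back as a constant. -/
theorem exists_local_log {M : SmoothManifold.{u}} {T : Set M} (hT : IsOpen T) {g : M → ℂˣ}
    (hg : ContMDiffOn M.I 𝓘(ℝ, ℂ) ∞ g T) {x : M} (hx : x ∈ T) : ∃ (O : Set M) (f : M → ℂ),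
      IsOpen O ∧ x ∈ O ∧ ContMDiffOn M.I 𝓘(ℝ, ℂ) ∞ f O ∧
        ∀ y ∈ O, (g y : ℂ) = Complex.exp (2 * Real.pi * Complex.I * f y) := by
  have hg' : ContMDiffOn M.I 𝓘(ℝ, ℂ) ∞ (fun y => (g y : ℂ)) T :=
    (Units.contMDiff_val (𝕜 := ℝ) (R := ℂ)).comp_contMDiffOn hg
  have hpi : (2 * Real.pi * Complex.I : ℂ) ≠ 0 := Complex.two_pi_I_ne_zero
  have hq : ContMDiffOn M.I 𝓘(ℝ, ℂ) ∞ (fun y => (g x : ℂ)⁻¹ * (g y : ℂ)) T :=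
    (contDiff_const.mul (𝕜 := ℝ) (contDiff_id (E := ℂ))).contMDiff.comp_contMDiffOn hg'
  have hO := hq.continuousOn.isOpen_inter_preimage hT Complex.isOpen_slitPlane
  refine ⟨_, fun y => (2 * Real.pi * Complex.I)⁻¹ *
    (Complex.log (g x) + Complex.log ((g x : ℂ)⁻¹ * (g y : ℂ))), hO, ⟨hx, ?_⟩, ?_, fun y hy => ?_⟩
  · simp [Complex.one_mem_slitPlane]
  · have hlog : ContDiffOn ℝ ∞ (fun z : ℂ => (2 * Real.pi * Complex.I : ℂ)⁻¹ *
        (Complex.log (g x) + Complex.log z)) Complex.slitPlane := fun z hz =>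
      (contDiffAt_const.mul (contDiffAt_const.add
        ((Complex.contDiffAt_log hz).restrict_scalars ℝ))).contDiffWithinAt
    exact hlog.contMDiffOn.comp (hq.mono inter_subset_left) fun y hy => hy.2
  · rw [mul_inv_cancel_left₀ hpi, Complex.exp_add, Complex.exp_log (g x).ne_zero, Complex.exp_log,
      mul_inv_cancel_left₀ (g x).ne_zero]
    exact mul_ne_zero (inv_ne_zero (g x).ne_zero) (g y).ne_zero

theorem exp_eq_one_iff_int {z : ℂ} :
    Complex.exp (2 * Real.pi * Complex.I * z) = 1 ↔ ∃ n : ℤ, z = n := by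
  rw [Complex.exp_eq_one_iff]
  refine exists_congr fun n => ?_
  rw [mul_comm, mul_left_inj' Complex.two_pi_I_ne_zero]

/-- A continuous function on a subspace with integral values comes from a locally constant integral
function. -/
theorem exists_locallyConstant {M : Type u} [TopologicalSpace M] {T : Set M} {f : M → ℂ}
    (hf : ContinuousOn f T) (h : ∀ x ∈ T, ∃ n : ℤ, f x = n) :
    ∃ n : LocallyConstant T ℤ, ∀ x : T, ((n x : ℤ) : ℂ) = f x := by
  choose n hn using fun x : T => h x x.2
  refine ⟨⟨n, (IsLocallyConstant.iff_continuous n).2 ?_⟩, fun x => (hn x).symm⟩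
  rw [Complex.isClosedEmbedding_intCast.isInducing.continuous_iff]
  exact (continuousOn_iff_continuous_domRestrict.1 hf).congr hn

end Exp

namespace Bundle2Gerbe

open BundleGerbe

variable {M : SmoothManifold.{u}} {𝒬 : Bundle2Gerbe M}

/-! ### Smooth families -/

section Smooth

variable {N : SmoothManifold.{u}} {T : Set N}

theorem contMDiffOn_m {f f' : N → 𝒬.Q.Y} (hf : ContMDiffOn N.I 𝒬.Q.Y.I ∞ f T)
    (hf' : ContMDiffOn N.I 𝒬.Q.Y.I ∞ f' T) (h : ∀ x ∈ T, (𝒬.Q.π (f x)).1 = (𝒬.Q.π (f' x)).2) :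
    ContMDiffOn N.I 𝒬.Q.Y.I ∞ (fun x => 𝒬.m (f x) (f' x)) T :=
  𝒬.smooth_m.comp (hf.prodMk hf') fun x hx => h x hx

theorem smoothInto_a {f f' f'' : N → 𝒬.Q.Y} (hf : ContMDiffOn N.I 𝒬.Q.Y.I ∞ f T)
    (hf' : ContMDiffOn N.I 𝒬.Q.Y.I ∞ f' T) (hf'' : ContMDiffOn N.I 𝒬.Q.Y.I ∞ f'' T)
    (h : ∀ x ∈ T, (𝒬.Q.π (f x)).1 = (𝒬.Q.π (f' x)).2)
    (h' : ∀ x ∈ T, (𝒬.Q.π (f' x)).1 = (𝒬.Q.π (f'' x)).2) :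
    𝒬.Q.SmoothInto N.I (fun x => 𝒬.a (f x) (f' x) (f'' x)) T :=
  𝒬.smooth_a.comp (hf.prodMk (hf'.prodMk hf'')) fun x hx => ⟨h x hx, h' x hx⟩

end Smooth

/-! ### The two composites around a tetrahedron -/

variable (𝒬) in
/-- The composite `(y₃₄ ∘ y₂₃) ∘ y₁₂ → y₁₄` through `y₂₄ ∘ y₁₂`. -/
noncomputable def outerFaces (u₁₂₄ u₂₃₄ : 𝒬.Q.P) (y₁₂ : 𝒬.Q.Y) : 𝒬.Q.P :=
  𝒬.Q.mul u₁₂₄ (𝒬.mhat u₂₃₄ (𝒬.Q.e y₁₂))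

variable (𝒬) in
/-- The composite `(y₃₄ ∘ y₂₃) ∘ y₁₂ → y₁₄` through `y₃₄ ∘ y₁₃`. -/
noncomputable def innerFaces (u₁₃₄ u₁₂₃ : 𝒬.Q.P) (y₃₄ y₂₃ y₁₂ : 𝒬.Q.Y) : 𝒬.Q.P :=
  𝒬.Q.mul u₁₃₄ (𝒬.Q.mul (𝒬.mhat (𝒬.Q.e y₃₄) u₁₂₃) (𝒬.a y₃₄ y₂₃ y₁₂))

section Tetrahedron

variable {y₁₂ y₂₃ y₃₄ y₁₃ y₂₄ y₁₄ : 𝒬.Q.Y} {u₁₂₃ u₂₃₄ u₁₂₄ u₁₃₄ : 𝒬.Q.P}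

theorem outerFaces_composable (h : (𝒬.Q.π y₃₄).1 = (𝒬.Q.π y₂₃).2)
    (h' : (𝒬.Q.π y₂₃).1 = (𝒬.Q.π y₁₂).2)
    (h₂₃₄ : 𝒬.Q.src u₂₃₄ = 𝒬.m y₃₄ y₂₃ ∧ 𝒬.Q.tgt u₂₃₄ = y₂₄)
    (h₁₂₄ : 𝒬.Q.src u₁₂₄ = 𝒬.m y₂₄ y₁₂ ∧ 𝒬.Q.tgt u₁₂₄ = y₁₄) :
    (𝒬.Q.π (𝒬.Q.src u₂₃₄)).1 = (𝒬.Q.π (𝒬.Q.src (𝒬.Q.e y₁₂))).2 ∧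
      𝒬.Q.src u₁₂₄ = 𝒬.Q.tgt (𝒬.mhat u₂₃₄ (𝒬.Q.e y₁₂)) := by
  have h₁ : (𝒬.Q.π (𝒬.Q.src u₂₃₄)).1 = (𝒬.Q.π (𝒬.Q.src (𝒬.Q.e y₁₂))).2 := by
    rw [src_e, h₂₃₄.1, 𝒬.proj_m _ _ h, h']
  exact ⟨h₁, by rw [𝒬.tgt_mhat _ _ h₁, tgt_e, h₂₃₄.2, h₁₂₄.1]⟩

theorem innerFaces_composable (h : (𝒬.Q.π y₃₄).1 = (𝒬.Q.π y₂₃).2)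
    (h' : (𝒬.Q.π y₂₃).1 = (𝒬.Q.π y₁₂).2)
    (h₁₂₃ : 𝒬.Q.src u₁₂₃ = 𝒬.m y₂₃ y₁₂ ∧ 𝒬.Q.tgt u₁₂₃ = y₁₃)
    (h₁₃₄ : 𝒬.Q.src u₁₃₄ = 𝒬.m y₃₄ y₁₃ ∧ 𝒬.Q.tgt u₁₃₄ = y₁₄) :
    (𝒬.Q.π (𝒬.Q.src (𝒬.Q.e y₃₄))).1 = (𝒬.Q.π (𝒬.Q.src u₁₂₃)).2 ∧
      𝒬.Q.src (𝒬.mhat (𝒬.Q.e y₃₄) u₁₂₃) = 𝒬.Q.tgt (𝒬.a y₃₄ y₂₃ y₁₂) ∧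
      𝒬.Q.src u₁₃₄ =
        𝒬.Q.tgt (𝒬.Q.mul (𝒬.mhat (𝒬.Q.e y₃₄) u₁₂₃) (𝒬.a y₃₄ y₂₃ y₁₂)) := by
  have h₁ : (𝒬.Q.π (𝒬.Q.src (𝒬.Q.e y₃₄))).1 = (𝒬.Q.π (𝒬.Q.src u₁₂₃)).2 := by
    rw [src_e, h₁₂₃.1, 𝒬.proj_m _ _ h', h]
  have h₂ : 𝒬.Q.src (𝒬.mhat (𝒬.Q.e y₃₄) u₁₂₃) = 𝒬.Q.tgt (𝒬.a y₃₄ y₂₃ y₁₂) := by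
    rw [𝒬.src_mhat _ _ h₁, src_e, h₁₂₃.1, (𝒬.proj_a _ _ _ h h').2]
  exact ⟨h₁, h₂, by rw [tgt_mul h₂, 𝒬.tgt_mhat _ _ h₁, tgt_e, h₁₂₃.2, h₁₃₄.1]⟩

theorem outerFaces_spec (h : (𝒬.Q.π y₃₄).1 = (𝒬.Q.π y₂₃).2)
    (h' : (𝒬.Q.π y₂₃).1 = (𝒬.Q.π y₁₂).2)
    (h₂₃₄ : 𝒬.Q.src u₂₃₄ = 𝒬.m y₃₄ y₂₃ ∧ 𝒬.Q.tgt u₂₃₄ = y₂₄)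
    (h₁₂₄ : 𝒬.Q.src u₁₂₄ = 𝒬.m y₂₄ y₁₂ ∧ 𝒬.Q.tgt u₁₂₄ = y₁₄) :
    𝒬.Q.src (𝒬.outerFaces u₁₂₄ u₂₃₄ y₁₂) = 𝒬.m (𝒬.m y₃₄ y₂₃) y₁₂ ∧
      𝒬.Q.tgt (𝒬.outerFaces u₁₂₄ u₂₃₄ y₁₂) = y₁₄ ∧
      𝒬.Q.phase (𝒬.outerFaces u₁₂₄ u₂₃₄ y₁₂) = 𝒬.Q.phase u₁₂₄ + 𝒬.Q.phase u₂₃₄ +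
        𝒬.ν y₂₄ y₁₂ - 𝒬.ν (𝒬.m y₃₄ y₂₃) y₁₂ := by
  obtain ⟨h₁, h₂⟩ := outerFaces_composable h h' h₂₃₄ h₁₂₄
  refine ⟨?_, ?_, ?_⟩
  · rw [outerFaces, src_mul h₂, 𝒬.src_mhat _ _ h₁, src_e, h₂₃₄.1]
  · rw [outerFaces, tgt_mul h₂, h₁₂₄.2]
  · rw [outerFaces, phase_mul h₂, phase_mhat h₁, phase_e, src_e, tgt_e, h₂₃₄.1, h₂₃₄.2]
    abel

theorem innerFaces_spec (h : (𝒬.Q.π y₃₄).1 = (𝒬.Q.π y₂₃).2)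
    (h' : (𝒬.Q.π y₂₃).1 = (𝒬.Q.π y₁₂).2)
    (h₁₂₃ : 𝒬.Q.src u₁₂₃ = 𝒬.m y₂₃ y₁₂ ∧ 𝒬.Q.tgt u₁₂₃ = y₁₃)
    (h₁₃₄ : 𝒬.Q.src u₁₃₄ = 𝒬.m y₃₄ y₁₃ ∧ 𝒬.Q.tgt u₁₃₄ = y₁₄) :
    𝒬.Q.src (𝒬.innerFaces u₁₃₄ u₁₂₃ y₃₄ y₂₃ y₁₂) = 𝒬.m (𝒬.m y₃₄ y₂₃) y₁₂ ∧
      𝒬.Q.tgt (𝒬.innerFaces u₁₃₄ u₁₂₃ y₃₄ y₂₃ y₁₂) = y₁₄ ∧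
      𝒬.Q.phase (𝒬.innerFaces u₁₃₄ u₁₂₃ y₃₄ y₂₃ y₁₂) = 𝒬.Q.phase u₁₃₄ + 𝒬.Q.phase u₁₂₃ +
        𝒬.ν y₃₄ y₁₃ + 𝒬.ν y₂₃ y₁₂ - 𝒬.ν y₃₄ y₂₃ - 𝒬.ν (𝒬.m y₃₄ y₂₃) y₁₂ +
        𝒬.α (𝒬.Q.π y₁₂).1 (𝒬.Q.π y₁₂).2 (𝒬.Q.π y₂₃).2 (𝒬.Q.π y₃₄).2 := by
  obtain ⟨h₁, h₂, h₃⟩ := innerFaces_composable h h' h₁₂₃ h₁₃₄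
  refine ⟨?_, ?_, ?_⟩
  · rw [innerFaces, src_mul h₃, src_mul h₂, (𝒬.proj_a _ _ _ h h').1]
  · rw [innerFaces, tgt_mul h₃, h₁₃₄.2]
  · rw [innerFaces, phase_mul h₃, phase_mul h₂, phase_mhat h₁, phase_a h h', phase_e, src_e, tgt_e,
      h₁₂₃.1, h₁₂₃.2]
    abel

end Tetrahedron

/-! ### Čech data -/

namespace CechData

variable {𝒰 : PointedCover M} (D : 𝒬.CechData 𝒰)

/-- The coordinate expression of `ρ`. -/
noncomputable def R (i j k : M) (x : M) : Additive ℂˣ :=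
  𝒬.Q.phase (D.ρ i j k x) + 𝒬.ν (D.σ j k x) (D.σ i j x)

variable {D} in
theorem composable_σ {i j k x : M} (hi : x ∈ 𝒰.U i) (hj : x ∈ 𝒰.U j) (hk : x ∈ 𝒰.U k) :
    (𝒬.Q.π (D.σ j k x)).1 = (𝒬.Q.π (D.σ i j x)).2 := by
  rw [D.proj_σ j k x ⟨hj, hk⟩, D.proj_σ i j x ⟨hi, hj⟩]

/-- The phases of the two composites around the tetrahedron are compared. `R` absorbs the `ν`-terms
at the faces, and the rest reads `g = δR - α(s)`. -/
theorem ofMul_g_add_α {i j k l x : M} (hi : x ∈ 𝒰.U i) (hj : x ∈ 𝒰.U j) (hk : x ∈ 𝒰.U k)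
    (hl : x ∈ 𝒰.U l) :
    Additive.ofMul (D.g ![i, j, k, l] x) + 𝒬.α (D.s i x) (D.s j x) (D.s k x) (D.s l x) =
      D.R j k l x - D.R i k l x + D.R i j l x - D.R i j k x := by
  have c := composable_σ (D := D) hj hk hl
  have c' := composable_σ (D := D) hi hj hk
  have key := congrArg 𝒬.Q.phase (D.g_spec i j k l x ⟨⟨⟨hi, hj⟩, hk⟩, hl⟩)
  rw [phase_act] at key
  have h₁ := (outerFaces_spec c c' (D.proj_ρ j k l x ⟨⟨hj, hk⟩, hl⟩)
    (D.proj_ρ i j l x ⟨⟨hi, hj⟩, hl⟩)).2.2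
  have h₂ := (innerFaces_spec c c' (D.proj_ρ i j k x ⟨⟨hi, hj⟩, hk⟩)
    (D.proj_ρ i k l x ⟨⟨hi, hk⟩, hl⟩)).2.2
  rw [D.proj_σ i j x ⟨hi, hj⟩, D.proj_σ j k x ⟨hj, hk⟩, D.proj_σ k l x ⟨hk, hl⟩] at h₂
  rw [outerFaces] at h₁
  rw [innerFaces] at h₂
  rw [h₁, h₂] at key
  simp only [R]
  grind

/-- The data only fix `g` pointwise; it is smooth as the ratio of two smooth sections of `Q`. -/
theorem contMDiffOn_g (τ : Fin 4 → M) :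
    ContMDiffOn M.I 𝓘(ℝ, ℂ) ∞ (D.g τ) (𝒰.inter τ) := by
  have hτ : τ = ![τ 0, τ 1, τ 2, τ 3] := by
    funext i
    fin_cases i <;> rfl
  have h0 : ∀ x ∈ 𝒰.inter τ, x ∈ 𝒰.U (τ 0) := fun x hx => mem_iInter.1 hx 0
  have h1 : ∀ x ∈ 𝒰.inter τ, x ∈ 𝒰.U (τ 1) := fun x hx => mem_iInter.1 hx 1
  have h2 : ∀ x ∈ 𝒰.inter τ, x ∈ 𝒰.U (τ 2) := fun x hx => mem_iInter.1 hx 2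
  have h3 : ∀ x ∈ 𝒰.inter τ, x ∈ 𝒰.U (τ 3) := fun x hx => mem_iInter.1 hx 3
  have σ01 := (D.smooth_σ (τ 0) (τ 1)).mono fun x hx => ⟨h0 x hx, h1 x hx⟩
  have σ12 := (D.smooth_σ (τ 1) (τ 2)).mono fun x hx => ⟨h1 x hx, h2 x hx⟩
  have σ23 := (D.smooth_σ (τ 2) (τ 3)).mono fun x hx => ⟨h2 x hx, h3 x hx⟩
  have ρ012 := (D.smooth_ρ (τ 0) (τ 1) (τ 2)).mono fun x hx => ⟨⟨h0 x hx, h1 x hx⟩, h2 x hx⟩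
  have ρ013 := (D.smooth_ρ (τ 0) (τ 1) (τ 3)).mono fun x hx => ⟨⟨h0 x hx, h1 x hx⟩, h3 x hx⟩
  have ρ023 := (D.smooth_ρ (τ 0) (τ 2) (τ 3)).mono fun x hx => ⟨⟨h0 x hx, h2 x hx⟩, h3 x hx⟩
  have ρ123 := (D.smooth_ρ (τ 1) (τ 2) (τ 3)).mono fun x hx => ⟨⟨h1 x hx, h2 x hx⟩, h3 x hx⟩
  have c : ∀ x ∈ 𝒰.inter τ, _ := fun x hx => composable_σ (D := D) (h1 x hx) (h2 x hx) (h3 x hx)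
  have c' : ∀ x ∈ 𝒰.inter τ, _ := fun x hx => composable_σ (D := D) (h0 x hx) (h1 x hx) (h2 x hx)
  have d : ∀ x ∈ 𝒰.inter τ, _ := fun x hx => outerFaces_composable (c x hx) (c' x hx)
    (D.proj_ρ _ _ _ x ⟨⟨h1 x hx, h2 x hx⟩, h3 x hx⟩)
    (D.proj_ρ _ _ _ x ⟨⟨h0 x hx, h1 x hx⟩, h3 x hx⟩)
  have d' : ∀ x ∈ 𝒰.inter τ, _ := fun x hx => innerFaces_composable (c x hx) (c' x hx)
    (D.proj_ρ _ _ _ x ⟨⟨h0 x hx, h1 x hx⟩, h2 x hx⟩)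
    (D.proj_ρ _ _ _ x ⟨⟨h0 x hx, h2 x hx⟩, h3 x hx⟩)
  refine PrincipalBundle.SmoothInto.ratio (R := 𝒬.Q.bundle) (J := M.I)
    (f := fun x => 𝒬.Q.mul (D.ρ (τ 0) (τ 2) (τ 3) x) (𝒬.Q.mul
      (𝒬.mhat (𝒬.Q.e (D.σ (τ 2) (τ 3) x)) (D.ρ (τ 0) (τ 1) (τ 2) x))
      (𝒬.a (D.σ (τ 2) (τ 3) x) (D.σ (τ 1) (τ 2) x) (D.σ (τ 0) (τ 1) x))))
    (g := fun x => 𝒬.Q.mul (D.ρ (τ 0) (τ 1) (τ 3) x)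
      (𝒬.mhat (D.ρ (τ 1) (τ 2) (τ 3) x) (𝒬.Q.e (D.σ (τ 0) (τ 1) x)))) ?_ ?_ fun x hx => ?_
  · exact 𝒬.Q.smooth_mul _ _ _ _ ρ023 (𝒬.Q.smooth_mul _ _ _ _
      (𝒬.smooth_mhat _ _ _ _ (smoothInto_e σ23) ρ012 fun x hx => (d' x hx).1)
      (smoothInto_a σ23 σ12 σ01 c c') fun x hx => (d' x hx).2.1) fun x hx => (d' x hx).2.2
  · exact 𝒬.Q.smooth_mul _ _ _ _ ρ013 (𝒬.smooth_mhat _ _ _ _ ρ123 (smoothInto_e σ01)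
      fun x hx => (d x hx).1) fun x hx => (d x hx).2
  · have := D.g_spec (τ 0) (τ 1) (τ 2) (τ 3) x ⟨⟨⟨h0 x hx, h1 x hx⟩, h2 x hx⟩, h3 x hx⟩
    rwa [← hτ] at this

/-- Restriction of Čech data along a refinement. -/
def refine {𝒱 : PointedCover M} (r : M → M) (h : ∀ x, 𝒱.U x ⊆ 𝒰.U (r x)) : 𝒬.CechData 𝒱 where
  s i := D.s (r i)
  smooth_s i := (D.smooth_s (r i)).mono (h i)
  proj_s i x hx := D.proj_s _ x (h i hx)
  σ i j := D.σ (r i) (r j)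
  smooth_σ i j := (D.smooth_σ _ _).mono (inter_subset_inter (h i) (h j))
  proj_σ i j x hx := D.proj_σ _ _ x ⟨h i hx.1, h j hx.2⟩
  ρ i j k := D.ρ (r i) (r j) (r k)
  smooth_ρ i j k :=
    (D.smooth_ρ _ _ _).mono (inter_subset_inter (inter_subset_inter (h i) (h j)) (h k))
  proj_ρ i j k x hx := D.proj_ρ _ _ _ x ⟨⟨h i hx.1.1, h j hx.1.2⟩, h k hx.2⟩
  g τ := D.g ![r (τ 0), r (τ 1), r (τ 2), r (τ 3)]
  g_spec i j k l x hx := D.g_spec _ _ _ _ x ⟨⟨⟨h i hx.1.1.1, h j hx.1.1.2⟩, h k hx.1.2⟩, h l hx.2⟩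

end CechData

end Bundle2Gerbe

/-! ### Existence of Čech data and of a four class -/

/-- Local lifts of smooth maps along a surjection admitting local sections. -/
theorem AdmitsLocalSections.exists_lift {E H B : Type u} [NormedAddCommGroup E] [NormedSpace ℝ E]
    [TopologicalSpace H] [TopologicalSpace B] [ChartedSpace H B] {Y : SmoothManifold.{u}}
    {I : ModelWithCorners ℝ E H} {S : Set B} {π : Y → B} (hπ : AdmitsLocalSections Y I S π)
    {E' H' A : Type u} [NormedAddCommGroup E'] [NormedSpace ℝ E'] [TopologicalSpace H']
    [TopologicalSpace A] [ChartedSpace H' A] {J : ModelWithCorners ℝ E' H'} {T : Set A} {b : A → B}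
    (hb : ContMDiffOn J I ∞ b T) (hS : MapsTo b T S) {x : A} (hx : x ∈ T) {y : Y}
    (hy : π y = b x) : ∃ (O : Set A) (f : A → Y), IsOpen O ∧ x ∈ O ∧ f x = y ∧
      ContMDiffOn J Y.I ∞ f (T ∩ O) ∧ ∀ a ∈ T ∩ O, π (f a) = b a := by
  obtain ⟨U, hU, hyU, s, hs, hsy, hsπ⟩ := hπ.exists_section y
  obtain ⟨O, hO, h⟩ := hb.continuousOn.exists_isOpen_inter hU
  refine ⟨O, fun a => s (b a), hO, (h x hx).2 (hy ▸ hyU), by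
    change s (b x) = y
    rw [← hy, hsy],
    hs.comp (hb.mono inter_subset_left) fun a ha => ⟨(h a ha.1).1 ha.2, hS ha.1⟩,
    fun a ha => hsπ _ ⟨(h a ha.1).1 ha.2, hS ha.1⟩⟩

theorem PointedCover.inter_pair {M : Type u} [TopologicalSpace M] (𝒰 : PointedCover M) (i j : M) :
    𝒰.inter ![i, j] = 𝒰.U i ∩ 𝒰.U j := by
  ext x
  simp [PointedCover.mem_inter, Fin.forall_fin_two]

theorem PointedCover.inter_triple {M : Type u} [TopologicalSpace M] (𝒰 : PointedCover M)
    (i j k : M) : 𝒰.inter ![i, j, k] = 𝒰.U i ∩ 𝒰.U j ∩ 𝒰.U k := by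
  ext x
  simp [PointedCover.mem_inter, Fin.forall_fin_succ, and_assoc]

theorem Fin.eq_vec_four {A : Type*} (σ : Fin 4 → A) : σ = ![σ 0, σ 1, σ 2, σ 3] := by
  funext i
  fin_cases i <;> rfl

/-- With separate arguments, `simp` can evaluate `τ ∘ j.succAbove` entry by entry, and alternating
sums become expressions for `ring`. -/
theorem exists_eq_curried {A C : Type*} (f : (Fin 4 → A) → C) :
    ∃ F : A → A → A → A → C, ∀ σ, f σ = F (σ 0) (σ 1) (σ 2) (σ 3) :=
  ⟨fun a b c d => f ![a, b, c, d], fun σ => congrArg f (Fin.eq_vec_four σ)⟩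

theorem cechD_apply {M : Type u} [TopologicalSpace M] (𝒰 : PointedCover M) {p : ℕ}
    (c : CechCochain 𝒰 p) (τ : Fin (p + 2) → M) (x : 𝒰.inter τ) :
    cechD 𝒰 p c τ x = ∑ j : Fin (p + 2),
      (-1) ^ (j : ℕ) * c (τ ∘ j.succAbove) ⟨x, 𝒰.inter_face τ j x.2⟩ := by
  change LocallyConstant.coeFnAddMonoidHom (∑ j : Fin (p + 2), _) x = _
  rw [map_sum, Finset.sum_apply]
  refine Finset.sum_congr rfl fun j _ => ?_
  rw [← smul_eq_mul]
  rfl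

namespace Bundle2Gerbe

open BundleGerbe

variable {M : SmoothManifold.{u}} (𝒬 : Bundle2Gerbe M)

theorem exists_sections : ∃ (𝒰 : PointedCover M) (s : M → M → 𝒬.X),
    (∀ i, ContMDiffOn M.I 𝒬.X.I ∞ (s i) (𝒰.U i)) ∧ ∀ i, ∀ x ∈ 𝒰.U i, 𝒬.π (s i x) = x := by
  have h (i : M) : ∃ (O : Set M) (f : M → 𝒬.X), IsOpen O ∧ i ∈ O ∧
      ContMDiffOn M.I 𝒬.X.I ∞ f O ∧ ∀ a ∈ O, 𝒬.π (f a) = a := by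
    obtain ⟨x, hx⟩ : i ∈ range 𝒬.π := by
      rw [𝒬.admitsLocalSections.range_eq]
      trivial
    obtain ⟨O, f, hO, hi, -, hf, hfπ⟩ := 𝒬.admitsLocalSections.exists_lift (T := univ)
      contMDiffOn_id (fun _ _ => mem_univ _) (mem_univ i) hx
    rw [univ_inter] at hf hfπ
    exact ⟨O, f, hO, hi, hf, hfπ⟩
  choose U s hU hi hs hsπ using h
  exact ⟨⟨U, hU, hi⟩, s, hs, hsπ⟩

/-- Local sections of `Y → X^[2]` lift `(s i, s j)` only near each point of a double intersection,
hence the passage to a refinement. -/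
theorem exists_lifts : ∃ (𝒰 : PointedCover M) (s : M → M → 𝒬.X) (σ : M → M → M → 𝒬.Q.Y),
    (∀ i, ContMDiffOn M.I 𝒬.X.I ∞ (s i) (𝒰.U i)) ∧ (∀ i, ∀ x ∈ 𝒰.U i, 𝒬.π (s i x) = x) ∧
      (∀ i j, ContMDiffOn M.I 𝒬.Q.Y.I ∞ (σ i j) (𝒰.U i ∩ 𝒰.U j)) ∧
      ∀ i j, ∀ x ∈ 𝒰.U i ∩ 𝒰.U j, 𝒬.Q.π (σ i j x) = (s i x, s j x) := by
  obtain ⟨𝒰, s, hs, hsπ⟩ := 𝒬.exists_sections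
  obtain ⟨𝒱, r, hr, h⟩ := 𝒰.exists_refinement (p := 1) (fun τ O => ∃ σ : M → 𝒬.Q.Y,
    ContMDiffOn M.I 𝒬.Q.Y.I ∞ σ O ∧ ∀ x ∈ O, 𝒬.Q.π (σ x) = (s (τ 0) x, s (τ 1) x))
    (fun τ O O' hO ⟨σ, hσ, hσπ⟩ => ⟨σ, hσ.mono hO, fun x hx => hσπ x (hO hx)⟩)
    -- On the empty set any point of `Y` will do.
    (fun τ => ⟨fun _ => 𝒬.point (s (τ 0) (τ 0)) (s (τ 0) (τ 0)),
      contMDiffOn_const, fun x hx => hx.elim⟩)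
    (fun τ x hx => by
      have h0 : ∀ x ∈ 𝒰.inter τ, x ∈ 𝒰.U (τ 0) := fun x hx => mem_iInter.1 hx 0
      have h1 : ∀ x ∈ 𝒰.inter τ, x ∈ 𝒰.U (τ 1) := fun x hx => mem_iInter.1 hx 1
      have hπ : ∀ x ∈ 𝒰.inter τ, 𝒬.π (s (τ 0) x) = 𝒬.π (s (τ 1) x) := fun x hx => by
        rw [hsπ _ x (h0 x hx), hsπ _ x (h1 x hx)]
      obtain ⟨O, f, hO, hx', -, hf, hfπ⟩ := 𝒬.Q.admitsLocalSections.exists_lift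
        (((hs _).mono h0).prodMk ((hs _).mono h1)) hπ hx (π_point (hπ x hx))
      exact ⟨_, (𝒰.isOpen_inter τ).inter hO, ⟨hx, hx'⟩, f, hf, hfπ⟩)
  choose σ hσ hσπ using h
  refine ⟨𝒱, fun i => s (r i), fun i j => σ ![i, j], fun i => (hs _).mono (hr i),
    fun i x hx => hsπ _ x (hr i hx), fun i j => ?_, fun i j => ?_⟩
  · rw [← 𝒱.inter_pair]
    exact hσ _
  · rw [← 𝒱.inter_pair]
    exact hσπ _

/-- A second refinement, now for triple intersections, supplies `ρ`. No further one is needed for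
`g`, which may be chosen pointwise because `contMDiffOn_g` makes it smooth afterwards. -/
theorem exists_cechData : ∃ 𝒰 : PointedCover M, Nonempty (𝒬.CechData 𝒰) := by
  obtain ⟨𝒰, s, σ, hs, hsπ, hσ, hσπ⟩ := 𝒬.exists_lifts
  obtain ⟨𝒱, r, hr, h⟩ := 𝒰.exists_refinement (p := 2) (fun τ O => ∃ ρ : M → 𝒬.Q.P,
    𝒬.Q.SmoothInto M.I ρ O ∧ ∀ x ∈ O,
      𝒬.Q.src (ρ x) = 𝒬.m (σ (τ 1) (τ 2) x) (σ (τ 0) (τ 1) x) ∧ 𝒬.Q.tgt (ρ x) = σ (τ 0) (τ 2) x)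
    (fun τ O O' hO ⟨ρ, hρ, hρπ⟩ => ⟨ρ, hρ.mono hO, fun x hx => hρπ x (hO hx)⟩)
    (fun τ => ⟨fun _ => 𝒬.Q.e (σ (τ 0) (τ 0) (τ 0)),
      smoothInto_e contMDiffOn_const, fun x hx => hx.elim⟩)
    (fun τ x hx => by
      have h0 : ∀ x ∈ 𝒰.inter τ, x ∈ 𝒰.U (τ 0) := fun x hx => mem_iInter.1 hx 0
      have h1 : ∀ x ∈ 𝒰.inter τ, x ∈ 𝒰.U (τ 1) := fun x hx => mem_iInter.1 hx 1
      have h2 : ∀ x ∈ 𝒰.inter τ, x ∈ 𝒰.U (τ 2) := fun x hx => mem_iInter.1 hx 2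
      have c : ∀ x ∈ 𝒰.inter τ,
          (𝒬.Q.π (σ (τ 1) (τ 2) x)).1 = (𝒬.Q.π (σ (τ 0) (τ 1) x)).2 := fun x hx => by
        rw [hσπ _ _ x ⟨h1 x hx, h2 x hx⟩, hσπ _ _ x ⟨h0 x hx, h1 x hx⟩]
      obtain ⟨O, ρ, hO, hx', hρπ, hρ⟩ := exists_local_arrow (contMDiffOn_m
        ((hσ (τ 1) (τ 2)).mono fun x hx => ⟨h1 x hx, h2 x hx⟩)
        ((hσ (τ 0) (τ 1)).mono fun x hx => ⟨h0 x hx, h1 x hx⟩) c)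
        ((hσ (τ 0) (τ 2)).mono fun x hx => ⟨h0 x hx, h2 x hx⟩) (fun x hx => by
          rw [𝒬.proj_m _ _ (c x hx), hσπ _ _ x ⟨h1 x hx, h2 x hx⟩, hσπ _ _ x ⟨h0 x hx, h1 x hx⟩,
            hσπ _ _ x ⟨h0 x hx, h2 x hx⟩]) hx
      exact ⟨_, (𝒰.isOpen_inter τ).inter hO, ⟨hx, hx'⟩, ρ, hρ, fun y hy => hρπ y hy.1⟩)
  choose ρ hρ hρπ using h
  have hσπ' : ∀ i j, ∀ x ∈ 𝒱.U i ∩ 𝒱.U j,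
      𝒬.Q.π (σ (r i) (r j) x) = (s (r i) x, s (r j) x) :=
    fun i j x hx => hσπ _ _ x ⟨hr i hx.1, hr j hx.2⟩
  have hρπ' : ∀ i j k, ∀ x ∈ 𝒱.U i ∩ 𝒱.U j ∩ 𝒱.U k,
      𝒬.Q.src (ρ ![i, j, k] x) = 𝒬.m (σ (r j) (r k) x) (σ (r i) (r j) x) ∧
        𝒬.Q.tgt (ρ ![i, j, k] x) = σ (r i) (r k) x := fun i j k => by
    rw [← 𝒱.inter_triple]
    exact hρπ _
  have hg (τ : Fin 4 → M) (x : M) : ∃ c : ℂˣ,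
      x ∈ 𝒱.U (τ 0) ∩ 𝒱.U (τ 1) ∩ 𝒱.U (τ 2) ∩ 𝒱.U (τ 3) →
      𝒬.outerFaces (ρ ![τ 0, τ 1, τ 3] x) (ρ ![τ 1, τ 2, τ 3] x) (σ (r (τ 0)) (r (τ 1)) x) =
        𝒬.Q.act c (𝒬.innerFaces (ρ ![τ 0, τ 2, τ 3] x) (ρ ![τ 0, τ 1, τ 2] x)
          (σ (r (τ 2)) (r (τ 3)) x) (σ (r (τ 1)) (r (τ 2)) x) (σ (r (τ 0)) (r (τ 1)) x)) := by
    by_cases hx : x ∈ 𝒱.U (τ 0) ∩ 𝒱.U (τ 1) ∩ 𝒱.U (τ 2) ∩ 𝒱.U (τ 3)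
    swap
    · exact ⟨1, fun h => (hx h).elim⟩
    obtain ⟨⟨⟨h0, h1⟩, h2⟩, h3⟩ := id hx
    have c : (𝒬.Q.π (σ (r (τ 2)) (r (τ 3)) x)).1 = (𝒬.Q.π (σ (r (τ 1)) (r (τ 2)) x)).2 := by
      rw [hσπ' _ _ x ⟨h2, h3⟩, hσπ' _ _ x ⟨h1, h2⟩]
    have c' : (𝒬.Q.π (σ (r (τ 1)) (r (τ 2)) x)).1 = (𝒬.Q.π (σ (r (τ 0)) (r (τ 1)) x)).2 := by
      rw [hσπ' _ _ x ⟨h1, h2⟩, hσπ' _ _ x ⟨h0, h1⟩]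
    have e := outerFaces_spec c c' (hρπ' _ _ _ x ⟨⟨h1, h2⟩, h3⟩) (hρπ' _ _ _ x ⟨⟨h0, h1⟩, h3⟩)
    have e' := innerFaces_spec c c' (hρπ' _ _ _ x ⟨⟨h0, h1⟩, h2⟩) (hρπ' _ _ _ x ⟨⟨h0, h2⟩, h3⟩)
    obtain ⟨d, hd⟩ := 𝒬.Q.exists_act (e'.1.trans e.1.symm) (e'.2.1.trans e.2.1.symm)
    exact ⟨d, fun _ => hd⟩
  choose g hg using hg
  exact ⟨𝒱, ⟨{
    s := fun i => s (r i)
    smooth_s := fun i => (hs _).mono (hr i)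
    proj_s := fun i x hx => hsπ _ x (hr i hx)
    σ := fun i j => σ (r i) (r j)
    smooth_σ := fun i j => (hσ _ _).mono (inter_subset_inter (hr i) (hr j))
    proj_σ := hσπ'
    ρ := fun i j k => ρ ![i, j, k]
    smooth_ρ := fun i j k => by
      rw [← 𝒱.inter_triple]
      exact hρ _
    proj_ρ := hρπ'
    g := g
    g_spec := fun i j k l x hx => hg ![i, j, k, l] x hx }⟩⟩

variable {𝒬}

theorem exists_cechData_log : ∃ (𝒰 : PointedCover M) (D : 𝒬.CechData 𝒰)
    (f : (Fin 4 → M) → M → ℂ), (∀ τ, ContMDiffOn M.I 𝓘(ℝ, ℂ) ∞ (f τ) (𝒰.inter τ)) ∧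
      ∀ τ, ∀ x ∈ 𝒰.inter τ, (D.g τ x : ℂ) = Complex.exp (2 * Real.pi * Complex.I * f τ x) := by
  obtain ⟨𝒰, ⟨D⟩⟩ := 𝒬.exists_cechData
  obtain ⟨𝒱, r, hr, h⟩ := 𝒰.exists_refinement (p := 3) (fun τ O => ∃ f : M → ℂ,
    ContMDiffOn M.I 𝓘(ℝ, ℂ) ∞ f O ∧ ∀ x ∈ O,
      (D.g τ x : ℂ) = Complex.exp (2 * Real.pi * Complex.I * f x))
    (fun τ O O' hO ⟨f, hf, hfg⟩ => ⟨f, hf.mono hO, fun x hx => hfg x (hO hx)⟩)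
    (fun τ => ⟨0, contMDiffOn_const, fun x hx => hx.elim⟩)
    (fun τ x hx => by
      obtain ⟨O, f, hO, hx', hf, hfg⟩ := exists_local_log (𝒰.isOpen_inter τ) (D.contMDiffOn_g τ) hx
      exact ⟨O, hO, hx', f, hf, hfg⟩)
  choose f hf hfg using h
  refine ⟨𝒱, D.refine r hr, f, hf, fun τ x hx => ?_⟩
  rw [← hfg τ x hx]
  have hτ : r ∘ τ = ![r (τ 0), r (τ 1), r (τ 2), r (τ 3)] := by
    funext i
    fin_cases i <;> rfl
  rw [hτ]
  rfl

/-- Apply `δ` to `g = δR - α(s)` and use `δα = 0`. -/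
theorem CechData.g_cocycle {𝒰 : PointedCover M} (D : 𝒬.CechData 𝒰) (τ : Fin 5 → M) {x : M}
    (hx : x ∈ 𝒰.inter τ) :
    Additive.ofMul (D.g ![τ 1, τ 2, τ 3, τ 4] x) - Additive.ofMul (D.g ![τ 0, τ 2, τ 3, τ 4] x) +
      Additive.ofMul (D.g ![τ 0, τ 1, τ 3, τ 4] x) - Additive.ofMul (D.g ![τ 0, τ 1, τ 2, τ 4] x) +
      Additive.ofMul (D.g ![τ 0, τ 1, τ 2, τ 3] x) = 0 := by
  have h : ∀ i, x ∈ 𝒰.U (τ i) := mem_iInter.1 hx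
  have hs : ∀ i, 𝒬.π (D.s (τ 0) x) = 𝒬.π (D.s (τ i) x) := fun i => by
    rw [D.proj_s _ x (h _), D.proj_s _ x (h _)]
  have e := α_coherence (hs 1) (hs 2) (hs 3) (hs 4)
  have e₀ := D.ofMul_g_add_α (h 1) (h 2) (h 3) (h 4)
  have e₁ := D.ofMul_g_add_α (h 0) (h 2) (h 3) (h 4)
  have e₂ := D.ofMul_g_add_α (h 0) (h 1) (h 3) (h 4)
  have e₃ := D.ofMul_g_add_α (h 0) (h 1) (h 2) (h 4)
  have e₄ := D.ofMul_g_add_α (h 0) (h 1) (h 2) (h 3)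
  grind

/-- The alternating sum of the logarithms of a `ℂˣ`-valued cocycle is integral. -/
theorem CechData.exists_int {𝒰 : PointedCover M} (D : 𝒬.CechData 𝒰) {f : (Fin 4 → M) → M → ℂ}
    (hfg : ∀ τ, ∀ x ∈ 𝒰.inter τ, (D.g τ x : ℂ) = Complex.exp (2 * Real.pi * Complex.I * f τ x))
    (τ : Fin 5 → M) {x : M} (hx : x ∈ 𝒰.inter τ) :
    ∃ n : ℤ, ∑ j : Fin 5, (-1 : ℂ) ^ (j : ℕ) * f (τ ∘ j.succAbove) x = n := by
  rw [← exp_eq_one_iff_int]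
  have key : D.g (τ ∘ (0 : Fin 5).succAbove) x / D.g (τ ∘ (1 : Fin 5).succAbove) x *
      D.g (τ ∘ (2 : Fin 5).succAbove) x / D.g (τ ∘ (3 : Fin 5).succAbove) x *
      D.g (τ ∘ (4 : Fin 5).succAbove) x = 1 := by
    have h := fun j : Fin 5 => Fin.eq_vec_four (τ ∘ j.succAbove)
    rw [h 0, h 1, h 2, h 3, h 4]
    exact D.g_cocycle τ hx
  have key' := congrArg (Units.val) key
  have hj : ∀ j : Fin 5, (D.g (τ ∘ j.succAbove) x : ℂ) = _ := fun j =>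
    hfg _ x (𝒰.inter_face τ j hx)
  simp only [Units.val_mul, Units.val_div_eq_div_val, hj, Units.val_one, ← Complex.exp_sub,
    ← Complex.exp_add] at key'
  refine (congrArg Complex.exp ?_).trans key'
  simp only [Fin.sum_univ_five]
  norm_num
  ring

theorem exists_isFourClass (𝒬 : Bundle2Gerbe M) : ∃ c : IntegralH4 M, 𝒬.IsFourClass c := by
  obtain ⟨𝒰, D, f, hf, hfg⟩ := 𝒬.exists_cechData_log
  have h (τ : Fin 5 → M) : ∃ n : LocallyConstant (𝒰.inter τ) ℤ, ∀ x : 𝒰.inter τ,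
      ((n x : ℤ) : ℂ) = ∑ j : Fin 5, (-1 : ℂ) ^ (j : ℕ) * f (τ ∘ j.succAbove) x := by
    refine exists_locallyConstant (continuousOn_finsetSum _ fun j _ =>
      continuousOn_const.mul ((hf _).continuousOn.mono (𝒰.inter_face τ j))) fun x hx => ?_
    exact D.exists_int hfg τ hx
  choose n hn using h
  have hn' : cechD 𝒰 4 n = 0 := by
    funext τ
    ext x
    -- In `ℂ` the cochain `n` is `δf`, so the claim becomes `δδf = 0`.
    rw [← Int.cast_inj (α := ℂ)]
    have hn'' : ∀ j : Fin 6, ((n (τ ∘ j.succAbove) ⟨x, 𝒰.inter_face τ j x.2⟩ : ℤ) : ℂ) =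
        ∑ k : Fin 5, (-1 : ℂ) ^ (k : ℕ) * f ((τ ∘ j.succAbove) ∘ k.succAbove) x := fun j =>
      hn (τ ∘ j.succAbove) ⟨x, 𝒰.inter_face τ j x.2⟩
    obtain ⟨F, hF⟩ := exists_eq_curried f
    rw [cechD_apply]
    push_cast
    simp only [hn'', hF]
    simp [Fin.sum_univ_six, Fin.sum_univ_five, Fin.succAbove]
    ring
  exact ⟨_, 𝒰, D, f, ⟨n, hn'⟩, hf, hfg, hn, rfl⟩

end Bundle2Gerbe

/-! ## Vanishing of Čech classes -/

section Cech

variable {M : Type u} [TopologicalSpace M]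

/-- The common refinement of two pointed covers. -/
def PointedCover.inf (𝒰 𝒱 : PointedCover M) : PointedCover M where
  U x := 𝒰.U x ∩ 𝒱.U x
  isOpen_U x := (𝒰.isOpen_U x).inter (𝒱.isOpen_U x)
  mem_U x := ⟨𝒰.mem_U x, 𝒱.mem_U x⟩

theorem PointedCover.le_inf_left (𝒰 𝒱 : PointedCover M) : 𝒰 ≤ 𝒰.inf 𝒱 := fun _ => inter_subset_left

theorem PointedCover.le_inf_right (𝒰 𝒱 : PointedCover M) : 𝒱 ≤ 𝒰.inf 𝒱 :=
  fun _ => inter_subset_right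

instance : IsDirectedOrder (PointedCover M) :=
  ⟨fun 𝒰 𝒱 => ⟨𝒰.inf 𝒱, 𝒰.le_inf_left 𝒱, 𝒰.le_inf_right 𝒱⟩⟩

instance (p : ℕ) : DirectedSystem (fun 𝒰 : PointedCover M => CechCoverH 𝒰 p)
    fun 𝒰 𝒱 h => cechHRestrict p 𝒰 𝒱 h where
  map_self 𝒰 x := by
    obtain ⟨c, rfl⟩ := QuotientAddGroup.mk_surjective x
    rfl
  map_map 𝒰 𝒱 𝒲 h h' x := by
    obtain ⟨c, rfl⟩ := QuotientAddGroup.mk_surjective x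
    rfl

/-- Pointed covers are directed, so an element of the limit vanishes exactly when it vanishes at
some stage. At that stage restriction keeps the indices fixed. -/
theorem cechClass_eq_zero_iff {p : ℕ} {𝒰 : PointedCover M} {n : cechZ 𝒰 (p + 1)} :
    cechClass p 𝒰 n = 0 ↔ ∃ (𝒱 : PointedCover M) (h : 𝒰 ≤ 𝒱) (b : CechCochain 𝒱 p),
      cechD 𝒱 p b = cechRestrict h (p + 1) n.1 := by
  classical
  constructor
  · intro h
    obtain ⟨𝒱, h𝒱, h'⟩ := AddCommGroup.DirectLimit.of.zero_exact _ _ h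
    obtain ⟨b, hb⟩ := (QuotientAddGroup.eq_zero_iff (cechZRestrict h𝒱 (p + 1) n)).1 h'
    exact ⟨𝒱, h𝒱, b, hb⟩
  · rintro ⟨𝒱, h𝒱, b, hb⟩
    have h' : cechHRestrict p 𝒰 𝒱 h𝒱 (QuotientAddGroup.mk n) = 0 :=
      (QuotientAddGroup.eq_zero_iff (cechZRestrict h𝒱 (p + 1) n)).2 ⟨b, hb⟩
    rw [cechClass, ← AddCommGroup.DirectLimit.of_f (hij := h𝒱), h', map_zero]

theorem exists_eq_curried_five {A C : Type*} (f : (Fin 5 → A) → C) :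
    ∃ F : A → A → A → A → A → C, ∀ σ, f σ = F (σ 0) (σ 1) (σ 2) (σ 3) (σ 4) :=
  ⟨fun a b c d e => f ![a, b, c, d, e], fun σ => congrArg f (by
    funext i
    fin_cases i <;> rfl)⟩

/-- Two refinement maps `id, r : 𝒱 → 𝒰` induce the same map in cohomology. -/
theorem exists_cechD_eq_of_refinement {𝒰 𝒱 : PointedCover M} (h : 𝒰 ≤ 𝒱) {r : M → M}
    (hr : ∀ x, 𝒱.U x ⊆ 𝒰.U (r x)) (n : cechZ 𝒰 4)
    (hn : ∃ b : CechCochain 𝒱 3, ∀ (τ : Fin 5 → M) (x : 𝒱.inter τ) (hx : x.1 ∈ 𝒰.inter (r ∘ τ)),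
      cechD 𝒱 3 b τ x = n.1 (r ∘ τ) ⟨x, hx⟩) :
    ∃ b : CechCochain 𝒱 3, cechD 𝒱 3 b = cechRestrict h 4 n.1 := by
  classical
  obtain ⟨b, hb⟩ := hn
  -- The simplices `(r σ₀, …, r σᵢ, σᵢ, …, σ₃)` triangulate the prism between the refinement maps
  -- `r` and `id`; on `𝒱.inter σ` the cocycle is defined on all of them.
  have k0 (σ : Fin 4 → M) : 𝒱.inter σ ⊆ 𝒰.inter ![r (σ 0), σ 0, σ 1, σ 2, σ 3] := fun x hx => by
    have hx := PointedCover.mem_inter.1 hx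
    simp [PointedCover.mem_inter, Fin.forall_fin_succ, hr _ (hx _), h _ (hx _)]
  have k1 (σ : Fin 4 → M) : 𝒱.inter σ ⊆ 𝒰.inter ![r (σ 0), r (σ 1), σ 1, σ 2, σ 3] :=
    fun x hx => by
    have hx := PointedCover.mem_inter.1 hx
    simp [PointedCover.mem_inter, Fin.forall_fin_succ, hr _ (hx _), h _ (hx _)]
  have k2 (σ : Fin 4 → M) : 𝒱.inter σ ⊆ 𝒰.inter ![r (σ 0), r (σ 1), r (σ 2), σ 2, σ 3] :=
    fun x hx => by
    have hx := PointedCover.mem_inter.1 hx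
    simp [PointedCover.mem_inter, Fin.forall_fin_succ, hr _ (hx _), h _ (hx _)]
  have k3 (σ : Fin 4 → M) : 𝒱.inter σ ⊆ 𝒰.inter ![r (σ 0), r (σ 1), r (σ 2), r (σ 3), σ 3] :=
    fun x hx => by
    have hx := PointedCover.mem_inter.1 hx
    simp [PointedCover.mem_inter, Fin.forall_fin_succ, hr _ (hx _), h _ (hx _)]
  -- Extension by zero removes the membership proofs from the algebra that follows.
  obtain ⟨F, hF⟩ := exists_eq_curried_five fun (τ : Fin 5 → M) (x : M) =>
    if hx : x ∈ 𝒰.inter τ then n.1 τ ⟨x, hx⟩ else 0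
  have hnF (τ : Fin 5 → M) (x : M) (hx : x ∈ 𝒰.inter τ) :
      n.1 τ ⟨x, hx⟩ = F (τ 0) (τ 1) (τ 2) (τ 3) (τ 4) x := by
    exact (dif_pos hx).symm.trans (congrFun (hF τ) x)
  have cocycle (a₀ a₁ a₂ a₃ a₄ a₅ : M) (x : M) (hx : x ∈ 𝒰.inter ![a₀, a₁, a₂, a₃, a₄, a₅]) :
      F a₁ a₂ a₃ a₄ a₅ x - F a₀ a₂ a₃ a₄ a₅ x + F a₀ a₁ a₃ a₄ a₅ x - F a₀ a₁ a₂ a₄ a₅ x +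
        F a₀ a₁ a₂ a₃ a₅ x - F a₀ a₁ a₂ a₃ a₄ x = 0 := by
    have hc := cechD_apply 𝒰 n.1 ![a₀, a₁, a₂, a₃, a₄, a₅] ⟨x, hx⟩
    rw [show cechD 𝒰 4 n.1 = 0 from n.2] at hc
    simp only [hnF] at hc
    simp [Fin.sum_univ_six, Fin.succAbove] at hc
    linarith
  -- The alternating sum of `n` over the prism simplices is the standard homotopy between the two
  -- restriction maps.
  refine ⟨b + fun σ => restrictLC (k0 σ) (n.1 _) - restrictLC (k1 σ) (n.1 _) +
    restrictLC (k2 σ) (n.1 _) - restrictLC (k3 σ) (n.1 _), ?_⟩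
  rw [map_add]
  funext τ
  ext x
  have hx := PointedCover.mem_inter.1 x.2
  have hxr : x.1 ∈ 𝒰.inter (r ∘ τ) := PointedCover.mem_inter.2 fun i => hr _ (hx i)
  have e := hb τ x hxr
  rw [hnF] at e
  change cechD 𝒱 3 b τ x + cechD 𝒱 3 _ τ x = n.1 τ ⟨x, _⟩
  have hK (σ : Fin 4 → M) (hσ : x.1 ∈ 𝒱.inter σ) : (restrictLC (k0 σ) (n.1 _) -
      restrictLC (k1 σ) (n.1 _) + restrictLC (k2 σ) (n.1 _) - restrictLC (k3 σ) (n.1 _) :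
        LocallyConstant (𝒱.inter σ) ℤ) ⟨x, hσ⟩ =
      F (r (σ 0)) (σ 0) (σ 1) (σ 2) (σ 3) x - F (r (σ 0)) (r (σ 1)) (σ 1) (σ 2) (σ 3) x +
        F (r (σ 0)) (r (σ 1)) (r (σ 2)) (σ 2) (σ 3) x -
        F (r (σ 0)) (r (σ 1)) (r (σ 2)) (r (σ 3)) (σ 3) x := by
    have h0 := hnF _ x.1 (k0 σ hσ)
    have h1 := hnF _ x.1 (k1 σ hσ)
    have h2 := hnF _ x.1 (k2 σ hσ)
    have h3 := hnF _ x.1 (k3 σ hσ)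
    exact congrArg₂ (· - ·) (congrArg₂ (· + ·) (congrArg₂ (· - ·) h0 h1) h2) h3
  rw [e, cechD_apply _ _ _ x, hnF]
  simp only [hK]
  -- The homotopy formula is the alternating sum of the cocycle identities on the five simplices of
  -- the prism over `τ`.
  have c0 := cocycle (r (τ 0)) (τ 0) (τ 1) (τ 2) (τ 3) (τ 4) x (by
    simp [PointedCover.mem_inter, Fin.forall_fin_succ, hr _ (hx _), h _ (hx _)])
  have c1 := cocycle (r (τ 0)) (r (τ 1)) (τ 1) (τ 2) (τ 3) (τ 4) x (by
    simp [PointedCover.mem_inter, Fin.forall_fin_succ, hr _ (hx _), h _ (hx _)])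
  have c2 := cocycle (r (τ 0)) (r (τ 1)) (r (τ 2)) (τ 2) (τ 3) (τ 4) x (by
    simp [PointedCover.mem_inter, Fin.forall_fin_succ, hr _ (hx _), h _ (hx _)])
  have c3 := cocycle (r (τ 0)) (r (τ 1)) (r (τ 2)) (r (τ 3)) (τ 3) (τ 4) x (by
    simp [PointedCover.mem_inter, Fin.forall_fin_succ, hr _ (hx _), h _ (hx _)])
  have c4 := cocycle (r (τ 0)) (r (τ 1)) (r (τ 2)) (r (τ 3)) (r (τ 4)) (τ 4) x (by
    simp [PointedCover.mem_inter, Fin.forall_fin_succ, hr _ (hx _), h _ (hx _)])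
  simp [Fin.sum_univ_five, Fin.succAbove]
  linarith

end Cech

/-! ## The four class of a trivial bundle 2-gerbe -/

namespace Bundle2Gerbe

open BundleGerbe

variable {M : SmoothManifold.{u}} {𝒬 : Bundle2Gerbe M}

namespace Trivialisation

section Smooth

variable {t : 𝒬.Trivialisation} {N : SmoothManifold.{u}} {T : Set N}

theorem contMDiffOn_η {f : N → t.L.Y} {f' : N → 𝒬.Q.Y} (hf : ContMDiffOn N.I t.L.Y.I ∞ f T)
    (hf' : ContMDiffOn N.I 𝒬.Q.Y.I ∞ f' T) (h : ∀ x ∈ T, t.L.π (f x) = (𝒬.Q.π (f' x)).2) :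
    ContMDiffOn N.I t.L.Y.I ∞ (fun x => t.η (f x) (f' x)) T :=
  t.smooth_η.comp (hf.prodMk hf') fun x hx => h x hx

theorem smoothInto_θ {f : N → t.L.Y} {f' f'' : N → 𝒬.Q.Y} (hf : ContMDiffOn N.I t.L.Y.I ∞ f T)
    (hf' : ContMDiffOn N.I 𝒬.Q.Y.I ∞ f' T) (hf'' : ContMDiffOn N.I 𝒬.Q.Y.I ∞ f'' T)
    (h : ∀ x ∈ T, t.L.π (f x) = (𝒬.Q.π (f' x)).2)
    (h' : ∀ x ∈ T, (𝒬.Q.π (f' x)).1 = (𝒬.Q.π (f'' x)).2) :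
    t.L.SmoothInto N.I (fun x => t.θ (f x) (f' x) (f'' x)) T :=
  t.smooth_θ.comp (hf.prodMk (hf'.prodMk hf'')) fun x hx => ⟨h x hx, h' x hx⟩

end Smooth

variable (t : 𝒬.Trivialisation)

/-- Local sections of the trivialising bundle gerbe, and of its bundle, over a refinement. -/
structure LocalData {𝒰 : PointedCover M} (D : 𝒬.CechData 𝒰) where
  z : M → M → t.L.Y
  smooth_z : ∀ i, ContMDiffOn M.I t.L.Y.I ∞ (z i) (𝒰.U i)
  π_z : ∀ i, ∀ x ∈ 𝒰.U i, t.L.π (z i x) = D.s i x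
  l : M → M → M → t.L.P
  smooth_l : ∀ i j, t.L.SmoothInto M.I (l i j) (𝒰.U i ∩ 𝒰.U j)
  proj_l : ∀ i j, ∀ x ∈ 𝒰.U i ∩ 𝒰.U j,
    t.L.src (l i j x) = t.η (z j x) (D.σ i j x) ∧ t.L.tgt (l i j x) = z i x

/-- Each `s i` lifts to `Z` after shrinking the `i`-th set around `i`. The arrows `l i j` exist only
locally on double intersections and require one more refinement. -/
theorem exists_localData {𝒰 : PointedCover M} (D : 𝒬.CechData 𝒰) :
    ∃ (𝒱 : PointedCover M) (r : M → M) (hr : ∀ x, 𝒱.U x ⊆ 𝒰.U (r x)),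
      Nonempty (t.LocalData (D.refine r hr)) := by
  have h (i : M) : ∃ (O : Set M) (z : M → t.L.Y), IsOpen O ∧ i ∈ O ∧ O ⊆ 𝒰.U i ∧
      ContMDiffOn M.I t.L.Y.I ∞ z O ∧ ∀ x ∈ O, t.L.π (z x) = D.s i x := by
    obtain ⟨y, hy⟩ := t.exists_Z (D.s i i)
    obtain ⟨O, z, hO, hi, -, hz, hzπ⟩ := t.L.admitsLocalSections.exists_lift (D.smooth_s i)
      (fun _ _ => mem_univ _) (𝒰.mem_U i) hy
    exact ⟨_, z, (𝒰.isOpen_U i).inter hO, ⟨𝒰.mem_U i, hi⟩, inter_subset_left, hz, hzπ⟩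
  choose U z hU hiU hU𝒰 hz hzπ using h
  let 𝒱 : PointedCover M := ⟨U, hU, hiU⟩
  obtain ⟨𝒲, r, hr, h⟩ := 𝒱.exists_refinement (p := 1) (fun τ O => ∃ l : M → t.L.P,
    t.L.SmoothInto M.I l O ∧ ∀ x ∈ O,
      t.L.src (l x) = t.η (z (τ 1) x) (D.σ (τ 0) (τ 1) x) ∧ t.L.tgt (l x) = z (τ 0) x)
    (fun τ O O' hO ⟨l, hl, hlπ⟩ => ⟨l, hl.mono hO, fun x hx => hlπ x (hO hx)⟩)
    (fun τ => ⟨fun _ => t.L.e (z (τ 0) (τ 0)), smoothInto_e contMDiffOn_const,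
      fun x hx => hx.elim⟩)
    (fun τ x hx => by
      have h0 : ∀ x ∈ 𝒱.inter τ, x ∈ U (τ 0) := fun x hx => mem_iInter.1 hx 0
      have h1 : ∀ x ∈ 𝒱.inter τ, x ∈ U (τ 1) := fun x hx => mem_iInter.1 hx 1
      have hσ : ∀ x ∈ 𝒱.inter τ, 𝒬.Q.π (D.σ (τ 0) (τ 1) x) = (D.s (τ 0) x, D.s (τ 1) x) :=
        fun x hx => D.proj_σ _ _ x ⟨hU𝒰 _ (h0 x hx), hU𝒰 _ (h1 x hx)⟩
      have c : ∀ x ∈ 𝒱.inter τ, t.L.π (z (τ 1) x) = (𝒬.Q.π (D.σ (τ 0) (τ 1) x)).2 :=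
        fun x hx => by rw [hσ x hx, hzπ _ x (h1 x hx)]
      obtain ⟨O, l, hO, hx', hlπ, hl⟩ := exists_local_arrow (contMDiffOn_η
        ((hz (τ 1)).mono h1)
        ((D.smooth_σ (τ 0) (τ 1)).mono fun x hx => ⟨hU𝒰 _ (h0 x hx), hU𝒰 _ (h1 x hx)⟩) c)
        ((hz (τ 0)).mono h0) (fun x hx => by
          rw [t.proj_η _ _ (c x hx), hσ x hx, hzπ _ x (h0 x hx)]) hx
      exact ⟨_, (𝒱.isOpen_inter τ).inter hO, ⟨hx, hx'⟩, l, hl, fun y hy => hlπ y hy.1⟩)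
  choose l hl hlπ using h
  refine ⟨𝒲, r, fun x => (hr x).trans (hU𝒰 (r x)), ⟨{
    z := fun i => z (r i)
    smooth_z := fun i => (hz _).mono (hr i)
    π_z := fun i x hx => hzπ _ x (hr i hx)
    l := fun i j => l ![i, j]
    smooth_l := fun i j => ?_
    proj_l := fun i j => ?_ }⟩⟩
  · rw [← 𝒲.inter_pair]
    exact hl _
  · rw [← 𝒲.inter_pair]
    exact hlπ _

namespace LocalData

variable {t} {𝒰 : PointedCover M} {D : 𝒬.CechData 𝒰} (Λ : t.LocalData D)

/-- The `ℂˣ`-valued Čech 2-cochain of a trivialisation. -/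
noncomputable def h (i j k : M) (x : M) : ℂˣ := Additive.toMul
  (t.L.phase (Λ.l i k x) + t.κ (Λ.z k x) (D.σ i k x) -
    (t.L.phase (Λ.l i j x) + t.κ (Λ.z j x) (D.σ i j x)) -
    (t.L.phase (Λ.l j k x) + t.κ (Λ.z k x) (D.σ j k x)) +
    D.R i j k x - t.β (D.s i x) (D.s j x) (D.s k x))

/-- There are two smooth arrows from `η(z_k, σ_jk ∘ σ_ij)` to `z_i`: one through `ρ_ijk` and `l_ik`,
the other through `θ`, `l_jk` and `l_ij`. `h` is their ratio, the first over the second. -/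
theorem contMDiffOn_h (i j k : M) :
    ContMDiffOn M.I 𝓘(ℝ, ℂ) ∞ (Λ.h i j k) (𝒰.U i ∩ 𝒰.U j ∩ 𝒰.U k) := by
  set T := 𝒰.U i ∩ 𝒰.U j ∩ 𝒰.U k
  have hij : T ⊆ 𝒰.U i ∩ 𝒰.U j := fun x hx => hx.1
  have hik : T ⊆ 𝒰.U i ∩ 𝒰.U k := fun x hx => ⟨hx.1.1, hx.2⟩
  have hjk : T ⊆ 𝒰.U j ∩ 𝒰.U k := fun x hx => ⟨hx.1.2, hx.2⟩
  have c : ∀ x ∈ T, (𝒬.Q.π (D.σ j k x)).1 = (𝒬.Q.π (D.σ i j x)).2 := fun x hx =>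
    CechData.composable_σ hx.1.1 hx.1.2 hx.2
  have cz : ∀ x ∈ T, t.L.π (Λ.z k x) = (𝒬.Q.π (D.σ j k x)).2 := fun x hx => by
    rw [Λ.π_z _ x hx.2, D.proj_σ _ _ x (hjk hx)]
  have cm : ∀ x ∈ T, t.L.π (Λ.z k x) = (𝒬.Q.π (𝒬.m (D.σ j k x) (D.σ i j x))).2 := fun x hx => by
    rw [𝒬.proj_m _ _ (c x hx), cz x hx]
  have c₁ : ∀ x ∈ T, t.L.π (t.L.src (t.L.e (Λ.z k x))) = (𝒬.Q.π (𝒬.Q.src (D.ρ i j k x))).2 :=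
    fun x hx => by rw [src_e, (D.proj_ρ _ _ _ x hx).1, cm x hx]
  have c₂ : ∀ x ∈ T, t.L.src (Λ.l i k x) = t.L.tgt (t.ηhat (t.L.e (Λ.z k x)) (D.ρ i j k x)) :=
    fun x hx => by
      rw [t.tgt_ηhat _ _ (c₁ x hx), tgt_e, (Λ.proj_l _ _ x (hik hx)).1, (D.proj_ρ _ _ _ x hx).2]
  have c₃ : ∀ x ∈ T, t.L.π (t.L.src (Λ.l j k x)) = (𝒬.Q.π (𝒬.Q.src (𝒬.Q.e (D.σ i j x)))).2 :=
    fun x hx => by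
      rw [src_e, (Λ.proj_l _ _ x (hjk hx)).1, t.proj_η _ _ (cz x hx), c x hx]
  have c₄ : ∀ x ∈ T, t.L.src (t.ηhat (Λ.l j k x) (𝒬.Q.e (D.σ i j x))) =
      t.L.tgt (t.θ (Λ.z k x) (D.σ j k x) (D.σ i j x)) := fun x hx => by
    rw [t.src_ηhat _ _ (c₃ x hx), src_e, (Λ.proj_l _ _ x (hjk hx)).1,
      (t.proj_θ _ _ _ (cz x hx) (c x hx)).2]
  have c₅ : ∀ x ∈ T, t.L.src (Λ.l i j x) = t.L.tgt (t.L.mul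
      (t.ηhat (Λ.l j k x) (𝒬.Q.e (D.σ i j x))) (t.θ (Λ.z k x) (D.σ j k x) (D.σ i j x))) :=
    fun x hx => by
      rw [tgt_mul (c₄ x hx), t.tgt_ηhat _ _ (c₃ x hx), tgt_e, (Λ.proj_l _ _ x (hjk hx)).2,
        (Λ.proj_l _ _ x (hij hx)).1]
  have sz := (Λ.smooth_z k).mono (s := 𝒰.U k) (fun x hx => hx.2 : T ⊆ 𝒰.U k)
  have sjk := (D.smooth_σ j k).mono hjk
  have sij := (D.smooth_σ i j).mono hij
  refine PrincipalBundle.SmoothInto.ratio (R := t.L.bundle) (J := M.I)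
    (t.L.smooth_mul _ _ _ _ ((Λ.smooth_l i j).mono hij) (t.L.smooth_mul _ _ _ _
      (t.smooth_ηhat _ _ _ _ ((Λ.smooth_l j k).mono hjk) (smoothInto_e sij) c₃)
      (smoothInto_θ sz sjk sij cz c) c₄) c₅)
    (t.L.smooth_mul _ _ _ _ ((Λ.smooth_l i k).mono hik)
      (t.smooth_ηhat _ _ _ _ (smoothInto_e sz) (D.smooth_ρ i j k) c₁) c₂) fun x hx => ?_
  refine ext_phase ?_ ?_ ?_
  · rw [src_act, src_mul (c₂ x hx), src_mul (c₅ x hx), src_mul (c₄ x hx), t.src_ηhat _ _ (c₁ x hx),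
      src_e, (D.proj_ρ _ _ _ x hx).1, (t.proj_θ _ _ _ (cz x hx) (c x hx)).1]
  · rw [tgt_act, tgt_mul (c₂ x hx), tgt_mul (c₅ x hx), (Λ.proj_l _ _ x (hik hx)).2,
      (Λ.proj_l _ _ x (hij hx)).2]
  · rw [phase_act, phase_mul (c₂ x hx), phase_mul (c₅ x hx), phase_mul (c₄ x hx),
      phase_ηhat (c₁ x hx), phase_ηhat (c₃ x hx), phase_θ (cz x hx) (c x hx), phase_e, phase_e,
      src_e, src_e, tgt_e, tgt_e, (D.proj_ρ _ _ _ x hx).1, (D.proj_ρ _ _ _ x hx).2,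
      (Λ.proj_l _ _ x (hjk hx)).1, (Λ.proj_l _ _ x (hjk hx)).2, D.proj_σ _ _ x (hij hx),
      D.proj_σ _ _ x (hjk hx), h, CechData.R, ofMul_toMul]
    abel

/-- The terms of `h` coming from `l` form the coboundary of a 1-cochain and disappear from `δh`.
There remains `δR - δβ = δR - α(s) = g`. -/
theorem ofMul_g {i j k l x : M} (hi : x ∈ 𝒰.U i) (hj : x ∈ 𝒰.U j) (hk : x ∈ 𝒰.U k)
    (hl : x ∈ 𝒰.U l) : Additive.ofMul (D.g ![i, j, k, l] x) = Additive.ofMul (Λ.h j k l x) -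
      Additive.ofMul (Λ.h i k l x) + Additive.ofMul (Λ.h i j l x) -
      Additive.ofMul (Λ.h i j k x) := by
  have e := D.ofMul_g_add_α hi hj hk hl
  have hπ : ∀ j, x ∈ 𝒰.U j → 𝒬.π (D.s i x) = 𝒬.π (D.s j x) := fun j hj => by
    rw [D.proj_s _ x hi, D.proj_s _ x hj]
  have e' := β_coherence (t := t) (hπ j hj) (hπ k hk) (hπ l hl)
  simp only [h, ofMul_toMul]
  grind

end LocalData

end Trivialisation

/-- With `h = exp(2πik)` on a refinement, `g = δh` makes `b = f - δk` integer-valued, and `δb = δf`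
is the restriction of `n`. -/
theorem eq_zero_of_isTrivial (h𝒬 : 𝒬.IsTrivial) {c : IntegralH4 M} (hc : 𝒬.IsFourClass c) :
    c = 0 := by
  obtain ⟨t⟩ := h𝒬
  obtain ⟨𝒰, D, f, n, hf, hfg, hn, rfl⟩ := hc
  obtain ⟨𝒱, r, hr, ⟨Λ⟩⟩ := t.exists_localData D
  obtain ⟨𝒲, r', hr', H⟩ := 𝒱.exists_refinement (p := 2) (fun τ O => ∃ k : M → ℂ,
    ContMDiffOn M.I 𝓘(ℝ, ℂ) ∞ k O ∧ ∀ x ∈ O,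
      (Λ.h (τ 0) (τ 1) (τ 2) x : ℂ) = Complex.exp (2 * Real.pi * Complex.I * k x))
    (fun τ O O' hO ⟨k, hk, hkh⟩ => ⟨k, hk.mono hO, fun x hx => hkh x (hO hx)⟩)
    (fun τ => ⟨0, contMDiffOn_const, fun x hx => hx.elim⟩)
    (fun τ x hx => by
      have h' : ∀ i, x ∈ 𝒱.U (τ i) := mem_iInter.1 hx
      obtain ⟨O, k, hO, hx', hk, hkh⟩ := exists_local_log
        (((𝒱.isOpen_U (τ 0)).inter (𝒱.isOpen_U (τ 1))).inter (𝒱.isOpen_U (τ 2)))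
        (Λ.contMDiffOn_h (τ 0) (τ 1) (τ 2)) ⟨⟨h' 0, h' 1⟩, h' 2⟩
      exact ⟨O, hO, hx', k, hk, hkh⟩)
  choose k hk hkh using H
  have hR : ∀ x, 𝒲.U x ⊆ 𝒰.U (r (r' x)) := fun x => (hr' x).trans (hr _)
  -- The primitive lives over the refinement map `r ∘ r'`, whereas the direct limit keeps indices
  -- fixed. `𝒳` refines `𝒰` in both ways, and `exists_cechD_eq_of_refinement` passes from one to the
  -- other.
  let 𝒳 := 𝒰.inf 𝒲
  have hin (τ : Fin 4 → M) : 𝒳.inter τ ⊆ 𝒰.inter (r ∘ r' ∘ τ) := fun x hx =>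
    PointedCover.mem_inter.2 fun i => hR _ (PointedCover.mem_inter.1 hx i).2
  have hface (τ : Fin 4 → M) (j : Fin 4) : 𝒳.inter τ ⊆ 𝒲.inter (τ ∘ j.succAbove) := fun x hx =>
    PointedCover.mem_inter.2 fun i => (PointedCover.mem_inter.1 hx _).2
  have H (τ : Fin 4 → M) : ∃ b : LocallyConstant (𝒳.inter τ) ℤ, ∀ x : 𝒳.inter τ,
      ((b x : ℤ) : ℂ) = f (r ∘ r' ∘ τ) x -
        ∑ j : Fin 4, (-1 : ℂ) ^ (j : ℕ) * k (τ ∘ j.succAbove) x := by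
    refine exists_locallyConstant (f := fun x => f (r ∘ r' ∘ τ) x -
        ∑ j : Fin 4, (-1 : ℂ) ^ (j : ℕ) * k (τ ∘ j.succAbove) x)
      (((hf _).continuousOn.mono (hin τ)).sub
      (continuousOn_finsetSum _ fun j _ =>
        continuousOn_const.mul ((hk _).continuousOn.mono (hface τ j)))) fun x hx => ?_
    rw [← exp_eq_one_iff_int]
    have hx' : ∀ i, x ∈ 𝒱.U (r' (τ i)) := fun i => hr' _ (PointedCover.mem_inter.1 hx i).2
    have key := Λ.ofMul_g (hx' 0) (hx' 1) (hx' 2) (hx' 3)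
    have key' := congrArg (fun a : Additive ℂˣ => ((Additive.toMul a : ℂˣ) : ℂ)) key
    simp only [toMul_sub, toMul_add, toMul_ofMul, Units.val_mul, Units.val_div_eq_div_val] at key'
    have hg := hfg _ x (hin τ hx)
    have hg' : D.g (r ∘ r' ∘ τ) x = (D.refine r hr).g ![r' (τ 0), r' (τ 1), r' (τ 2), r' (τ 3)] x :=
      congrArg (fun σ => D.g σ x) (Fin.eq_vec_four (r ∘ r' ∘ τ))
    have hh : ∀ j : Fin 4, _ := fun j => hkh _ x (hface τ j hx)
    have h0 := hh 0
    have h1 := hh 1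
    have h2 := hh 2
    have h3 := hh 3
    rw [hg', key'] at hg
    simp [Fin.succAbove] at h0 h1 h2 h3
    rw [h0, h1, h2, h3, ← Complex.exp_sub, ← Complex.exp_add, ← Complex.exp_sub] at hg
    simp only [Fin.sum_univ_four]
    rw [mul_sub, Complex.exp_sub, ← hg, ← Complex.exp_sub, Complex.exp_eq_one_iff]
    refine ⟨0, ?_⟩
    simp
    ring
  choose b hb using H
  rw [cechClass_eq_zero_iff]
  refine ⟨𝒳, 𝒰.le_inf_left 𝒲, exists_cechD_eq_of_refinement (r := r ∘ r') _
    (fun x => inter_subset_right.trans (hR x)) n ⟨b, fun τ x hx => ?_⟩⟩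
  rw [← Int.cast_inj (α := ℂ), cechD_apply, hn]
  push_cast
  obtain ⟨F, hF⟩ := exists_eq_curried f
  obtain ⟨K, hK⟩ : ∃ K : M → M → M → M → ℂ, ∀ σ, k σ = K (σ 0) (σ 1) (σ 2) :=
    ⟨fun a b c => k ![a, b, c], fun σ => congrArg k (by
      funext i
      fin_cases i <;> rfl)⟩
  simp only [hb, hF, hK]
  simp [Fin.sum_univ_five, Fin.sum_univ_four, Fin.succAbove]
  ring

end Bundle2Gerbe

/-! ## Partitions of unity and Čech cochains -/

/-- The exponential map `z ↦ exp(2πiz)` as a map into the Lie group `ℂˣ`. -/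
noncomputable def expUnit (z : ℂ) : ℂˣ :=
  Units.mk0 (Complex.exp (2 * Real.pi * Complex.I * z)) (Complex.exp_ne_zero _)

theorem contMDiff_expUnit : ContMDiff 𝓘(ℝ, ℂ) 𝓘(ℝ, ℂ) ∞ expUnit := by
  refine ContMDiff.of_comp_isOpenEmbedding Units.isOpenEmbedding_val ?_
  exact (Complex.contDiff_exp.comp (contDiff_const.mul contDiff_id)).contMDiff

theorem expUnit_add (z w : ℂ) : expUnit (z + w) = expUnit z * expUnit w :=
  Units.ext (by simp [expUnit, mul_add, Complex.exp_add])

theorem expUnit_sub (z w : ℂ) : expUnit (z - w) = expUnit z / expUnit w :=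
  Units.ext (by simp [expUnit, mul_sub, Complex.exp_sub])

theorem expUnit_intCast (n : ℤ) : expUnit n = 1 := Units.ext (exp_eq_one_iff_int.2 ⟨n, rfl⟩)

/-- The sheaf of smooth functions has no cohomology in degree three. -/
theorem exists_smooth_primitive {M : SmoothManifold.{u}} [FiniteDimensional ℝ M.model]
    [SecondCountableTopology M] {𝒰 : PointedCover M} {f : (Fin 4 → M) → M → ℂ}
    (hf : ∀ τ, ContMDiffOn M.I 𝓘(ℝ, ℂ) ∞ (f τ) (𝒰.inter τ))
    (hd : ∀ (τ : Fin 5 → M), ∀ x ∈ 𝒰.inter τ,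
      ∑ j : Fin 5, (-1 : ℂ) ^ (j : ℕ) * f (τ ∘ j.succAbove) x = 0) :
    ∃ k : M → M → M → M → ℂ,
      (∀ i j l, ContMDiffOn M.I 𝓘(ℝ, ℂ) ∞ (k i j l) (𝒰.U i ∩ 𝒰.U j ∩ 𝒰.U l)) ∧
      ∀ i j l m, ∀ x ∈ 𝒰.U i ∩ 𝒰.U j ∩ 𝒰.U l ∩ 𝒰.U m,
        f ![i, j, l, m] x = k j l m x - k i l m x + k i j m x - k i j l x := by
  have : LocallyCompactSpace M := Manifold.locallyCompact_of_finiteDimensional M.I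
  obtain ⟨φ, hφ⟩ := SmoothPartitionOfUnity.exists_isSubordinate M.I isClosed_univ 𝒰.U 𝒰.isOpen_U
    (fun x _ => mem_iUnion.2 ⟨x, 𝒰.mem_U x⟩)
  -- The contracting homotopy of a partition of unity. The closed support of `φ p` lies in `𝒰.U p`,
  -- so each summand is smooth on the whole triple intersection.
  refine ⟨fun i j l x => ∑ᶠ p, φ p x • f ![p, i, j, l] x, fun i j l x hx => ?_, ?_⟩
  · refine (φ.contMDiffAt_finsum fun p hp => ?_).contMDiffWithinAt
    refine (hf _).contMDiffAt ((𝒰.isOpen_inter _).mem_nhds ?_)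
    simp [PointedCover.mem_inter, Fin.forall_fin_succ, hφ p hp, hx.1.1, hx.1.2, hx.2]
  · intro i j l m x ⟨⟨⟨hi, hj⟩, hl⟩, hm⟩
    have hfin := φ.locallyFinite.point_finite x
    have hs (a b c : M) : ∑ᶠ p, φ p x • f ![p, a, b, c] x =
        ∑ p ∈ hfin.toFinset, φ p x • f ![p, a, b, c] x :=
      finsum_eq_sum_of_support_subset _ fun p hp => by
        rw [Finite.coe_toFinset]
        exact left_ne_zero_of_smul hp
    have h1 : ∑ p ∈ hfin.toFinset, φ p x = 1 := by
      rw [← φ.sum_eq_one (mem_univ x)]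
      refine (finsum_eq_sum_of_support_subset _ fun p hp => ?_).symm
      rw [Finite.coe_toFinset]
      exact hp
    simp only [hs]
    rw [← Finset.sum_sub_distrib, ← Finset.sum_add_distrib, ← Finset.sum_sub_distrib]
    conv_lhs => rw [← one_smul ℝ (f _ x), ← h1, Finset.sum_smul]
    refine Finset.sum_congr rfl fun p hp => ?_
    rw [← smul_sub, ← smul_add, ← smul_sub]
    congr 1
    have hp' : x ∈ 𝒰.U p := hφ p (subset_closure ((hfin.mem_toFinset).1 hp))
    -- Where `φ p` does not vanish, the cocycle condition at `(p, i, j, l, m)` turns the `p`-th term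
    -- of `δk` into `φ p` times `f_ijlm`.
    have key := hd ![p, i, j, l, m] x (by
      simp [PointedCover.mem_inter, Fin.forall_fin_succ, hp', hi, hj, hl, hm])
    obtain ⟨F, hF⟩ := exists_eq_curried f
    simp only [hF] at key ⊢
    simp [Fin.sum_univ_five, Fin.succAbove] at key
    simp
    linear_combination key

/-! ### Normalising the cocycle to 1 when the four class vanishes -/

namespace Bundle2Gerbe

open BundleGerbe

variable {M : SmoothManifold.{u}} {𝒬 : Bundle2Gerbe M}

/-- Multiplication of the sections `ρ` by a smooth cochain whose coboundary is `g` leads to Čech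
data whose cocycle is trivial. -/
theorem CechData.exists_g_eq_one {𝒰 : PointedCover M} (D : 𝒬.CechData 𝒰) {h : M → M → M → M → ℂˣ}
    (hh : ∀ i j k, ContMDiffOn M.I 𝓘(ℝ, ℂ) ∞ (h i j k) (𝒰.U i ∩ 𝒰.U j ∩ 𝒰.U k))
    (hg : ∀ i j k l, ∀ x ∈ 𝒰.U i ∩ 𝒰.U j ∩ 𝒰.U k ∩ 𝒰.U l,
      D.g ![i, j, k, l] x = h j k l x / h i k l x * h i j l x / h i j k x) :
    ∃ D' : 𝒬.CechData 𝒰, ∀ τ x, D'.g τ x = 1 := by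
  have hproj : ∀ i j k, ∀ x ∈ 𝒰.U i ∩ 𝒰.U j ∩ 𝒰.U k,
      𝒬.Q.src (𝒬.Q.act (h i j k x)⁻¹ (D.ρ i j k x)) = 𝒬.m (D.σ j k x) (D.σ i j x) ∧
        𝒬.Q.tgt (𝒬.Q.act (h i j k x)⁻¹ (D.ρ i j k x)) = D.σ i k x := fun i j k x hx => by
    rw [src_act, tgt_act]
    exact D.proj_ρ i j k x hx
  refine ⟨{ D with
    ρ := fun i j k x => 𝒬.Q.act (h i j k x)⁻¹ (D.ρ i j k x)
    smooth_ρ := fun i j k => (D.smooth_ρ i j k).act (hh i j k).inv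
    proj_ρ := hproj
    g := fun _ _ => 1
    g_spec := fun i j k l x hx => ?_ }, fun _ _ => rfl⟩
  obtain ⟨⟨⟨hi, hj⟩, hk⟩, hl⟩ := id hx
  have c := composable_σ (D := D) hj hk hl
  have c' := composable_σ (D := D) hi hj hk
  obtain ⟨s₁, t₁, p₁⟩ := outerFaces_spec c c' (hproj j k l x ⟨⟨hj, hk⟩, hl⟩)
    (hproj i j l x ⟨⟨hi, hj⟩, hl⟩)
  obtain ⟨s₂, t₂, p₂⟩ := innerFaces_spec c c' (hproj i j k x ⟨⟨hi, hj⟩, hk⟩)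
    (hproj i k l x ⟨⟨hi, hk⟩, hl⟩)
  rw [D.proj_σ i j x ⟨hi, hj⟩, D.proj_σ j k x ⟨hj, hk⟩, D.proj_σ k l x ⟨hk, hl⟩] at p₂
  rw [outerFaces] at s₁ t₁ p₁
  rw [innerFaces] at s₂ t₂ p₂
  refine ext_phase ?_ ?_ ?_
  · rw [src_act, s₁, s₂]
  · rw [tgt_act, t₁, t₂]
  · rw [phase_act, p₁, p₂]
    -- Division of `ρ` by `h` subtracts `δh = g` from `δR`, so the new cocycle is trivial.
    have e := D.ofMul_g_add_α hi hj hk hl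
    rw [hg i j k l x hx] at e
    simp only [R, ofMul_mul, ofMul_div] at e
    simp only [phase_act, ofMul_inv, ofMul_one]
    grind

/-- On a finer cover `δf = δb` with `b` integral, so the smooth cocycle `f - b` is some `δk`. Since
`exp(2πib) = 1`, the cochain `exp(2πik)` has coboundary `g`. -/
theorem exists_cechData_g_eq_one [FiniteDimensional ℝ M.model] [SecondCountableTopology M]
    (h : 𝒬.IsFourClass 0) :
    ∃ (𝒰 : PointedCover M) (D : 𝒬.CechData 𝒰), ∀ τ x, D.g τ x = 1 := by
  classical
  obtain ⟨𝒰, D, f, n, hf, hfg, hn, h0⟩ := h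
  obtain ⟨𝒱, h𝒱, b, hb⟩ := cechClass_eq_zero_iff.1 h0.symm
  let B (τ : Fin 4 → M) (x : M) : ℂ := if hx : x ∈ 𝒱.inter τ then (b τ ⟨x, hx⟩ : ℤ) else 0
  have hB (τ : Fin 4 → M) (x : M) (hx : x ∈ 𝒱.inter τ) : B τ x = (b τ ⟨x, hx⟩ : ℤ) := dif_pos hx
  have hBs (τ : Fin 4 → M) : ContMDiffOn M.I 𝓘(ℝ, ℂ) ∞ (B τ) (𝒱.inter τ) := by
    refine contMDiffOn_of_forall_isOpen fun x hx => ?_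
    obtain ⟨O, hO, hxO, hc⟩ := (b τ).isLocallyConstant.exists_open ⟨x, hx⟩
    obtain ⟨O', hO', rfl⟩ := isOpen_induced_iff.1 hO
    refine ⟨O', hO', hxO, (contMDiffOn_const (c := B τ x)).congr fun y hy => ?_⟩
    rw [hB _ _ hx, hB _ _ hy.1]
    exact congrArg Int.cast (hc ⟨y, hy.1⟩ hy.2)
  obtain ⟨k, hk, hkf⟩ := exists_smooth_primitive (𝒰 := 𝒱) (f := fun τ x => f τ x - B τ x)
    (fun τ => ((hf τ).mono (PointedCover.inter_mono h𝒱 τ)).sub (hBs τ)) fun τ x hx => by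
      have e := congrArg (Int.cast (R := ℂ)) (congrArg (fun c => c ⟨x, hx⟩) (congrFun hb τ))
      rw [cechD_apply] at e
      change _ = ((n.1 τ ⟨x, PointedCover.inter_mono h𝒱 τ hx⟩ : ℤ) : ℂ) at e
      rw [hn] at e
      push_cast at e
      have hB' : ∀ j : Fin 5, _ := fun j =>
        hB (τ ∘ j.succAbove) x (PointedCover.inter_face 𝒱 τ j hx)
      simp only [hB', mul_sub, Finset.sum_sub_distrib]
      rw [← e, sub_self]
  obtain ⟨D', hD'⟩ := (D.refine (𝒱 := 𝒱) id h𝒱).exists_g_eq_one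
    (h := fun i j l x => expUnit (k i j l x))
    (fun i j l => contMDiff_expUnit.comp_contMDiffOn (hk i j l)) fun i j l m x hx => by
      have hx' : x ∈ 𝒱.inter ![i, j, l, m] := by
        simp [PointedCover.mem_inter, Fin.forall_fin_succ, hx.1.1.1, hx.1.1.2, hx.1.2, hx.2]
      rw [← expUnit_sub, ← expUnit_add, ← expUnit_sub, ← hkf i j l m x hx, expUnit_sub,
        hB _ _ hx', expUnit_intCast, div_one]
      exact Units.ext (hfg _ x (PointedCover.inter_mono h𝒱 _ hx'))
  exact ⟨𝒱, D', hD'⟩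

end Bundle2Gerbe

/-! ## Constructions of manifolds and bundles -/

namespace SmoothManifold

/-- The product of two manifolds. -/
noncomputable def prod (X Y : SmoothManifold.{u}) : SmoothManifold.{u} where
  carrier := X × Y
  model := X.model × Y.model
  chartedSpace := inferInstanceAs (ChartedSpace (ModelProd X.model Y.model) (X × Y))
  isManifold := by
    have : IsManifold (X.I.prod Y.I) ∞ (X × Y) := inferInstance
    rwa [← modelWithCornersSelf_prod] at this

theorem I_prod (X Y : SmoothManifold.{u}) : (X.prod Y).I = X.I.prod Y.I :=
  modelWithCornersSelf_prod

section Sigma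

variable (ι : Type u) (Y : SmoothManifold.{u}) (A : ι → Set Y) (hA : ∀ i, IsOpen (A i))

/-- A set as a manifold of dimension zero. -/
noncomputable def discrete : SmoothManifold.{u} :=
  letI : TopologicalSpace ι := ⊥
  haveI : DiscreteTopology ι := ⟨rfl⟩
  letI : ChartedSpace PUnit.{u + 1} ι := ChartedSpace.ofDiscreteTopology
  { carrier := ι
    model := PUnit
    isManifold := IsManifold.of_discreteTopology _ }

instance : DiscreteTopology (discrete ι) := ⟨rfl⟩

/-- The total space of a disjoint union of open subsets, as an open subset of a product. -/
noncomputable def sigmaSet : TopologicalSpace.Opens ((discrete ι).prod Y) where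
  carrier := {p | p.2 ∈ A p.1}
  is_open' := by
    refine isOpen_iff_mem_nhds.2 fun p hp => ?_
    refine mem_of_superset (prod_mem_nhds (X := discrete ι) (Y := Y)
      ((isOpen_discrete {p.1}).mem_nhds rfl) ((hA p.1).mem_nhds hp)) ?_
    rintro ⟨i, y⟩ ⟨hi, hy⟩
    obtain rfl : i = p.1 := hi
    exact hy

/-- The disjoint union of a family of open subsets of a manifold. -/
noncomputable def sigma : SmoothManifold.{u} where
  carrier := sigmaSet ι Y A hA
  model := ((discrete ι).prod Y).model
  metrizableSpace := Topology.IsEmbedding.subtypeVal.metrizableSpace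

namespace sigma

variable {ι Y A hA}

/-- The index of the component of a point of a disjoint union. -/
noncomputable def idx (z : sigma ι Y A hA) : ι := z.1.1

/-- The point of `Y` which corresponds to a point of a disjoint union of open subsets. -/
noncomputable def pt (z : sigma ι Y A hA) : Y := z.1.2

theorem pt_mem (z : sigma ι Y A hA) : pt z ∈ A (idx z) := z.2

variable (hA) in
/-- The point of a disjoint union given by an index and a point. -/
noncomputable def mk (i : ι) (y : Y) (h : y ∈ A i) : sigma ι Y A hA := ⟨(i, y), h⟩

theorem ext {z z' : sigma ι Y A hA} (h : idx z = idx z') (h' : pt z = pt z') : z = z' :=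
  Subtype.ext (Prod.ext h h')

theorem contMDiff_pt : ContMDiff (sigma ι Y A hA).I Y.I ∞ (pt (hA := hA)) := by
  have h : ContMDiff ((discrete ι).prod Y).I ((discrete ι).prod Y).I ∞
    (Subtype.val : sigmaSet ι Y A hA → (discrete ι).prod Y) := contMDiff_subtype_val
  have h' : ContMDiff ((discrete ι).prod Y).I Y.I ∞ (fun p : (discrete ι).prod Y => p.2) := by
    rw [I_prod]
    exact contMDiff_snd (M := discrete ι) (N := Y)
  exact h'.comp h

theorem continuous_idx : Continuous (fun z : sigma ι Y A hA => (idx z : discrete ι)) :=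
  continuous_fst.comp continuous_subtype_val

section Maps

variable {E' H' N : Type*} [NormedAddCommGroup E'] [NormedSpace ℝ E'] [TopologicalSpace H']
  [TopologicalSpace N] [ChartedSpace H' N] {J : ModelWithCorners ℝ E' H'} {T : Set N}
  {f : N → sigma ι Y A hA}

theorem exists_isOpen_idx_eq (hf : ContinuousOn f T) {x : N} (hx : x ∈ T) :
    ∃ O, IsOpen O ∧ x ∈ O ∧ ∀ y ∈ T ∩ O, idx (f y) = idx (f x) := by
  obtain ⟨O, hO, h⟩ := (continuous_idx.comp_continuousOn hf).exists_isOpen_inter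
    (isOpen_discrete {(idx (f x) : discrete ι)})
  exact ⟨O, hO, (h x hx).2 rfl, fun y hy => (h y hy.1).1 hy.2⟩

/-- The index is a coordinate in a discrete factor, for which smoothness means local constancy. -/
theorem contMDiffOn_iff : ContMDiffOn J (sigma ι Y A hA).I ∞ f T ↔
    ContMDiffOn J Y.I ∞ (fun x => pt (f x)) T ∧
      ∀ x ∈ T, ∃ O, IsOpen O ∧ x ∈ O ∧ ∀ y ∈ T ∩ O, idx (f y) = idx (f x) := by
  refine ⟨fun h => ⟨contMDiff_pt.comp_contMDiffOn h,
    fun x hx => exists_isOpen_idx_eq h.continuousOn hx⟩, fun ⟨h, h'⟩ => ?_⟩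
  refine contMDiffOn_of_forall_isOpen fun x hx => ?_
  obtain ⟨O, hO, hxO, hi⟩ := h' x hx
  refine ⟨O, hO, hxO, fun y hy => ?_⟩
  refine (ContMDiffWithinAt.subtypeVal_comp_iff (I' := ((discrete ι).prod Y).I)
    (sigmaSet ι Y A hA) f _ y).1 ?_
  rw [I_prod]
  refine ContMDiffWithinAt.prodMk (M' := discrete ι) (N' := Y)
    (f := fun y => (idx (f y) : discrete ι))
    (g := fun y => pt (f y)) ?_ (h.mono inter_subset_left y hy)
  exact (contMDiffOn_const (c := (idx (f x) : discrete ι))).congr hi y hy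

end Maps

end sigma

end Sigma

end SmoothManifold

section LocallyConstant

/-- Smoothness of a family of maps with a locally constant parameter. -/
theorem contMDiffOn_of_locallyConstant {E₁ H₁ A₁ E₂ H₂ A₂ K : Type*} [NormedAddCommGroup E₁]
    [NormedSpace ℝ E₁] [TopologicalSpace H₁] [TopologicalSpace A₁] [ChartedSpace H₁ A₁]
    [NormedAddCommGroup E₂] [NormedSpace ℝ E₂] [TopologicalSpace H₂] [TopologicalSpace A₂]
    [ChartedSpace H₂ A₂] {J₁ : ModelWithCorners ℝ E₁ H₁} {J₂ : ModelWithCorners ℝ E₂ H₂}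
    {T : Set A₁} (c : A₁ → K)
    (hc : ∀ x ∈ T, ∃ O, IsOpen O ∧ x ∈ O ∧ ∀ y ∈ T ∩ O, c y = c x) {f : K → A₁ → A₂}
    (hf : ∀ k, ContMDiffOn J₁ J₂ ∞ (f k) (T ∩ {x | c x = k})) :
    ContMDiffOn J₁ J₂ ∞ (fun x => f (c x) x) T := by
  refine contMDiffOn_of_forall_isOpen fun x hx => ?_
  obtain ⟨O, hO, hxO, h⟩ := hc x hx
  exact ⟨O, hO, hxO, ((hf (c x)).mono fun y hy => ⟨hy.1, h y hy⟩).congr fun y hy => by rw [h y hy]⟩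

variable {E H B : Type u} [NormedAddCommGroup E] [NormedSpace ℝ E] [TopologicalSpace H]
  [TopologicalSpace B] [ChartedSpace H B] {I : ModelWithCorners ℝ E H} {S : Set B}
  {R : PrincipalBundle I S} {E' H' A : Type u} [NormedAddCommGroup E'] [NormedSpace ℝ E']
  [TopologicalSpace H'] [TopologicalSpace A] [ChartedSpace H' A] {J : ModelWithCorners ℝ E' H'}
  {T : Set A}

theorem PrincipalBundle.smoothInto_of_locallyConstant {K : Type*} (c : A → K)
    (hc : ∀ x ∈ T, ∃ O, IsOpen O ∧ x ∈ O ∧ ∀ y ∈ T ∩ O, c y = c x) {f : K → A → R.P}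
    (hf : ∀ k, R.SmoothInto J (f k) (T ∩ {x | c x = k})) :
    R.SmoothInto J (fun x => f (c x) x) T := by
  refine .of_local fun x hx => ?_
  obtain ⟨O, hO, hxO, h⟩ := hc x hx
  exact ⟨O, hO, hxO, ((hf (c x)).mono fun y hy => ⟨hy.1, h y hy⟩).congr fun y hy => by rw [h y hy]⟩

/-- The pullback of a principal `ℂˣ`-bundle along a smooth map. -/
noncomputable def PrincipalBundle.pullback (R : PrincipalBundle I S) {φ : A → B}
    (hφ : ContMDiffOn J I ∞ φ T) (hT : MapsTo φ T S) : PrincipalBundle J T where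
  P := {w : A × R.P // w.1 ∈ T ∧ R.proj w.2 = φ w.1}
  proj w := w.1.1
  range_proj := by
    refine Subset.antisymm (range_subset_iff.2 fun w => w.2.1) fun x hx => ?_
    have h := hT hx
    rw [← R.range_proj] at h
    obtain ⟨p, hp⟩ := h
    exact ⟨⟨(x, p), hx, hp⟩, rfl⟩
  act c w := ⟨(w.1.1, R.act c w.1.2), w.2.1, (R.proj_act _ _).trans w.2.2⟩
  one_act w := Subtype.ext (Prod.ext rfl (R.one_act _))
  mul_act c d w := Subtype.ext (Prod.ext rfl (R.mul_act c d _))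
  proj_act c w := rfl
  existsUnique_act := by
    rintro ⟨⟨x, p⟩, hx, hp⟩ ⟨⟨y, q⟩, hy, hq⟩ rfl
    obtain ⟨c, hc, hc'⟩ := R.existsUnique_act p q (hp.trans hq.symm)
    exact ⟨c, Subtype.ext (Prod.ext rfl hc),
      fun d hd => hc' d (congrArg Prod.snd (congrArg Subtype.val hd))⟩
  ι := R.ι
  -- The preimage of `R.dom i` is only relatively open in `T`; an ambient open set with the same
  -- trace on `T` replaces it.
  dom i := (hφ.continuousOn.exists_isOpen_inter (R.isOpen_dom i)).choose
  isOpen_dom i := (hφ.continuousOn.exists_isOpen_inter (R.isOpen_dom i)).choose_spec.1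
  cover x hx := by
    obtain ⟨i, hi⟩ := R.cover _ (hT hx)
    exact ⟨i, ((hφ.continuousOn.exists_isOpen_inter (R.isOpen_dom i)).choose_spec.2 x hx).2 hi⟩
  coord i w := R.coord i w.1.2
  coord_act i c w hw := R.coord_act i c _ (by
    rw [w.2.2]
    exact ((hφ.continuousOn.exists_isOpen_inter (R.isOpen_dom i)).choose_spec.2 _ w.2.1).1 hw)
  smooth_transition i j := by
    obtain ⟨t, ht, htp⟩ := R.smooth_transition i j
    have h := fun k => (hφ.continuousOn.exists_isOpen_inter (R.isOpen_dom k)).choose_spec.2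
    refine ⟨fun x => t (φ x), ht.comp (hφ.mono inter_subset_left) fun x hx =>
      ⟨hT hx.1, (h i x hx.1).1 hx.2.1, (h j x hx.1).1 hx.2.2⟩, fun w hw => ?_⟩
    rw [htp, w.2.2]
    rw [w.2.2]
    exact ⟨(h i _ w.2.1).1 hw.1, (h j _ w.2.1).1 hw.2⟩

theorem PrincipalBundle.smoothInto_pullback_iff {φ : A → B} (hφ : ContMDiffOn J I ∞ φ T)
    (hT : MapsTo φ T S) {E'' H'' A' : Type u} [NormedAddCommGroup E''] [NormedSpace ℝ E'']
    [TopologicalSpace H''] [TopologicalSpace A'] [ChartedSpace H'' A']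
    {J' : ModelWithCorners ℝ E'' H''} {T' : Set A'} {f : A' → (R.pullback hφ hT).P} :
    (R.pullback hφ hT).SmoothInto J' f T' ↔
      ContMDiffOn J' J ∞ (fun x => (f x).1.1) T' ∧ R.SmoothInto J' (fun x => (f x).1.2) T' := by
  have h := fun k => (hφ.continuousOn.exists_isOpen_inter (R.isOpen_dom k)).choose_spec.2
  have hR : (fun x => R.proj (f x).1.2) = fun x => φ (f x).1.1 := funext fun x => (f x).2.2
  have hd (i : R.ι) (x : A') : (f x).1.1 ∈ (R.pullback hφ hT).dom i ↔
      R.proj (f x).1.2 ∈ R.dom i := by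
    rw [(f x).2.2]
    exact h i _ (f x).2.1
  have hset (i : R.ι) : T' ∩ {x | (R.pullback hφ hT).proj (f x) ∈ (R.pullback hφ hT).dom i} =
      T' ∩ {x | R.proj (f x).1.2 ∈ R.dom i} := by
    ext x
    exact and_congr_right fun _ => hd i x
  constructor
  · intro hf
    refine ⟨hf.proj, ?_, fun i => ?_⟩
    · rw [hR]
      exact hφ.comp hf.proj fun x _ => (f x).2.1
    · rw [← hset]
      exact hf.coord i
  · rintro ⟨h₁, h₂⟩
    refine ⟨h₁, fun i => ?_⟩
    exact (hset i).symm ▸ h₂.coord i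

end LocallyConstant

/-! ## The trivialising bundle gerbe -/

namespace Bundle2Gerbe

open BundleGerbe SmoothManifold

variable {M : SmoothManifold.{u}} {𝒬 : Bundle2Gerbe M}

theorem contMDiff_fst_π : ContMDiff 𝒬.Q.Y.I 𝒬.X.I ∞ fun y => (𝒬.Q.π y).1 :=
  contMDiff_fst.comp 𝒬.Q.admitsLocalSections.smooth

theorem contMDiff_snd_π : ContMDiff 𝒬.Q.Y.I 𝒬.X.I ∞ fun y => (𝒬.Q.π y).2 :=
  contMDiff_snd.comp 𝒬.Q.admitsLocalSections.smooth

namespace CechData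

variable {𝒰 : PointedCover M} (D : 𝒬.CechData 𝒰)

/-! ### Composition twisted by `ρ` -/

/-- The composite `σ_ik ∘ y → y''` of `u : σ_ij ∘ y → y'` and `v : σ_jk ∘ y' → y''`. -/
noncomputable def comp (i j k x : M) (y : 𝒬.Q.Y) (v u : 𝒬.Q.P) : 𝒬.Q.P :=
  𝒬.Q.mul v (𝒬.Q.mul (𝒬.mhat (𝒬.Q.e (D.σ j k x)) u) (𝒬.Q.mul (𝒬.a (D.σ j k x) (D.σ i j x) y)
    (𝒬.Q.inv (𝒬.mhat (D.ρ i j k x) (𝒬.Q.e y)))))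

section Comp

variable {D} {i j k x : M} (hi : x ∈ 𝒰.U i) (hj : x ∈ 𝒰.U j) (hk : x ∈ 𝒰.U k) {y : 𝒬.Q.Y}
  {v u : 𝒬.Q.P} (hy : (𝒬.Q.π y).2 = D.s i x) (hu : 𝒬.Q.src u = 𝒬.m (D.σ i j x) y)
  (hv : 𝒬.Q.src v = 𝒬.m (D.σ j k x) (𝒬.Q.tgt u))

include hi hj hk hy hu hv

theorem comp_composable :
    (𝒬.Q.π (D.σ j k x)).1 = (𝒬.Q.π (D.σ i j x)).2 ∧ (𝒬.Q.π (D.σ i j x)).1 = (𝒬.Q.π y).2 ∧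
    (𝒬.Q.π (𝒬.Q.src (D.ρ i j k x))).1 = (𝒬.Q.π (𝒬.Q.src (𝒬.Q.e y))).2 ∧
    𝒬.Q.src (𝒬.a (D.σ j k x) (D.σ i j x) y) =
      𝒬.Q.tgt (𝒬.Q.inv (𝒬.mhat (D.ρ i j k x) (𝒬.Q.e y))) ∧
    (𝒬.Q.π (𝒬.Q.src (𝒬.Q.e (D.σ j k x)))).1 = (𝒬.Q.π (𝒬.Q.src u)).2 ∧
    𝒬.Q.src (𝒬.mhat (𝒬.Q.e (D.σ j k x)) u) = 𝒬.Q.tgt (𝒬.Q.mul (𝒬.a (D.σ j k x) (D.σ i j x) y)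
      (𝒬.Q.inv (𝒬.mhat (D.ρ i j k x) (𝒬.Q.e y)))) ∧
    𝒬.Q.src v = 𝒬.Q.tgt (𝒬.Q.mul (𝒬.mhat (𝒬.Q.e (D.σ j k x)) u)
      (𝒬.Q.mul (𝒬.a (D.σ j k x) (D.σ i j x) y)
        (𝒬.Q.inv (𝒬.mhat (D.ρ i j k x) (𝒬.Q.e y))))) := by
  have c := composable_σ (D := D) hi hj hk
  have c' : (𝒬.Q.π (D.σ i j x)).1 = (𝒬.Q.π y).2 := by rw [hy, D.proj_σ _ _ x ⟨hi, hj⟩]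
  have hρ := D.proj_ρ i j k x ⟨⟨hi, hj⟩, hk⟩
  have c₁ : (𝒬.Q.π (𝒬.Q.src (D.ρ i j k x))).1 = (𝒬.Q.π (𝒬.Q.src (𝒬.Q.e y))).2 := by
    rw [src_e, hρ.1, 𝒬.proj_m _ _ c, c']
  have c₂ : 𝒬.Q.src (𝒬.a (D.σ j k x) (D.σ i j x) y) =
      𝒬.Q.tgt (𝒬.Q.inv (𝒬.mhat (D.ρ i j k x) (𝒬.Q.e y))) := by
    rw [tgt_inv, 𝒬.src_mhat _ _ c₁, src_e, hρ.1, (𝒬.proj_a _ _ _ c c').1]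
  have c₃ : (𝒬.Q.π (𝒬.Q.src (𝒬.Q.e (D.σ j k x)))).1 = (𝒬.Q.π (𝒬.Q.src u)).2 := by
    rw [src_e, hu, 𝒬.proj_m _ _ c', c]
  have c₄ : 𝒬.Q.src (𝒬.mhat (𝒬.Q.e (D.σ j k x)) u) =
      𝒬.Q.tgt (𝒬.Q.mul (𝒬.a (D.σ j k x) (D.σ i j x) y)
        (𝒬.Q.inv (𝒬.mhat (D.ρ i j k x) (𝒬.Q.e y)))) := by
    rw [tgt_mul c₂, 𝒬.src_mhat _ _ c₃, src_e, hu, (𝒬.proj_a _ _ _ c c').2]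
  exact ⟨c, c', c₁, c₂, c₃, c₄, by rw [tgt_mul c₄, 𝒬.tgt_mhat _ _ c₃, tgt_e, hv]⟩

/-- The chain is `σ_ik ∘ y → (σ_jk ∘ σ_ij) ∘ y → σ_jk ∘ (σ_ij ∘ y) → σ_jk ∘ y' → y''`. Its first
arrow, inverse to `ρ`, contributes `-R`, and its second, the associator, contributes `α`. -/
theorem comp_spec : 𝒬.Q.src (D.comp i j k x y v u) = 𝒬.m (D.σ i k x) y ∧
    𝒬.Q.tgt (D.comp i j k x y v u) = 𝒬.Q.tgt v ∧
    𝒬.Q.phase (D.comp i j k x y v u) = 𝒬.Q.phase v + 𝒬.Q.phase u +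
      𝒬.ν (D.σ j k x) (𝒬.Q.tgt u) + 𝒬.ν (D.σ i j x) y - 𝒬.ν (D.σ i k x) y +
      𝒬.α (𝒬.Q.π y).1 (D.s i x) (D.s j x) (D.s k x) - D.R i j k x := by
  obtain ⟨c, c', c₁, c₂, c₃, c₄, c₅⟩ := comp_composable hi hj hk hy hu hv
  have hρ := D.proj_ρ i j k x ⟨⟨hi, hj⟩, hk⟩
  refine ⟨?_, ?_, ?_⟩
  · rw [comp, src_mul c₅, src_mul c₄, src_mul c₂, src_inv, 𝒬.tgt_mhat _ _ c₁, tgt_e, hρ.2]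
  · rw [comp, tgt_mul c₅]
  · rw [comp, phase_mul c₅, phase_mul c₄, phase_mul c₂, phase_inv, phase_mhat c₁, phase_mhat c₃,
      phase_a c c', phase_e, phase_e, src_e, src_e, tgt_e, tgt_e, hu, hρ.1, hρ.2, hy,
      D.proj_σ _ _ x ⟨hi, hj⟩, D.proj_σ _ _ x ⟨hj, hk⟩, R]
    abel

end Comp

/-! ### The manifold `Z` -/

/-- Local sections of the pullbacks of `Y → X^[2]` along `(id, s i)`, near the points of `X`. -/
structure Frame where
  A : 𝒬.X → Set 𝒬.X
  isOpen_A : ∀ α, IsOpen (A α)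
  mem_A : ∀ α, α ∈ A α
  π_mem : ∀ α, ∀ w ∈ A α, 𝒬.π w ∈ 𝒰.U (𝒬.π α)
  t : 𝒬.X → 𝒬.X → 𝒬.Q.Y
  smooth_t : ∀ α, ContMDiffOn 𝒬.X.I 𝒬.Q.Y.I ∞ (t α) (A α)
  π_t : ∀ α, ∀ w ∈ A α, 𝒬.Q.π (t α w) = (w, D.s (𝒬.π α) (𝒬.π w))

/-- With `i = 𝒬.π α`, lift the map `w ↦ (w, s i (𝒬.π w))` to `Y` near `α`. -/
theorem nonempty_frame : Nonempty D.Frame := by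
  have hπ := 𝒬.admitsLocalSections.smooth
  have h (α : 𝒬.X) : ∃ (O : Set 𝒬.X) (t : 𝒬.X → 𝒬.Q.Y), IsOpen O ∧ α ∈ O ∧
      (∀ w ∈ O, 𝒬.π w ∈ 𝒰.U (𝒬.π α)) ∧ ContMDiffOn 𝒬.X.I 𝒬.Q.Y.I ∞ t O ∧
      ∀ w ∈ O, 𝒬.Q.π (t w) = (w, D.s (𝒬.π α) (𝒬.π w)) := by
    have hO := (𝒰.isOpen_U (𝒬.π α)).preimage hπ.continuous
    have hα : α ∈ 𝒬.π ⁻¹' 𝒰.U (𝒬.π α) := 𝒰.mem_U _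
    have hs := (D.smooth_s (𝒬.π α)).comp hπ.contMDiffOn (s := 𝒬.π ⁻¹' 𝒰.U (𝒬.π α)) fun _ h => h
    have hm : ∀ w ∈ 𝒬.π ⁻¹' 𝒰.U (𝒬.π α), 𝒬.π w = 𝒬.π (D.s (𝒬.π α) (𝒬.π w)) :=
      fun w hw => (D.proj_s _ _ hw).symm
    obtain ⟨y, hy⟩ := exists_Y (hm α hα)
    obtain ⟨O, t, hO', hα', -, ht, htπ⟩ := 𝒬.Q.admitsLocalSections.exists_lift
      (contMDiffOn_id.prodMk hs) (fun w hw => hm w hw) hα hy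
    exact ⟨_, t, hO.inter hO', ⟨hα, hα'⟩, fun w hw => hw.1, ht, htπ⟩
  choose A t h₁ h₂ h₃ h₄ h₅ using h
  exact ⟨⟨A, h₁, h₂, h₃, t, h₄, h₅⟩⟩

namespace Frame

variable {D} (F : D.Frame)

theorem isOpen_preimage (α : 𝒬.X) : IsOpen {y | (𝒬.Q.π y).2 ∈ F.A α} :=
  (F.isOpen_A α).preimage contMDiff_snd_π.continuous

/-- The total space of the trivialising bundle gerbe. -/
noncomputable def Z : SmoothManifold.{u} :=
  -- A point is an index `α` with some `y ∈ Y_(x,w)`, where `w ∈ F.A α`. Leaving `w` free keeps each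
  -- component an open subset of `Y`; prescribing `w = s i` would make it a fibre product.
  SmoothManifold.sigma 𝒬.X 𝒬.Q.Y (fun α => {y | (𝒬.Q.π y).2 ∈ F.A α}) F.isOpen_preimage

/-- The index of the section `t` which belongs to a point of `Z`. -/
noncomputable def idx (z : F.Z) : 𝒬.X := SmoothManifold.sigma.idx z

/-- The point of `Y` which belongs to a point of `Z`. -/
noncomputable def pt (z : F.Z) : 𝒬.Q.Y := SmoothManifold.sigma.pt z

/-- The projection of `Z` to `X`. -/
noncomputable def base (z : F.Z) : 𝒬.X := (𝒬.Q.π (F.pt z)).1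

/-- The index of the open subset of `M` which belongs to a point of `Z`. -/
noncomputable def ind (z : F.Z) : M := 𝒬.π (F.idx z)

/-- The projection of `Z` to `M`. -/
noncomputable def foot (z : F.Z) : M := 𝒬.π (F.base z)

/-- The value at a point of `Z` of the local section `t` of `Y`. -/
noncomputable def lift (z : F.Z) : 𝒬.Q.Y := F.t (F.idx z) (𝒬.Q.π (F.pt z)).2

/-- The point of `Y_(x, s i)` which belongs to a point of `Z` over `x`. -/
noncomputable def arrow (z : F.Z) : 𝒬.Q.Y := 𝒬.m (F.lift z) (F.pt z)

/-- The value `s i` which belongs to a point of `Z`. -/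
noncomputable def top (z : F.Z) : 𝒬.X := D.s (F.ind z) (F.foot z)

/-- The value `σ i j` which belongs to a pair of points of `Z`. -/
noncomputable def shift (z z' : F.Z) : 𝒬.Q.Y := D.σ (F.ind z) (F.ind z') (F.foot z)

variable {F}

theorem snd_π_pt_mem (z : F.Z) : (𝒬.Q.π (F.pt z)).2 ∈ F.A (F.idx z) :=
  SmoothManifold.sigma.pt_mem z

theorem π_snd_π_pt (z : F.Z) : 𝒬.π (𝒬.Q.π (F.pt z)).2 = F.foot z := (𝒬.π_fst_eq _).symm

theorem foot_mem (z : F.Z) : F.foot z ∈ 𝒰.U (F.ind z) := by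
  rw [← π_snd_π_pt]
  exact F.π_mem _ _ (snd_π_pt_mem z)

theorem foot_congr {z z' : F.Z} (h : F.base z = F.base z') : F.foot z = F.foot z' := by
  rw [foot, foot, h]

theorem foot_mem' {z z' : F.Z} (h : F.base z = F.base z') : F.foot z ∈ 𝒰.U (F.ind z') := by
  rw [foot_congr h]
  exact foot_mem z'

theorem π_lift (z : F.Z) : 𝒬.Q.π (F.lift z) = ((𝒬.Q.π (F.pt z)).2, F.top z) := by
  rw [lift, F.π_t _ _ (snd_π_pt_mem z), π_snd_π_pt, top, ind]

theorem lift_composable (z : F.Z) : (𝒬.Q.π (F.lift z)).1 = (𝒬.Q.π (F.pt z)).2 := by rw [π_lift]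

theorem π_arrow (z : F.Z) : 𝒬.Q.π (F.arrow z) = (F.base z, F.top z) := by
  rw [arrow, 𝒬.proj_m _ _ (lift_composable z), π_lift, base]

theorem top_eq {z z' : F.Z} (h : F.base z = F.base z') : F.top z' = D.s (F.ind z') (F.foot z) := by
  rw [top, foot_congr h]

theorem π_shift {z z' : F.Z} (h : F.base z = F.base z') :
    𝒬.Q.π (F.shift z z') = (F.top z, F.top z') := by
  rw [shift, D.proj_σ _ _ _ ⟨foot_mem z, foot_mem' h⟩, top, top_eq h]

theorem shift_composable {z z' : F.Z} (h : F.base z = F.base z') :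
    (𝒬.Q.π (F.shift z z')).1 = (𝒬.Q.π (F.arrow z)).2 := by rw [π_shift h, π_arrow]

theorem π_m_shift {z z' : F.Z} (h : F.base z = F.base z') :
    𝒬.Q.π (𝒬.m (F.shift z z') (F.arrow z)) = (F.base z, F.top z') := by
  rw [𝒬.proj_m _ _ (shift_composable h), π_shift h, π_arrow]

/-! ### Smoothness -/

theorem contMDiff_pt : ContMDiff F.Z.I 𝒬.Q.Y.I ∞ F.pt := SmoothManifold.sigma.contMDiff_pt

theorem contMDiff_base : ContMDiff F.Z.I 𝒬.X.I ∞ F.base := contMDiff_fst_π.comp contMDiff_pt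

theorem contMDiff_foot : ContMDiff F.Z.I M.I ∞ F.foot :=
  𝒬.admitsLocalSections.smooth.comp contMDiff_base

theorem contMDiff_lift : ContMDiff F.Z.I 𝒬.Q.Y.I ∞ F.lift := by
  rw [← contMDiffOn_univ]
  have h (x : F.Z) (hx : x ∈ univ) : ∃ O, IsOpen O ∧ x ∈ O ∧ ∀ y ∈ univ ∩ O, F.idx y = F.idx x :=
    SmoothManifold.sigma.exists_isOpen_idx_eq (f := fun z : F.Z => z) continuousOn_id hx
  refine contMDiffOn_of_locallyConstant F.idx h (f := fun α z => F.t α (𝒬.Q.π (F.pt z)).2)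
    fun α => ?_
  refine (F.smooth_t α).comp (contMDiff_snd_π.comp contMDiff_pt).contMDiffOn fun z hz => ?_
  obtain rfl : F.idx z = α := hz.2
  exact snd_π_pt_mem z

theorem contMDiff_arrow : ContMDiff F.Z.I 𝒬.Q.Y.I ∞ F.arrow := by
  rw [← contMDiffOn_univ]
  exact contMDiffOn_m contMDiff_lift.contMDiffOn contMDiff_pt.contMDiffOn
    fun z _ => lift_composable z

section Families

variable {E' H' N : Type u} [NormedAddCommGroup E'] [NormedSpace ℝ E'] [TopologicalSpace H']
  [TopologicalSpace N] [ChartedSpace H' N] {J : ModelWithCorners ℝ E' H'} {T : Set N}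
  {f f' f'' : N → F.Z}

theorem exists_isOpen_ind_eq (hf : ContMDiffOn J F.Z.I ∞ f T) {x : N} (hx : x ∈ T) :
    ∃ O, IsOpen O ∧ x ∈ O ∧ ∀ y ∈ T ∩ O, F.ind (f y) = F.ind (f x) := by
  obtain ⟨O, hO, hxO, h⟩ := SmoothManifold.sigma.exists_isOpen_idx_eq hf.continuousOn hx
  exact ⟨O, hO, hxO, fun y hy => congrArg 𝒬.π (h y hy)⟩

theorem contMDiffOn_shift (hf : ContMDiffOn J F.Z.I ∞ f T) (hf' : ContMDiffOn J F.Z.I ∞ f' T)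
    (h : ∀ x ∈ T, F.base (f x) = F.base (f' x)) :
    ContMDiffOn J 𝒬.Q.Y.I ∞ (fun x => F.shift (f x) (f' x)) T := by
  refine contMDiffOn_of_locallyConstant (fun x => (F.ind (f x), F.ind (f' x))) (fun x hx => ?_)
    (f := fun p x => D.σ p.1 p.2 (F.foot (f x))) fun p => ?_
  · obtain ⟨O, hO, hxO, hc⟩ := exists_isOpen_ind_eq hf hx
    obtain ⟨O', hO', hxO', hc'⟩ := exists_isOpen_ind_eq hf' hx
    exact ⟨_, hO.inter hO', ⟨hxO, hxO'⟩, fun y hy =>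
      Prod.ext (hc y ⟨hy.1, hy.2.1⟩) (hc' y ⟨hy.1, hy.2.2⟩)⟩
  · refine (D.smooth_σ p.1 p.2).comp ((contMDiff_foot.comp_contMDiffOn hf).mono inter_subset_left)
      fun x hx => ?_
    obtain rfl : (F.ind (f x), F.ind (f' x)) = p := hx.2
    exact ⟨foot_mem _, foot_mem' (h x hx.1)⟩

theorem smoothInto_ρ (hf : ContMDiffOn J F.Z.I ∞ f T) (hf' : ContMDiffOn J F.Z.I ∞ f' T)
    (hf'' : ContMDiffOn J F.Z.I ∞ f'' T) (h : ∀ x ∈ T, F.base (f x) = F.base (f' x))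
    (h' : ∀ x ∈ T, F.base (f x) = F.base (f'' x)) : 𝒬.Q.SmoothInto J
      (fun x => D.ρ (F.ind (f x)) (F.ind (f' x)) (F.ind (f'' x)) (F.foot (f x))) T := by
  refine PrincipalBundle.smoothInto_of_locallyConstant
    (fun x => (F.ind (f x), F.ind (f' x), F.ind (f'' x))) (fun x hx => ?_)
    (f := fun p x => D.ρ p.1 p.2.1 p.2.2 (F.foot (f x))) fun p => ?_
  · obtain ⟨O, hO, hxO, hc⟩ := exists_isOpen_ind_eq hf hx
    obtain ⟨O', hO', hxO', hc'⟩ := exists_isOpen_ind_eq hf' hx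
    obtain ⟨O'', hO'', hxO'', hc''⟩ := exists_isOpen_ind_eq hf'' hx
    exact ⟨_, hO.inter (hO'.inter hO''), ⟨hxO, hxO', hxO''⟩, fun y hy => Prod.ext
      (hc y ⟨hy.1, hy.2.1⟩) (Prod.ext (hc' y ⟨hy.1, hy.2.2.1⟩) (hc'' y ⟨hy.1, hy.2.2.2⟩))⟩
  · refine (D.smooth_ρ p.1 p.2.1 p.2.2).comp
      ((contMDiff_foot.comp_contMDiffOn hf).mono inter_subset_left) fun x hx => ?_
    obtain rfl : (F.ind (f x), F.ind (f' x), F.ind (f'' x)) = p := hx.2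
    exact ⟨⟨foot_mem _, foot_mem' (h x hx.1)⟩, foot_mem' (h' x hx.1)⟩

end Families

theorem base_mk {α : 𝒬.X} {y : 𝒬.Q.Y} (h : (𝒬.Q.π y).2 ∈ F.A α) :
    F.base (SmoothManifold.sigma.mk F.isOpen_preimage α y h) = (𝒬.Q.π y).1 := rfl

/-- To extend `y ∈ Y_(x,w)` to nearby points `x'`, first let `w` vary by a map `τ` over `M` with `τ
x = w`, then lift `(id, τ)` to `Y` through `y`, keeping the index fixed. -/
theorem admitsLocalSections_base : AdmitsLocalSections F.Z 𝒬.X.I univ F.base := by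
  classical
  refine ⟨contMDiff_base, eq_univ_of_forall fun x => ?_, fun z => ?_⟩
  · obtain ⟨y, hy⟩ := exists_Y (Eq.refl (𝒬.π x))
    have hy' : (𝒬.Q.π y).2 ∈ F.A x := by
      rw [hy]
      exact F.mem_A x
    exact ⟨SmoothManifold.sigma.mk F.isOpen_preimage x y hy', by rw [base_mk, hy]⟩
  · have hπ := 𝒬.admitsLocalSections.smooth
    obtain ⟨O, τ, hO, hxO, hτz, hτ, hτπ⟩ := 𝒬.admitsLocalSections.exists_lift (T := univ)
      hπ.contMDiffOn (fun _ _ => mem_univ _) (mem_univ (F.base z)) (y := (𝒬.Q.π (F.pt z)).2)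
      (π_snd_π_pt z)
    rw [univ_inter] at hτ hτπ
    obtain ⟨O', f, hO', hxO', hfz, hf, hfπ⟩ := 𝒬.Q.admitsLocalSections.exists_lift
      (contMDiffOn_id.prodMk hτ) (fun w hw => (hτπ w hw).symm) hxO (y := F.pt z)
      (Prod.ext rfl hτz.symm)
    obtain ⟨O'', hO'', h''⟩ := hf.continuousOn.exists_isOpen_inter (F.isOpen_preimage (F.idx z))
    let g (x : 𝒬.X) : F.Z := if h : (𝒬.Q.π (f x)).2 ∈ F.A (F.idx z) then
      SmoothManifold.sigma.mk F.isOpen_preimage (F.idx z) (f x) h else z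
    have hg : ∀ x ∈ O ∩ O' ∩ O'', F.pt (g x) = f x ∧ F.idx (g x) = F.idx z := fun x hx => by
      have h : (𝒬.Q.π (f x)).2 ∈ F.A (F.idx z) := (h'' x hx.1).1 hx.2
      rw [show g x = SmoothManifold.sigma.mk F.isOpen_preimage (F.idx z) (f x) h from dif_pos h]
      exact ⟨rfl, rfl⟩
    have hz : F.base z ∈ O ∩ O' ∩ O'' := ⟨⟨hxO, hxO'⟩, (h'' _ ⟨hxO, hxO'⟩).2 (by
      rw [hfz]
      exact snd_π_pt_mem z)⟩
    refine ⟨O ∩ O' ∩ O'', (hO.inter hO').inter hO'', hz, g, ?_, ?_, fun x hx => ?_⟩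
    · rw [inter_univ]
      refine SmoothManifold.sigma.contMDiffOn_iff.2 ⟨?_, fun x hx => ⟨univ, isOpen_univ, trivial,
        fun y hy => ((hg y hy.1).2.trans (hg x hx).2.symm)⟩⟩
      exact (hf.mono inter_subset_left).congr fun x hx => (hg x hx).1
    · exact SmoothManifold.sigma.ext (hg _ hz).2 ((hg _ hz).1.trans hfz)
    · rw [base, (hg x hx.1).1, hfπ x hx.1.1]
      rfl

end Frame

end CechData

end Bundle2Gerbe

theorem BundleGerbe.e_mul_e {E H B : Type u} [NormedAddCommGroup E] [NormedSpace ℝ E]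
    [TopologicalSpace H] [TopologicalSpace B] [ChartedSpace H B] {I : ModelWithCorners ℝ E H}
    {S : Set B} (G : BundleGerbe I S) (y : G.Y) : G.mul (G.e y) (G.e y) = G.e y := by
  have h := G.e_mul (G.e y)
  rwa [tgt_e] at h

namespace Bundle2Gerbe

open BundleGerbe SmoothManifold

variable {M : SmoothManifold.{u}} {𝒬 : Bundle2Gerbe M}

namespace CechData

variable {𝒰 : PointedCover M} {D : 𝒬.CechData 𝒰}

theorem smoothInto_comp {N : SmoothManifold.{u}} {T : Set N} {i j k x : N → M} {y : N → 𝒬.Q.Y}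
    {v u : N → 𝒬.Q.P}
    (hi : ∀ w ∈ T, x w ∈ 𝒰.U (i w)) (hj : ∀ w ∈ T, x w ∈ 𝒰.U (j w))
    (hk : ∀ w ∈ T, x w ∈ 𝒰.U (k w)) (hy : ∀ w ∈ T, (𝒬.Q.π (y w)).2 = D.s (i w) (x w))
    (hu : ∀ w ∈ T, 𝒬.Q.src (u w) = 𝒬.m (D.σ (i w) (j w) (x w)) (y w))
    (hv : ∀ w ∈ T, 𝒬.Q.src (v w) = 𝒬.m (D.σ (j w) (k w) (x w)) (𝒬.Q.tgt (u w)))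
    (hσ : ContMDiffOn N.I 𝒬.Q.Y.I ∞ (fun w => D.σ (i w) (j w) (x w)) T)
    (hσ' : ContMDiffOn N.I 𝒬.Q.Y.I ∞ (fun w => D.σ (j w) (k w) (x w)) T)
    (hρ : 𝒬.Q.SmoothInto N.I (fun w => D.ρ (i w) (j w) (k w) (x w)) T)
    (sy : ContMDiffOn N.I 𝒬.Q.Y.I ∞ y T) (su : 𝒬.Q.SmoothInto N.I u T)
    (sv : 𝒬.Q.SmoothInto N.I v T) :
    𝒬.Q.SmoothInto N.I (fun w => D.comp (i w) (j w) (k w) (x w) (y w) (v w) (u w)) T := by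
  have h := fun w hw => comp_composable (D := D) (hi w hw) (hj w hw) (hk w hw) (hy w hw) (hu w hw)
    (hv w hw)
  refine 𝒬.Q.smooth_mul _ _ _ _ sv (𝒬.Q.smooth_mul _ _ _ _
    (𝒬.smooth_mhat _ _ _ _ (smoothInto_e hσ') su fun w hw => (h w hw).2.2.2.2.1)
    (𝒬.Q.smooth_mul _ _ _ _ (smoothInto_a hσ' hσ sy (fun w hw => (h w hw).1)
      fun w hw => (h w hw).2.1) (smoothInto_inv (𝒬.smooth_mhat _ _ _ _ hρ (smoothInto_e sy)
        fun w hw => (h w hw).2.2.1)) fun w hw => (h w hw).2.2.2.1)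
    fun w hw => (h w hw).2.2.2.2.2.1) fun w hw => (h w hw).2.2.2.2.2.2

namespace Frame

variable {F : D.Frame}

/-! ### The `ℂˣ`-bundle -/

theorem contMDiffOn_hom : ContMDiffOn (F.Z.I.prod F.Z.I) (𝒬.Q.Y.I.prod 𝒬.Q.Y.I) ∞
    (fun w : F.Z × F.Z => (𝒬.m (F.shift w.1 w.2) (F.arrow w.1), F.arrow w.2))
    {w | F.base w.1 = F.base w.2} := by
  have h₁ : ContMDiff (F.Z.I.prod F.Z.I) F.Z.I ∞ (fun w : F.Z × F.Z => w.1) := contMDiff_fst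
  have h₂ : ContMDiff (F.Z.I.prod F.Z.I) F.Z.I ∞ (fun w : F.Z × F.Z => w.2) := contMDiff_snd
  have h₃ := contMDiffOn_shift (T := {w : F.Z × F.Z | F.base w.1 = F.base w.2}) h₁.contMDiffOn
    h₂.contMDiffOn fun _ h => h
  exact (𝒬.smooth_m.comp (h₃.prodMk (contMDiff_arrow.comp h₁).contMDiffOn)
    fun _ h => shift_composable h).prodMk (contMDiff_arrow.comp h₂).contMDiffOn

theorem mapsTo_hom :
    MapsTo (fun w : F.Z × F.Z => (𝒬.m (F.shift w.1 w.2) (F.arrow w.1), F.arrow w.2))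
      {w | F.base w.1 = F.base w.2} {w | 𝒬.Q.π w.1 = 𝒬.Q.π w.2} := fun w h => by
  change 𝒬.Q.π _ = 𝒬.Q.π _
  rw [π_m_shift h, π_arrow, show F.base w.1 = F.base w.2 from h]

variable (F) in
/-- The `ℂˣ`-bundle on `Z ×_X Z` with fibres `Q_(σ_ij ∘ arrow z, arrow z')`. -/
noncomputable def bundle :
    PrincipalBundle (F.Z.I.prod F.Z.I) {w : F.Z × F.Z | F.base w.1 = F.base w.2} :=
  𝒬.Q.bundle.pullback contMDiffOn_hom mapsTo_hom

/-- The source of an element of the bundle. -/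
noncomputable def dom (u : F.bundle.P) : F.Z := (F.bundle.proj u).1

/-- The target of an element of the bundle. -/
noncomputable def cod (u : F.bundle.P) : F.Z := (F.bundle.proj u).2

/-- The element of `Q` which belongs to an element of the pullback. -/
noncomputable def arr (u : F.bundle.P) : 𝒬.Q.P :=
  (show {w : (F.Z × F.Z) × 𝒬.Q.bundle.P // w.1 ∈ {w : F.Z × F.Z | F.base w.1 = F.base w.2} ∧
    𝒬.Q.bundle.proj w.2 = (𝒬.m (F.shift w.1.1 w.1.2) (F.arrow w.1.1), F.arrow w.1.2)} from u).1.2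

theorem base_dom (u : F.bundle.P) : F.base (dom u) = F.base (cod u) := u.2.1

theorem src_arr (u : F.bundle.P) :
    𝒬.Q.src (arr u) = 𝒬.m (F.shift (dom u) (cod u)) (F.arrow (dom u)) := congrArg Prod.fst u.2.2

theorem tgt_arr (u : F.bundle.P) : 𝒬.Q.tgt (arr u) = F.arrow (cod u) := congrArg Prod.snd u.2.2

theorem ext_arr {u v : F.bundle.P} (h : dom u = dom v) (h' : cod u = cod v) (h'' : arr u = arr v) :
    u = v := Subtype.ext (Prod.ext (Prod.ext h h') h'')

/-- The element of the pullback given by an element of `Q`. -/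
noncomputable def mkHom (z z' : F.Z) (q : 𝒬.Q.P) (h : F.base z = F.base z')
    (hs : 𝒬.Q.src q = 𝒬.m (F.shift z z') (F.arrow z)) (ht : 𝒬.Q.tgt q = F.arrow z') : F.bundle.P :=
  ⟨((z, z'), q), h, Prod.ext hs ht⟩

section MkHom

variable {z z' : F.Z} {q : 𝒬.Q.P} (h : F.base z = F.base z')
  (hs : 𝒬.Q.src q = 𝒬.m (F.shift z z') (F.arrow z)) (ht : 𝒬.Q.tgt q = F.arrow z')

theorem dom_mkHom : dom (mkHom z z' q h hs ht) = z := rfl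

theorem cod_mkHom : cod (mkHom z z' q h hs ht) = z' := rfl

theorem arr_mkHom : arr (mkHom z z' q h hs ht) = q := rfl

end MkHom

theorem dom_act (c : ℂˣ) (u : F.bundle.P) : dom (F.bundle.act c u) = dom u := rfl

theorem cod_act (c : ℂˣ) (u : F.bundle.P) : cod (F.bundle.act c u) = cod u := rfl

theorem arr_act (c : ℂˣ) (u : F.bundle.P) : arr (F.bundle.act c u) = 𝒬.Q.act c (arr u) := rfl

/-- The phase of an element of the pullback, normalised so as to make products simple. -/
noncomputable def phase (u : F.bundle.P) : Additive ℂˣ :=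
  𝒬.Q.phase (arr u) + 𝒬.ν (F.shift (dom u) (cod u)) (F.arrow (dom u)) +
    𝒬.ν (F.lift (dom u)) (F.pt (dom u)) - 𝒬.ν (F.lift (cod u)) (F.pt (cod u))

theorem phase_act (c : ℂˣ) (u : F.bundle.P) :
    phase (F.bundle.act c u) = Additive.ofMul c + phase u := by
  rw [phase, arr_act, BundleGerbe.phase_act, dom_act, cod_act, phase]
  abel

theorem ext_phase {u v : F.bundle.P} (h : dom u = dom v) (h' : cod u = cod v)
    (h'' : phase u = phase v) : u = v := by
  refine ext_arr h h' (BundleGerbe.ext_phase ?_ ?_ ?_)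
  · rw [src_arr, src_arr, h, h']
  · rw [tgt_arr, tgt_arr, h']
  · rw [phase, phase, h, h'] at h''
    simpa using h''

section Families

variable {E' H' N : Type u} [NormedAddCommGroup E'] [NormedSpace ℝ E'] [TopologicalSpace H']
  [TopologicalSpace N] [ChartedSpace H' N] {J : ModelWithCorners ℝ E' H'} {T : Set N}
  {f : N → F.bundle.P}

theorem smoothInto_iff : F.bundle.SmoothInto J f T ↔
    ContMDiffOn J F.Z.I ∞ (fun x => dom (f x)) T ∧ ContMDiffOn J F.Z.I ∞ (fun x => cod (f x)) T ∧
      𝒬.Q.SmoothInto J (fun x => arr (f x)) T := by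
  refine (PrincipalBundle.smoothInto_pullback_iff contMDiffOn_hom mapsTo_hom).trans ?_
  exact ⟨fun h => ⟨contMDiff_fst.comp_contMDiffOn h.1, contMDiff_snd.comp_contMDiffOn h.1, h.2⟩,
    fun h => ⟨h.1.prodMk h.2.1, h.2.2⟩⟩

end Families

/-! ### The product -/

section Mul

variable {u v : F.bundle.P} (h : dom u = cod v)

include h

theorem base_dom_cod : F.base (dom v) = F.base (cod u) := by rw [base_dom, ← h, base_dom]

theorem mul_aux : (𝒬.Q.π (F.arrow (dom v))).2 = D.s (F.ind (dom v)) (F.foot (dom v)) ∧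
    𝒬.Q.src (arr v) = 𝒬.m (D.σ (F.ind (dom v)) (F.ind (cod v)) (F.foot (dom v)))
      (F.arrow (dom v)) ∧
    𝒬.Q.src (arr u) = 𝒬.m (D.σ (F.ind (cod v)) (F.ind (cod u)) (F.foot (dom v)))
      (𝒬.Q.tgt (arr v)) := by
  refine ⟨by rw [π_arrow, top], src_arr v, ?_⟩
  rw [src_arr, tgt_arr, h, shift, foot_congr (base_dom v)]

theorem arr_mul_spec :
    𝒬.Q.src (D.comp (F.ind (dom v)) (F.ind (cod v)) (F.ind (cod u)) (F.foot (dom v))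
      (F.arrow (dom v)) (arr u) (arr v)) = 𝒬.m (F.shift (dom v) (cod u)) (F.arrow (dom v)) ∧
    𝒬.Q.tgt (D.comp (F.ind (dom v)) (F.ind (cod v)) (F.ind (cod u)) (F.foot (dom v))
      (F.arrow (dom v)) (arr u) (arr v)) = F.arrow (cod u) ∧
    𝒬.Q.phase (D.comp (F.ind (dom v)) (F.ind (cod v)) (F.ind (cod u)) (F.foot (dom v))
      (F.arrow (dom v)) (arr u) (arr v)) = 𝒬.Q.phase (arr u) + 𝒬.Q.phase (arr v) +
        𝒬.ν (F.shift (dom u) (cod u)) (F.arrow (dom u)) +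
        𝒬.ν (F.shift (dom v) (cod v)) (F.arrow (dom v)) -
        𝒬.ν (F.shift (dom v) (cod u)) (F.arrow (dom v)) +
        𝒬.α (F.base (dom v)) (F.top (dom v)) (F.top (cod v)) (F.top (cod u)) -
        D.R (F.ind (dom v)) (F.ind (cod v)) (F.ind (cod u)) (F.foot (dom v)) := by
  have hs := comp_spec (foot_mem (dom v)) (foot_mem' (base_dom v)) (foot_mem' (base_dom_cod h))
    (mul_aux h).1 (mul_aux h).2.1 (mul_aux h).2.2
  refine ⟨hs.1, hs.2.1.trans (tgt_arr u), hs.2.2.trans ?_⟩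
  rw [h, tgt_arr, π_arrow, top_eq (base_dom v), top_eq (base_dom_cod h), shift, shift, shift,
    ← foot_congr (base_dom v), top]

end Mul

open Classical in
/-- The product of the trivialising bundle gerbe. -/
noncomputable def mul (u v : F.bundle.P) : F.bundle.P :=
  if h : dom u = cod v then
    mkHom (dom v) (cod u) (D.comp (F.ind (dom v)) (F.ind (cod v)) (F.ind (cod u)) (F.foot (dom v))
      (F.arrow (dom v)) (arr u) (arr v)) (base_dom_cod h) (arr_mul_spec h).1
      (arr_mul_spec h).2.1
  else v

variable (F) in
/-- The cocycle by which the product differs from the product of phases. -/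
noncomputable def twist (z z' z'' : F.Z) : Additive ℂˣ :=
  𝒬.α (F.base z) (F.top z) (F.top z') (F.top z'') - D.R (F.ind z) (F.ind z') (F.ind z'') (F.foot z)

/-- Here the triviality of the cocycle enters: `g = δR - α(s)` becomes `α(s) = δR`. -/
theorem α_eq (hg : ∀ τ x, D.g τ x = 1) {z z' z'' z''' : F.Z} (h' : F.base z = F.base z')
    (h'' : F.base z = F.base z'') (h''' : F.base z = F.base z''') :
    𝒬.α (F.top z) (F.top z') (F.top z'') (F.top z''') =
      D.R (F.ind z') (F.ind z'') (F.ind z''') (F.foot z) -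
        D.R (F.ind z) (F.ind z'') (F.ind z''') (F.foot z) +
        D.R (F.ind z) (F.ind z') (F.ind z''') (F.foot z) -
        D.R (F.ind z) (F.ind z') (F.ind z'') (F.foot z) := by
  have := D.ofMul_g_add_α (foot_mem z) (foot_mem' h') (foot_mem' h'') (foot_mem' h''')
  rwa [hg, ofMul_one, zero_add, ← top_eq h', ← top_eq h'', ← top_eq h'''] at this

theorem π_base (z : F.Z) : 𝒬.π (F.base z) = F.foot z := rfl

theorem π_top (z : F.Z) : 𝒬.π (F.top z) = F.foot z := D.proj_s _ _ (foot_mem z)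

/-- By `α_coherence` at the base point and the four tops, the coboundary of the `α`-part of `twist`
is `α` of the tops; by `α_eq` this is `δR`, which the `R`-part cancels. Associativity of `mul`
follows. -/
theorem twist_cocycle (hg : ∀ τ x, D.g τ x = 1) {z z' z'' z''' : F.Z} (h' : F.base z = F.base z')
    (h'' : F.base z = F.base z'') (h''' : F.base z = F.base z''') :
    F.twist z' z'' z''' + F.twist z z' z''' = F.twist z z'' z''' + F.twist z z' z'' := by
  have h₁ := α_eq hg h' h'' h'''
  have h₂ := 𝒬.α_coherence (x₁ := F.base z) (x₂ := F.top z) (x₃ := F.top z') (x₄ := F.top z'')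
    (x₅ := F.top z''') (by rw [π_top, π_base]) (by rw [π_top, π_base, foot_congr h'])
    (by rw [π_top, π_base, foot_congr h'']) (by rw [π_top, π_base, foot_congr h'''])
  simp only [twist, ← h', ← foot_congr h']
  grind

section Mul

variable {u v : F.bundle.P}

theorem dom_mul (h : dom u = cod v) : dom (mul u v) = dom v := by rw [mul, dif_pos h, dom_mkHom]

theorem cod_mul (h : dom u = cod v) : cod (mul u v) = cod u := by rw [mul, dif_pos h, cod_mkHom]

theorem arr_mul (h : dom u = cod v) : arr (mul u v) = D.comp (F.ind (dom v)) (F.ind (cod v))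
    (F.ind (cod u)) (F.foot (dom v)) (F.arrow (dom v)) (arr u) (arr v) := by
  rw [mul, dif_pos h, arr_mkHom]

/-- The `ν`-terms in the normalisation of `phase` telescope, leaving only `twist`. -/
theorem phase_mul (h : dom u = cod v) :
    phase (mul u v) = phase u + phase v + F.twist (dom v) (cod v) (cod u) := by
  rw [phase, dom_mul h, cod_mul h, arr_mul h, (arr_mul_spec h).2.2, phase, phase, h, twist]
  abel

end Mul

variable (F) in
/-- The bundle gerbe on `X` which trivialises the bundle 2-gerbe. -/
noncomputable def gerbe (hg : ∀ τ x, D.g τ x = 1) : BundleGerbe 𝒬.X.I (univ : Set 𝒬.X) where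
  Y := F.Z
  π := F.base
  admitsLocalSections := admitsLocalSections_base
  bundle := F.bundle
  mul := mul
  proj_mul _ _ h := Prod.ext (dom_mul h) (cod_mul h)
  act_mul c u v h := by
    have h' : dom (F.bundle.act c u) = cod v := h
    refine ext_phase ?_ ?_ ?_
    · rw [dom_mul h', dom_act, dom_mul h]
    · rw [cod_mul h', cod_act, cod_act, cod_mul h]
    · rw [phase_mul h', phase_act, phase_act, phase_mul h, cod_act]
      abel
  mul_act c u v h := by
    have h' : dom u = cod (F.bundle.act c v) := h
    refine ext_phase ?_ ?_ ?_
    · rw [dom_mul h', dom_act, dom_act, dom_mul h]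
    · rw [cod_mul h', cod_act, cod_mul h]
    · rw [phase_mul h', phase_act, phase_act, phase_mul h, cod_act, dom_act]
      abel
  smooth_mul N T u v su sv h := by
    obtain ⟨su₁, su₂, su₃⟩ := smoothInto_iff.1 su
    obtain ⟨sv₁, sv₂, sv₃⟩ := smoothInto_iff.1 sv
    have h' : ∀ x ∈ T, dom (u x) = cod (v x) := h
    refine smoothInto_iff.2 ⟨sv₁.congr fun x hx => dom_mul (h' x hx),
      su₂.congr fun x hx => cod_mul (h' x hx), ?_⟩
    refine .congr (smoothInto_comp (fun x _ => foot_mem _) (fun x _ => foot_mem' (base_dom (v x)))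
      (fun x hx => foot_mem' (base_dom_cod (h' x hx))) (fun x hx => (mul_aux (h' x hx)).1)
      (fun x hx => (mul_aux (h' x hx)).2.1) (fun x hx => (mul_aux (h' x hx)).2.2)
      (contMDiffOn_shift sv₁ sv₂ fun x _ => base_dom (v x)) ?_
      (smoothInto_ρ sv₁ sv₂ su₂ (fun x _ => base_dom (v x)) fun x hx => base_dom_cod (h' x hx))
      (contMDiff_arrow.comp_contMDiffOn sv₁) sv₃ su₃) fun x hx => arr_mul (h' x hx)
    refine (contMDiffOn_shift sv₂ su₂ fun x hx => ?_).congr fun x hx => ?_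
    · rw [← h' x hx, base_dom]
    · rw [shift, foot_congr (base_dom (v x))]
  mul_assoc u v w h h' := by
    replace h : dom u = cod v := h
    replace h' : dom v = cod w := h'
    have k : dom (mul u v) = cod w := (dom_mul h).trans h'
    have k' : dom u = cod (mul v w) := h.trans (cod_mul h').symm
    refine ext_phase ?_ ?_ ?_
    · rw [dom_mul k, dom_mul k', dom_mul h']
    · rw [cod_mul k, cod_mul k', cod_mul h]
    · have hc := twist_cocycle hg (base_dom w) (base_dom_cod h')
        ((base_dom_cod h').trans ((congrArg F.base h).symm.trans (base_dom u)))
      rw [phase_mul k, phase_mul k', phase_mul h, phase_mul h', dom_mul h', cod_mul h,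
        cod_mul h', h']
      grind

variable (F) in
/-- The identity section of the trivialising bundle gerbe. -/
noncomputable def unit (hg : ∀ τ x, D.g τ x = 1) (z : F.Z) : F.bundle.P := (F.gerbe hg).e z

variable (hg : ∀ τ x, D.g τ x = 1)

theorem dom_unit (z : F.Z) : dom (F.unit hg z) = z := (F.gerbe hg).src_e z

theorem cod_unit (z : F.Z) : cod (F.unit hg z) = z := (F.gerbe hg).tgt_e z

/-- Idempotence of the unit determines its phase; the twist prevents it from being 0 in general. -/
theorem phase_unit (z : F.Z) : phase (F.unit hg z) = -F.twist z z z := by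
  have h : mul (F.unit hg z) (F.unit hg z) = F.unit hg z := (F.gerbe hg).e_mul_e z
  have h' := phase_mul (u := F.unit hg z) (v := F.unit hg z) (by rw [dom_unit, cod_unit])
  rw [h, dom_unit, cod_unit] at h'
  grind

theorem smoothInto_unit {N : SmoothManifold.{u}} {T : Set N} {f : N → F.Z}
    (hf : ContMDiffOn N.I F.Z.I ∞ f T) :
    F.bundle.SmoothInto N.I (fun x => F.unit hg (f x)) T := smoothInto_e (G := F.gerbe hg) hf

end Frame

end CechData

end Bundle2Gerbe

/-! ## The trivialisation -/

namespace Bundle2Gerbe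

open BundleGerbe SmoothManifold

variable {M : SmoothManifold.{u}} {𝒬 : Bundle2Gerbe M}

/-! ### Reassociation -/

variable (𝒬) in
/-- The arrow `s ∘ (l ∘ (p ∘ y)) → l' ∘ (p' ∘ y')` given by `q : s ∘ (l ∘ p) → l' ∘ p'` and
`u : y → y'`. -/
noncomputable def whisker (s l p l' p' : 𝒬.Q.Y) (q u : 𝒬.Q.P) : 𝒬.Q.P :=
  𝒬.Q.mul (𝒬.a l' p' (𝒬.Q.tgt u)) (𝒬.Q.mul (𝒬.mhat q u) (𝒬.Q.mul
    (𝒬.Q.inv (𝒬.a s (𝒬.m l p) (𝒬.Q.src u))) (𝒬.mhat (𝒬.Q.e s) (𝒬.Q.inv (𝒬.a l p (𝒬.Q.src u))))))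

section Whisker

variable {s l p l' p' : 𝒬.Q.Y} {q u : 𝒬.Q.P} (hs : (𝒬.Q.π s).1 = (𝒬.Q.π l).2)
  (hl : (𝒬.Q.π l).1 = (𝒬.Q.π p).2) (hp : (𝒬.Q.π p).1 = (𝒬.Q.π (𝒬.Q.src u)).2)
  (hl' : (𝒬.Q.π l').1 = (𝒬.Q.π p').2) (hp' : (𝒬.Q.π p').1 = (𝒬.Q.π (𝒬.Q.tgt u)).2)
  (hq : 𝒬.Q.src q = 𝒬.m s (𝒬.m l p)) (hq' : 𝒬.Q.tgt q = 𝒬.m l' p')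

include hs hl hp hl' hp' hq hq'

theorem whisker_composable :
    (𝒬.Q.π s).1 = (𝒬.Q.π (𝒬.m l p)).2 ∧ (𝒬.Q.π (𝒬.m l p)).1 = (𝒬.Q.π (𝒬.Q.src u)).2 ∧
    (𝒬.Q.π (𝒬.Q.src (𝒬.Q.e s))).1 =
      (𝒬.Q.π (𝒬.Q.src (𝒬.Q.inv (𝒬.a l p (𝒬.Q.src u))))).2 ∧
    𝒬.Q.src (𝒬.Q.inv (𝒬.a s (𝒬.m l p) (𝒬.Q.src u))) =
      𝒬.Q.tgt (𝒬.mhat (𝒬.Q.e s) (𝒬.Q.inv (𝒬.a l p (𝒬.Q.src u)))) ∧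
    (𝒬.Q.π (𝒬.Q.src q)).1 = (𝒬.Q.π (𝒬.Q.src u)).2 ∧
    𝒬.Q.src (𝒬.mhat q u) = 𝒬.Q.tgt (𝒬.Q.mul (𝒬.Q.inv (𝒬.a s (𝒬.m l p) (𝒬.Q.src u)))
      (𝒬.mhat (𝒬.Q.e s) (𝒬.Q.inv (𝒬.a l p (𝒬.Q.src u))))) ∧
    𝒬.Q.src (𝒬.a l' p' (𝒬.Q.tgt u)) = 𝒬.Q.tgt (𝒬.Q.mul (𝒬.mhat q u) (𝒬.Q.mul
      (𝒬.Q.inv (𝒬.a s (𝒬.m l p) (𝒬.Q.src u)))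
      (𝒬.mhat (𝒬.Q.e s) (𝒬.Q.inv (𝒬.a l p (𝒬.Q.src u)))))) := by
  have c₁ : (𝒬.Q.π s).1 = (𝒬.Q.π (𝒬.m l p)).2 := by rw [𝒬.proj_m _ _ hl, hs]
  have c₂ : (𝒬.Q.π (𝒬.m l p)).1 = (𝒬.Q.π (𝒬.Q.src u)).2 := by rw [𝒬.proj_m _ _ hl, hp]
  have c₃ : (𝒬.Q.π (𝒬.Q.src (𝒬.Q.e s))).1 =
      (𝒬.Q.π (𝒬.Q.src (𝒬.Q.inv (𝒬.a l p (𝒬.Q.src u))))).2 := by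
    rw [src_e, π_src, tgt_inv, (𝒬.proj_a _ _ _ hl hp).1, 𝒬.proj_m _ _ c₂, ← c₁]
  have c₄ : 𝒬.Q.src (𝒬.Q.inv (𝒬.a s (𝒬.m l p) (𝒬.Q.src u))) =
      𝒬.Q.tgt (𝒬.mhat (𝒬.Q.e s) (𝒬.Q.inv (𝒬.a l p (𝒬.Q.src u)))) := by
    rw [src_inv, 𝒬.tgt_mhat _ _ c₃, tgt_e, tgt_inv, (𝒬.proj_a _ _ _ hl hp).1,
      (𝒬.proj_a _ _ _ c₁ c₂).2]
  have c₅ : (𝒬.Q.π (𝒬.Q.src q)).1 = (𝒬.Q.π (𝒬.Q.src u)).2 := by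
    rw [hq, 𝒬.proj_m _ _ c₁, c₂]
  have c₆ : 𝒬.Q.src (𝒬.mhat q u) = 𝒬.Q.tgt (𝒬.Q.mul
      (𝒬.Q.inv (𝒬.a s (𝒬.m l p) (𝒬.Q.src u)))
      (𝒬.mhat (𝒬.Q.e s) (𝒬.Q.inv (𝒬.a l p (𝒬.Q.src u))))) := by
    rw [tgt_mul c₄, 𝒬.src_mhat _ _ c₅, tgt_inv, (𝒬.proj_a _ _ _ c₁ c₂).1, hq]
  refine ⟨c₁, c₂, c₃, c₄, c₅, c₆, ?_⟩
  rw [tgt_mul c₆, 𝒬.tgt_mhat _ _ c₅, (𝒬.proj_a _ _ _ hl' hp').1, hq']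

/-- The chain is `s ∘ (l ∘ (p ∘ y)) → s ∘ ((l ∘ p) ∘ y) → (s ∘ (l ∘ p)) ∘ y → (l' ∘ p') ∘ y' → l' ∘
(p' ∘ y')`. The two inverse associators account for the negative `α`-terms, the last associator for
the positive one. -/
theorem whisker_spec : 𝒬.Q.src (𝒬.whisker s l p l' p' q u) = 𝒬.m s (𝒬.m l (𝒬.m p (𝒬.Q.src u))) ∧
    𝒬.Q.tgt (𝒬.whisker s l p l' p' q u) = 𝒬.m l' (𝒬.m p' (𝒬.Q.tgt u)) ∧
    𝒬.Q.phase (𝒬.whisker s l p l' p' q u) = 𝒬.Q.phase q + 𝒬.Q.phase u +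
      𝒬.ν s (𝒬.m l p) + 𝒬.ν l p - 𝒬.ν l' p' -
      𝒬.ν s (𝒬.m l (𝒬.m p (𝒬.Q.src u))) - 𝒬.ν l (𝒬.m p (𝒬.Q.src u)) +
      𝒬.ν l' (𝒬.m p' (𝒬.Q.tgt u)) - 𝒬.ν p (𝒬.Q.src u) + 𝒬.ν p' (𝒬.Q.tgt u) +
      𝒬.α (𝒬.Q.π (𝒬.Q.src u)).1 (𝒬.Q.π (𝒬.Q.src u)).2 (𝒬.Q.π p').2 (𝒬.Q.π l').2 -
      𝒬.α (𝒬.Q.π (𝒬.Q.src u)).1 (𝒬.Q.π (𝒬.Q.src u)).2 (𝒬.Q.π p).2 (𝒬.Q.π l).2 -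
      𝒬.α (𝒬.Q.π (𝒬.Q.src u)).1 (𝒬.Q.π (𝒬.Q.src u)).2 (𝒬.Q.π l).2 (𝒬.Q.π s).2 := by
  obtain ⟨c₁, c₂, c₃, c₄, c₅, c₆, c₇⟩ := whisker_composable hs hl hp hl' hp' hq hq'
  refine ⟨?_, ?_, ?_⟩
  · rw [whisker, src_mul c₇, src_mul c₆, src_mul c₄, 𝒬.src_mhat _ _ c₃, src_e, src_inv,
      (𝒬.proj_a _ _ _ hl hp).2]
  · rw [whisker, tgt_mul c₇, (𝒬.proj_a _ _ _ hl' hp').2]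
  · rw [whisker, phase_mul c₇, phase_mul c₆, phase_mul c₄, phase_mhat c₃, phase_mhat c₅, phase_inv,
      phase_inv, phase_a hl' hp', phase_a hl hp, phase_a c₁ c₂, phase_e, src_e, tgt_e, src_inv,
      tgt_inv, (𝒬.proj_a _ _ _ hl hp).1, (𝒬.proj_a _ _ _ hl hp).2, hq, hq', 𝒬.proj_m _ _ hl,
      ← 𝒬.Q.π_src u]
    abel

end Whisker

theorem smoothInto_whisker {N : SmoothManifold.{u}} {T : Set N} {s l p l' p' : N → 𝒬.Q.Y}
    {q u : N → 𝒬.Q.P} (hs : ∀ x ∈ T, (𝒬.Q.π (s x)).1 = (𝒬.Q.π (l x)).2)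
    (hl : ∀ x ∈ T, (𝒬.Q.π (l x)).1 = (𝒬.Q.π (p x)).2)
    (hp : ∀ x ∈ T, (𝒬.Q.π (p x)).1 = (𝒬.Q.π (𝒬.Q.src (u x))).2)
    (hl' : ∀ x ∈ T, (𝒬.Q.π (l' x)).1 = (𝒬.Q.π (p' x)).2)
    (hp' : ∀ x ∈ T, (𝒬.Q.π (p' x)).1 = (𝒬.Q.π (𝒬.Q.tgt (u x))).2)
    (hq : ∀ x ∈ T, 𝒬.Q.src (q x) = 𝒬.m (s x) (𝒬.m (l x) (p x)))
    (hq' : ∀ x ∈ T, 𝒬.Q.tgt (q x) = 𝒬.m (l' x) (p' x))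
    (ss : ContMDiffOn N.I 𝒬.Q.Y.I ∞ s T) (sl : ContMDiffOn N.I 𝒬.Q.Y.I ∞ l T)
    (sp : ContMDiffOn N.I 𝒬.Q.Y.I ∞ p T) (sl' : ContMDiffOn N.I 𝒬.Q.Y.I ∞ l' T)
    (sp' : ContMDiffOn N.I 𝒬.Q.Y.I ∞ p' T) (sq : 𝒬.Q.SmoothInto N.I q T)
    (su : 𝒬.Q.SmoothInto N.I u T) :
    𝒬.Q.SmoothInto N.I (fun x => 𝒬.whisker (s x) (l x) (p x) (l' x) (p' x) (q x) (u x)) T := by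
  have h := fun x hx => whisker_composable (hs x hx) (hl x hx) (hp x hx) (hl' x hx) (hp' x hx)
    (hq x hx) (hq' x hx)
  have s₁ := contMDiffOn_src su
  refine 𝒬.Q.smooth_mul _ _ _ _ (smoothInto_a sl' sp' (contMDiffOn_tgt su) hl' hp')
    (𝒬.Q.smooth_mul _ _ _ _ (𝒬.smooth_mhat _ _ _ _ sq su fun x hx => (h x hx).2.2.2.2.1)
    (𝒬.Q.smooth_mul _ _ _ _ (smoothInto_inv (smoothInto_a ss (contMDiffOn_m sl sp hl) s₁
      (fun x hx => (h x hx).1) fun x hx => (h x hx).2.1)) (𝒬.smooth_mhat _ _ _ _ (smoothInto_e ss)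
      (smoothInto_inv (smoothInto_a sl sp s₁ hl hp)) fun x hx => (h x hx).2.2.1)
    fun x hx => (h x hx).2.2.2.1) fun x hx => (h x hx).2.2.2.2.2.1)
    fun x hx => (h x hx).2.2.2.2.2.2

namespace CechData.Frame

variable {𝒰 : PointedCover M} {D : 𝒬.CechData 𝒰} {F : D.Frame}

/-! ### The action of `Y` on `Z` -/

theorem snd_π_m_pt_mem {z : F.Z} {y : 𝒬.Q.Y} (h : F.base z = (𝒬.Q.π y).2) :
    (𝒬.Q.π (𝒬.m (F.pt z) y)).2 ∈ F.A (F.idx z) := by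
  rw [𝒬.proj_m _ _ h]
  exact snd_π_pt_mem z

open Classical in
/-- The action of `y ∈ Y_(x₁,x₂)`, from the fibre of `Z` over `x₂` to the one over `x₁`. -/
noncomputable def η (z : F.Z) (y : 𝒬.Q.Y) : F.Z :=
  if h : F.base z = (𝒬.Q.π y).2 then
    SmoothManifold.sigma.mk F.isOpen_preimage (F.idx z) (𝒬.m (F.pt z) y) (snd_π_m_pt_mem h)
  else z

section Eta

variable {z z' : F.Z} {y y' : 𝒬.Q.Y} (h : F.base z = (𝒬.Q.π y).2)

include h

theorem η_eq : η z y = SmoothManifold.sigma.mk F.isOpen_preimage (F.idx z) (𝒬.m (F.pt z) y)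
    (snd_π_m_pt_mem h) := dif_pos h

/-- Acting by `y` precomposes `pt` and changes neither the index nor the far end of `pt`. Hence
everything attached to the far end (`ind`, `foot`, `top`, `lift`, `shift`) is invariant. -/
theorem idx_η : F.idx (η z y) = F.idx z := (congrArg F.idx (η_eq h) :)

theorem pt_η : F.pt (η z y) = 𝒬.m (F.pt z) y := (congrArg F.pt (η_eq h) :)

theorem π_pt_η : 𝒬.Q.π (F.pt (η z y)) = ((𝒬.Q.π y).1, (𝒬.Q.π (F.pt z)).2) := by
  rw [pt_η h, 𝒬.proj_m _ _ h]

theorem base_η : F.base (η z y) = (𝒬.Q.π y).1 := by rw [base, π_pt_η h]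

theorem ind_η : F.ind (η z y) = F.ind z := by rw [ind, idx_η h, ind]

theorem foot_η : F.foot (η z y) = F.foot z := by rw [foot, base_η h, 𝒬.π_fst_eq, ← h, foot]

theorem top_η : F.top (η z y) = F.top z := by rw [top, ind_η h, foot_η h, top]

theorem lift_η : F.lift (η z y) = F.lift z := by rw [lift, idx_η h, π_pt_η h, lift]

theorem arrow_η : F.arrow (η z y) = 𝒬.m (F.lift z) (𝒬.m (F.pt z) y) := by
  rw [arrow, lift_η h, pt_η h]

theorem shift_η (h' : F.base z' = (𝒬.Q.π y').2) : F.shift (η z y) (η z' y') = F.shift z z' := by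
  rw [shift, ind_η h, ind_η h', foot_η h, shift]

end Eta

section Families

variable {E' H' N : Type u} [NormedAddCommGroup E'] [NormedSpace ℝ E'] [TopologicalSpace H']
  [TopologicalSpace N] [ChartedSpace H' N] {J : ModelWithCorners ℝ E' H'} {T : Set N}
  {f : N → F.Z} {f' : N → 𝒬.Q.Y}

theorem contMDiffOn_η (hf : ContMDiffOn J F.Z.I ∞ f T) (hf' : ContMDiffOn J 𝒬.Q.Y.I ∞ f' T)
    (h : ∀ x ∈ T, F.base (f x) = (𝒬.Q.π (f' x)).2) :
    ContMDiffOn J F.Z.I ∞ (fun x => η (f x) (f' x)) T := by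
  refine SmoothManifold.sigma.contMDiffOn_iff.2 ⟨?_, fun x hx => ?_⟩
  · exact (𝒬.smooth_m.comp ((contMDiff_pt.comp_contMDiffOn hf).prodMk hf') h).congr
      fun x hx => pt_η (h x hx)
  · obtain ⟨O, hO, hxO, hc⟩ := SmoothManifold.sigma.exists_isOpen_idx_eq hf.continuousOn hx
    exact ⟨O, hO, hxO, fun y hy =>
      ((idx_η (h y hy.1)).trans (hc y hy)).trans (idx_η (h x hx)).symm⟩

end Families

/-! ### The action of `Q` on the bundle -/

section EtaHat

variable {l : F.bundle.P} {u : 𝒬.Q.P} (h : F.base (dom l) = (𝒬.Q.π (𝒬.Q.src u)).2)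

include h

theorem base_cod : F.base (cod l) = (𝒬.Q.π (𝒬.Q.tgt u)).2 := by rw [← base_dom, h, π_src]

theorem ηhat_composable :
    (𝒬.Q.π (F.shift (dom l) (cod l))).1 = (𝒬.Q.π (F.lift (dom l))).2 ∧
    𝒬.Q.src (arr l) = 𝒬.m (F.shift (dom l) (cod l)) (𝒬.m (F.lift (dom l)) (F.pt (dom l))) ∧
    F.base (η (dom l) (𝒬.Q.src u)) = F.base (η (cod l) (𝒬.Q.tgt u)) := by
  refine ⟨by rw [π_shift (base_dom l), π_lift], src_arr l, ?_⟩
  rw [base_η h, base_η (base_cod h), π_src]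

theorem ηhat_spec :
    𝒬.Q.src (𝒬.whisker (F.shift (dom l) (cod l)) (F.lift (dom l)) (F.pt (dom l)) (F.lift (cod l))
      (F.pt (cod l)) (arr l) u) = 𝒬.m (F.shift (η (dom l) (𝒬.Q.src u)) (η (cod l) (𝒬.Q.tgt u)))
        (F.arrow (η (dom l) (𝒬.Q.src u))) ∧
    𝒬.Q.tgt (𝒬.whisker (F.shift (dom l) (cod l)) (F.lift (dom l)) (F.pt (dom l)) (F.lift (cod l))
      (F.pt (cod l)) (arr l) u) = F.arrow (η (cod l) (𝒬.Q.tgt u)) := by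
  obtain ⟨h₁, h₂, -⟩ := whisker_spec (ηhat_composable h).1 (lift_composable (dom l)) h
    (lift_composable (cod l)) (base_cod h) (ηhat_composable h).2.1 (tgt_arr l)
  exact ⟨by rw [h₁, shift_η h (base_cod h), arrow_η h], by rw [h₂, arrow_η (base_cod h)]⟩

end EtaHat

open Classical in
/-- The map on `ℂˣ`-bundles over the action `η`. -/
noncomputable def ηhat (l : F.bundle.P) (u : 𝒬.Q.P) : F.bundle.P :=
  if h : F.base (dom l) = (𝒬.Q.π (𝒬.Q.src u)).2 then
    mkHom (η (dom l) (𝒬.Q.src u)) (η (cod l) (𝒬.Q.tgt u)) (𝒬.whisker (F.shift (dom l) (cod l))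
      (F.lift (dom l)) (F.pt (dom l)) (F.lift (cod l)) (F.pt (cod l)) (arr l) u)
      (ηhat_composable h).2.2 (ηhat_spec h).1 (ηhat_spec h).2
  else l

section EtaHat

variable {l : F.bundle.P} {u : 𝒬.Q.P} (h : F.base (dom l) = (𝒬.Q.π (𝒬.Q.src u)).2)

include h

theorem dom_ηhat : dom (ηhat l u) = η (dom l) (𝒬.Q.src u) := by rw [ηhat, dif_pos h, dom_mkHom]

theorem cod_ηhat : cod (ηhat l u) = η (cod l) (𝒬.Q.tgt u) := by rw [ηhat, dif_pos h, cod_mkHom]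

theorem arr_ηhat : arr (ηhat l u) = 𝒬.whisker (F.shift (dom l) (cod l)) (F.lift (dom l))
    (F.pt (dom l)) (F.lift (cod l)) (F.pt (cod l)) (arr l) u := by
  rw [ηhat, dif_pos h, arr_mkHom]

/-- The normalisation of `phase` absorbs the `ν`-terms at `shift` and `lift`; only those pairing
`pt` with the end points of `u` survive. -/
theorem phase_ηhat : phase (ηhat l u) = phase l + 𝒬.Q.phase u -
    𝒬.ν (F.pt (dom l)) (𝒬.Q.src u) + 𝒬.ν (F.pt (cod l)) (𝒬.Q.tgt u) +
    𝒬.α (𝒬.Q.π (𝒬.Q.src u)).1 (F.base (dom l)) (𝒬.Q.π (F.pt (cod l))).2 (F.top (cod l)) -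
    𝒬.α (𝒬.Q.π (𝒬.Q.src u)).1 (F.base (dom l)) (𝒬.Q.π (F.pt (dom l))).2 (F.top (dom l)) -
    𝒬.α (𝒬.Q.π (𝒬.Q.src u)).1 (F.base (dom l)) (F.top (dom l)) (F.top (cod l)) := by
  have hw := (whisker_spec (ηhat_composable h).1 (lift_composable (dom l)) h
    (lift_composable (cod l)) (base_cod h) (ηhat_composable h).2.1 (tgt_arr l)).2.2
  rw [phase, arr_ηhat h, hw, dom_ηhat h, cod_ηhat h, shift_η h (base_cod h),
    arrow_η h, lift_η h, lift_η (base_cod h), pt_η h, pt_η (base_cod h), phase, ← h, π_lift, π_lift,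
    π_shift (base_dom l), arrow]
  abel

end EtaHat

theorem smoothInto_ηhat {N : SmoothManifold.{u}} {T : Set N} {l : N → F.bundle.P} {u : N → 𝒬.Q.P}
    (sl : F.bundle.SmoothInto N.I l T) (su : 𝒬.Q.SmoothInto N.I u T)
    (h : ∀ x ∈ T, F.base (dom (l x)) = (𝒬.Q.π (𝒬.Q.src (u x))).2) :
    F.bundle.SmoothInto N.I (fun x => ηhat (l x) (u x)) T := by
  obtain ⟨s₁, s₂, s₃⟩ := smoothInto_iff.1 sl
  refine smoothInto_iff.2 ⟨(contMDiffOn_η s₁ (contMDiffOn_src su) h).congr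
    fun x hx => dom_ηhat (h x hx), (contMDiffOn_η s₂ (contMDiffOn_tgt su)
      fun x hx => base_cod (h x hx)).congr fun x hx => cod_ηhat (h x hx), ?_⟩
  refine .congr (smoothInto_whisker (fun x hx => (ηhat_composable (h x hx)).1)
    (fun x _ => lift_composable (dom (l x))) h (fun x _ => lift_composable (cod (l x)))
    (fun x hx => base_cod (h x hx)) (fun x _ => src_arr (l x)) (fun x _ => tgt_arr (l x))
    (contMDiffOn_shift s₁ s₂ fun x _ => base_dom (l x)) (contMDiff_lift.comp_contMDiffOn s₁)
    (contMDiff_pt.comp_contMDiffOn s₁) (contMDiff_lift.comp_contMDiffOn s₂)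
    (contMDiff_pt.comp_contMDiffOn s₂) s₃ su) fun x hx => arr_ηhat (h x hx)

end CechData.Frame

end Bundle2Gerbe

namespace Bundle2Gerbe

open BundleGerbe SmoothManifold

variable {M : SmoothManifold.{u}} {𝒬 : Bundle2Gerbe M}

namespace CechData.Frame

variable {𝒰 : PointedCover M} {D : 𝒬.CechData 𝒰} {F : D.Frame} (hg : ∀ τ x, D.g τ x = 1)

/-! ### The transformation `θ` -/

variable (F) in
/-- The element of `Q` which belongs to `θ`. -/
noncomputable def arrθ (z : F.Z) (y₂₃ y₁₂ : 𝒬.Q.Y) : 𝒬.Q.P :=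
  -- Sources in the bundle carry a factor `σ_ii`, which the unit removes. The inverse associator
  -- then rebrackets `pt z ∘ (y₂₃ ∘ y₁₂)`.
  𝒬.Q.mul (𝒬.mhat (𝒬.Q.e (F.lift z)) (𝒬.Q.inv (𝒬.a (F.pt z) y₂₃ y₁₂)))
    (arr (F.unit hg (η z (𝒬.m y₂₃ y₁₂))))

section Theta

variable {z : F.Z} {y₂₃ y₁₂ : 𝒬.Q.Y} (h : F.base z = (𝒬.Q.π y₂₃).2)
  (h' : (𝒬.Q.π y₂₃).1 = (𝒬.Q.π y₁₂).2)

include h h'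

omit h in
theorem snd_π_m : (𝒬.Q.π (𝒬.m y₂₃ y₁₂)).2 = (𝒬.Q.π y₂₃).2 := by rw [𝒬.proj_m _ _ h']

theorem base_m : F.base z = (𝒬.Q.π (𝒬.m y₂₃ y₁₂)).2 := by rw [snd_π_m h', h]

theorem base_η' : F.base (η z y₂₃) = (𝒬.Q.π y₁₂).2 := by rw [base_η h, h']

theorem base_η_m : F.base (η z (𝒬.m y₂₃ y₁₂)) = F.base (η (η z y₂₃) y₁₂) := by
  rw [base_η (base_m h h'), base_η (base_η' h h'), 𝒬.proj_m _ _ h']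

theorem arrow_η_η : F.arrow (η (η z y₂₃) y₁₂) = 𝒬.m (F.lift z) (𝒬.m (𝒬.m (F.pt z) y₂₃) y₁₂) := by
  rw [arrow_η (base_η' h h'), lift_η h, pt_η h]

theorem arrθ_composable :
    (𝒬.Q.π (𝒬.Q.src (𝒬.Q.e (F.lift z)))).1 =
      (𝒬.Q.π (𝒬.Q.src (𝒬.Q.inv (𝒬.a (F.pt z) y₂₃ y₁₂)))).2 ∧
    𝒬.Q.src (𝒬.mhat (𝒬.Q.e (F.lift z)) (𝒬.Q.inv (𝒬.a (F.pt z) y₂₃ y₁₂))) =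
      𝒬.Q.tgt (arr (F.unit hg (η z (𝒬.m y₂₃ y₁₂)))) := by
  have ha := 𝒬.proj_a (F.pt z) _ _ h h'
  have h₁ : (𝒬.Q.π (𝒬.Q.src (𝒬.Q.e (F.lift z)))).1 =
      (𝒬.Q.π (𝒬.Q.src (𝒬.Q.inv (𝒬.a (F.pt z) y₂₃ y₁₂)))).2 := by
    rw [src_e, src_inv, ha.2, 𝒬.proj_m (F.pt z) _ (base_m h h'), π_lift]
  refine ⟨h₁, ?_⟩
  rw [𝒬.src_mhat _ _ h₁, src_e, src_inv, ha.2, tgt_arr, cod_unit, arrow_η (base_m h h')]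

theorem arrθ_spec :
    𝒬.Q.src (F.arrθ hg z y₂₃ y₁₂) =
      𝒬.m (F.shift (η z (𝒬.m y₂₃ y₁₂)) (η (η z y₂₃) y₁₂)) (F.arrow (η z (𝒬.m y₂₃ y₁₂))) ∧
    𝒬.Q.tgt (F.arrθ hg z y₂₃ y₁₂) = F.arrow (η (η z y₂₃) y₁₂) := by
  have ha := 𝒬.proj_a (F.pt z) _ _ h h'
  obtain ⟨h₁, h₂⟩ := arrθ_composable hg h h'
  constructor
  · rw [arrθ, src_mul h₂, src_arr, dom_unit, cod_unit, shift, shift, ind_η (base_η' h h'), ind_η h,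
      ind_η (base_m h h')]
  · rw [arrθ, tgt_mul h₂, 𝒬.tgt_mhat _ _ h₁, tgt_e, tgt_inv, ha.1, arrow_η_η h h']

end Theta

open Classical in
/-- The transformation `η z (m y₂₃ y₁₂) → η (η z y₂₃) y₁₂` given by the associator. -/
noncomputable def θ (z : F.Z) (y₂₃ y₁₂ : 𝒬.Q.Y) : F.bundle.P :=
  if h : F.base z = (𝒬.Q.π y₂₃).2 ∧ (𝒬.Q.π y₂₃).1 = (𝒬.Q.π y₁₂).2 then
    mkHom (η z (𝒬.m y₂₃ y₁₂)) (η (η z y₂₃) y₁₂) (F.arrθ hg z y₂₃ y₁₂) (base_η_m h.1 h.2)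
      (arrθ_spec hg h.1 h.2).1 (arrθ_spec hg h.1 h.2).2
  else F.unit hg z

section Theta

variable {z : F.Z} {y₂₃ y₁₂ : 𝒬.Q.Y} (h : F.base z = (𝒬.Q.π y₂₃).2)
  (h' : (𝒬.Q.π y₂₃).1 = (𝒬.Q.π y₁₂).2)

include h h'

theorem dom_θ : dom (F.θ hg z y₂₃ y₁₂) = η z (𝒬.m y₂₃ y₁₂) := by rw [θ, dif_pos ⟨h, h'⟩, dom_mkHom]

theorem cod_θ : cod (F.θ hg z y₂₃ y₁₂) = η (η z y₂₃) y₁₂ := by rw [θ, dif_pos ⟨h, h'⟩, cod_mkHom]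

theorem arr_θ : arr (F.θ hg z y₂₃ y₁₂) = F.arrθ hg z y₂₃ y₁₂ := by
  rw [θ, dif_pos ⟨h, h'⟩, arr_mkHom]

/-- The first two terms are the phase of the unit, minus a twist at three equal points; the last is
that of the inverse associator. -/
theorem phase_θ : phase (F.θ hg z y₂₃ y₁₂) = D.R (F.ind z) (F.ind z) (F.ind z) (F.foot z) -
    𝒬.α (𝒬.Q.π y₁₂).1 (F.top z) (F.top z) (F.top z) - 𝒬.Q.phase (𝒬.a (F.pt z) y₂₃ y₁₂) := by
  have ha := 𝒬.proj_a (F.pt z) _ _ h h'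
  have hm := base_m h h'
  obtain ⟨h₁, h₂⟩ := arrθ_composable hg h h'
  have h₃ := phase_unit hg (η z (𝒬.m y₂₃ y₁₂))
  rw [twist, base_η hm, top_η hm, ind_η hm, foot_η hm, phase, dom_unit, cod_unit, 𝒬.proj_m _ _ h']
    at h₃
  rw [phase, arr_θ hg h h', dom_θ hg h h', cod_θ hg h h', arrθ, BundleGerbe.phase_mul h₂,
    phase_mhat h₁, phase_e, phase_inv, src_e, tgt_e, src_inv, tgt_inv, ha.1, ha.2, shift, ind_η hm,
    ind_η (base_η' h h'), ind_η h, lift_η hm, lift_η (base_η' h h'), lift_η h, pt_η hm,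
    pt_η (base_η' h h'), pt_η h]
  rw [shift, ind_η hm, lift_η hm, pt_η hm] at h₃
  grind

end Theta

theorem smoothInto_θ {N : SmoothManifold.{u}} {T : Set N} {f : N → F.Z} {f₂₃ f₁₂ : N → 𝒬.Q.Y}
    (hf : ContMDiffOn N.I F.Z.I ∞ f T) (hf₂₃ : ContMDiffOn N.I 𝒬.Q.Y.I ∞ f₂₃ T)
    (hf₁₂ : ContMDiffOn N.I 𝒬.Q.Y.I ∞ f₁₂ T) (h : ∀ x ∈ T, F.base (f x) = (𝒬.Q.π (f₂₃ x)).2)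
    (h' : ∀ x ∈ T, (𝒬.Q.π (f₂₃ x)).1 = (𝒬.Q.π (f₁₂ x)).2) :
    F.bundle.SmoothInto N.I (fun x => F.θ hg (f x) (f₂₃ x) (f₁₂ x)) T := by
  have s₁ := contMDiffOn_η hf (contMDiffOn_m hf₂₃ hf₁₂ h') fun x hx => base_m (h x hx) (h' x hx)
  have s₂ := contMDiffOn_η (contMDiffOn_η hf hf₂₃ h) hf₁₂ fun x hx => base_η' (h x hx) (h' x hx)
  refine smoothInto_iff.2 ⟨s₁.congr fun x hx => dom_θ hg (h x hx) (h' x hx),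
    s₂.congr fun x hx => cod_θ hg (h x hx) (h' x hx), ?_⟩
  refine .congr (𝒬.Q.smooth_mul _ _ _ _ (𝒬.smooth_mhat _ _ _ _
    (smoothInto_e (contMDiff_lift.comp_contMDiffOn hf)) (smoothInto_inv
      (smoothInto_a (contMDiff_pt.comp_contMDiffOn hf) hf₂₃ hf₁₂ h h'))
    fun x hx => (arrθ_composable hg (h x hx) (h' x hx)).1)
    (smoothInto_iff.1 (smoothInto_unit hg s₁)).2.2
    fun x hx => (arrθ_composable hg (h x hx) (h' x hx)).2) fun x hx => arr_θ hg (h x hx) (h' x hx)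

/-- `smoothInto_θ` concerns families over a `SmoothManifold`, so the triple product is made into
one, and `hI` identifies the two models with corners. -/
theorem smooth_θ : F.bundle.SmoothInto (F.Z.I.prod (𝒬.Q.Y.I.prod 𝒬.Q.Y.I))
    (fun w : F.Z × 𝒬.Q.Y × 𝒬.Q.Y => F.θ hg w.1 w.2.1 w.2.2)
    {w | F.base w.1 = (𝒬.Q.π w.2.1).2 ∧ (𝒬.Q.π w.2.1).1 = (𝒬.Q.π w.2.2).2} := by
  have hI : (F.Z.prod (𝒬.Q.Y.prod 𝒬.Q.Y)).I = F.Z.I.prod (𝒬.Q.Y.I.prod 𝒬.Q.Y.I) := by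
    rw [I_prod, I_prod]
    rfl
  rw [← hI]
  have h₁ : ContMDiff (F.Z.prod (𝒬.Q.Y.prod 𝒬.Q.Y)).I F.Z.I ∞
      (fun w : F.Z.prod (𝒬.Q.Y.prod 𝒬.Q.Y) => w.1) := by
    rw [hI]
    exact contMDiff_fst (M := F.Z) (N := 𝒬.Q.Y × 𝒬.Q.Y)
  have h₂ : ContMDiff (F.Z.prod (𝒬.Q.Y.prod 𝒬.Q.Y)).I 𝒬.Q.Y.I ∞
      (fun w : F.Z.prod (𝒬.Q.Y.prod 𝒬.Q.Y) => w.2.1) := by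
    rw [hI]
    exact contMDiff_fst.comp (contMDiff_snd (M := F.Z) (N := 𝒬.Q.Y × 𝒬.Q.Y))
  have h₃ : ContMDiff (F.Z.prod (𝒬.Q.Y.prod 𝒬.Q.Y)).I 𝒬.Q.Y.I ∞
      (fun w : F.Z.prod (𝒬.Q.Y.prod 𝒬.Q.Y) => w.2.2) := by
    rw [hI]
    exact contMDiff_snd.comp (contMDiff_snd (M := F.Z) (N := 𝒬.Q.Y × 𝒬.Q.Y))
  exact smoothInto_θ hg h₁.contMDiffOn h₂.contMDiffOn h₃.contMDiffOn (fun _ h => h.1)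
    fun _ h => h.2

/-! ### Compatibility of `η` and `θ` with the products -/

section Eta

variable {l l' : F.bundle.P} {u u' : 𝒬.Q.P} (h : F.base (dom l) = (𝒬.Q.π (𝒬.Q.src u)).2)

include h

theorem act_ηhat (c : ℂˣ) : ηhat (F.bundle.act c l) u = F.bundle.act c (ηhat l u) := by
  have h' : F.base (dom (F.bundle.act c l)) = (𝒬.Q.π (𝒬.Q.src u)).2 := h
  refine ext_phase ?_ ?_ ?_
  · rw [dom_ηhat h', dom_act, dom_act, dom_ηhat h]
  · rw [cod_ηhat h', cod_act, cod_act, cod_ηhat h]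
  · rw [phase_ηhat h', phase_act, phase_act, phase_ηhat h, dom_act, cod_act]
    abel

theorem ηhat_act (c : ℂˣ) : ηhat l (𝒬.Q.act c u) = F.bundle.act c (ηhat l u) := by
  have h' : F.base (dom l) = (𝒬.Q.π (𝒬.Q.src (𝒬.Q.act c u))).2 := by rw [src_act, h]
  refine ext_phase ?_ ?_ ?_
  · rw [dom_ηhat h', dom_act, src_act, dom_ηhat h]
  · rw [cod_ηhat h', cod_act, tgt_act, cod_ηhat h]
  · rw [phase_ηhat h', phase_act, phase_ηhat h, BundleGerbe.phase_act, src_act, tgt_act]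
    abel

/-- The action moves the base point inside `twist`. The resulting change is matched by the `α`-terms
of `phase_ηhat` through `α_coherence` at the new and old base points and the three tops. -/
theorem ηhat_mul (hl : dom l' = cod l) (hu : 𝒬.Q.src u' = 𝒬.Q.tgt u) :
    ηhat (mul l' l) (𝒬.Q.mul u' u) = mul (ηhat l' u') (ηhat l u) := by
  have h₂ : F.base (dom l') = (𝒬.Q.π (𝒬.Q.src u')).2 := by rw [hl, hu, base_cod h]
  have h₃ : F.base (dom (mul l' l)) = (𝒬.Q.π (𝒬.Q.src (𝒬.Q.mul u' u))).2 := by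
    rw [dom_mul hl, src_mul hu, h]
  have h₄ : dom (ηhat l' u') = cod (ηhat l u) := by rw [dom_ηhat h₂, cod_ηhat h, hl, hu]
  have hα := 𝒬.α_coherence (x₁ := (𝒬.Q.π (𝒬.Q.src u)).1) (x₂ := F.base (dom l))
    (x₃ := F.top (dom l)) (x₄ := F.top (cod l)) (x₅ := F.top (cod l'))
    (by rw [𝒬.π_fst_eq, h]) (by rw [𝒬.π_fst_eq, ← h, π_top, π_base])
    (by rw [𝒬.π_fst_eq, ← h, π_top, π_base, foot_congr (base_dom l)])
    (by rw [𝒬.π_fst_eq, ← h, π_top, π_base, foot_congr (base_dom_cod hl)])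
  have hπ : 𝒬.Q.π (𝒬.Q.tgt u) = 𝒬.Q.π (𝒬.Q.src u) := by rw [π_src]
  refine ext_phase ?_ ?_ ?_
  · rw [dom_ηhat h₃, dom_mul hl, src_mul hu, dom_mul h₄, dom_ηhat h]
  · rw [cod_ηhat h₃, cod_mul hl, tgt_mul hu, cod_mul h₄, cod_ηhat h₂]
  · rw [phase_ηhat h₃, dom_mul hl, cod_mul hl, src_mul hu, tgt_mul hu, phase_mul hl,
      BundleGerbe.phase_mul hu, phase_mul h₄, phase_ηhat h, phase_ηhat h₂, dom_ηhat h, cod_ηhat h,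
      cod_ηhat h₂, twist, twist, base_η h, top_η h, ind_η h, foot_η h, top_η (base_cod h),
      ind_η (base_cod h), top_η (base_cod h₂), ind_η (base_cod h₂), hl, hu, hπ, ← base_dom l]
    grind

end Eta

theorem descent_θ {l : F.bundle.P} {u₂₃ u₁₂ : 𝒬.Q.P}
    (h : F.base (dom l) = (𝒬.Q.π (𝒬.Q.src u₂₃)).2)
    (h' : (𝒬.Q.π (𝒬.Q.src u₂₃)).1 = (𝒬.Q.π (𝒬.Q.src u₁₂)).2) :
    mul (F.θ hg (cod l) (𝒬.Q.tgt u₂₃) (𝒬.Q.tgt u₁₂)) (ηhat l (𝒬.mhat u₂₃ u₁₂)) =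
      mul (ηhat (ηhat l u₂₃) u₁₂) (F.θ hg (dom l) (𝒬.Q.src u₂₃) (𝒬.Q.src u₁₂)) := by
  have k := base_cod h
  have k' : (𝒬.Q.π (𝒬.Q.tgt u₂₃)).1 = (𝒬.Q.π (𝒬.Q.tgt u₁₂)).2 := by rw [← π_src, h', π_src]
  have hs := 𝒬.src_mhat _ _ h'
  have ht := 𝒬.tgt_mhat _ _ h'
  have h₁ : F.base (dom l) = (𝒬.Q.π (𝒬.Q.src (𝒬.mhat u₂₃ u₁₂))).2 := by rw [hs, base_m h h']
  have h₂ : F.base (dom (ηhat l u₂₃)) = (𝒬.Q.π (𝒬.Q.src u₁₂)).2 := by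
    rw [dom_ηhat h, base_η' h h']
  have m₁ : dom (F.θ hg (cod l) (𝒬.Q.tgt u₂₃) (𝒬.Q.tgt u₁₂)) =
      cod (ηhat l (𝒬.mhat u₂₃ u₁₂)) := by rw [dom_θ hg k k', cod_ηhat h₁, ht]
  have m₂ : dom (ηhat (ηhat l u₂₃) u₁₂) =
      cod (F.θ hg (dom l) (𝒬.Q.src u₂₃) (𝒬.Q.src u₁₂)) := by
    rw [dom_ηhat h₂, dom_ηhat h, cod_θ hg h h']
  refine ext_phase ?_ ?_ ?_
  · rw [dom_mul m₁, dom_mul m₂, dom_ηhat h₁, dom_θ hg h h', hs]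
  · rw [cod_mul m₁, cod_mul m₂, cod_θ hg k k', cod_ηhat h₂, cod_ηhat h]
  · have j := base_m h h'
    have j' := base_m k k'
    have hb : F.base (η (dom l) (𝒬.m (𝒬.Q.src u₂₃) (𝒬.Q.src u₁₂))) =
        F.base (η (cod l) (𝒬.m (𝒬.Q.tgt u₂₃) (𝒬.Q.tgt u₁₂))) := by
      rw [base_η j, base_η j', 𝒬.proj_m _ _ h', 𝒬.proj_m _ _ k', π_src]
    -- For the two points `A`, `B` over one base point these say `twist A B B = twist B B B` and
    -- `twist A A B = twist A A A`, so the units inside the two copies of `θ` absorb the twists of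
    -- the products.
    have c₁ := twist_cocycle hg hb hb hb
    have c₂ := twist_cocycle hg rfl rfl hb
    have hπ₁ : 𝒬.Q.π (𝒬.Q.tgt u₁₂) = 𝒬.Q.π (𝒬.Q.src u₁₂) := by rw [π_src]
    have hπ₂ : 𝒬.Q.π (𝒬.Q.tgt u₂₃) = 𝒬.Q.π (𝒬.Q.src u₂₃) := by rw [π_src]
    have q₂ : 𝒬.π (𝒬.Q.π (𝒬.Q.src u₁₂)).1 = 𝒬.π (𝒬.Q.π (𝒬.Q.src u₂₃)).1 := by
      rw [𝒬.π_fst_eq, h']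
    have q₃ : 𝒬.π (𝒬.Q.π (𝒬.Q.src u₁₂)).1 = 𝒬.π (F.base (dom l)) := by rw [q₂, 𝒬.π_fst_eq, h]
    have q₄ : 𝒬.π (𝒬.Q.π (𝒬.Q.src u₁₂)).1 = F.foot (cod l) := by
      rw [q₃, π_base, foot_congr (base_dom l)]
    -- The three `α`-terms of `phase_ηhat` each call for one pentagon: at `dom l`, at `cod l`, and
    -- between their tops.
    have α₁ := 𝒬.α_coherence q₂ q₃ (x₄ := (𝒬.Q.π (F.pt (dom l))).2) (x₅ := F.top (dom l))
      (by rw [q₃, π_snd_π_pt, π_base]) (by rw [q₃, π_top, π_base])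
    have α₂ := 𝒬.α_coherence q₂ q₃ (x₄ := (𝒬.Q.π (F.pt (cod l))).2) (x₅ := F.top (cod l))
      (by rw [q₄, π_snd_π_pt]) (by rw [q₄, π_top])
    have α₃ := 𝒬.α_coherence q₂ q₃ (x₄ := F.top (dom l)) (x₅ := F.top (cod l))
      (by rw [q₃, π_top, π_base]) (by rw [q₄, π_top])
    simp only [twist, base_η j, top_η j, ind_η j, foot_η j, base_η j', top_η j', ind_η j',
      foot_η j', 𝒬.proj_m _ _ h', 𝒬.proj_m _ _ k', hπ₁, ← foot_congr (base_dom l)] at c₁ c₂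
    rw [phase_mul m₁, phase_mul m₂, phase_θ hg h h', phase_θ hg k k', phase_ηhat h₁, phase_ηhat h₂,
      phase_ηhat h, phase_mhat h', phase_a h h', phase_a k k', dom_ηhat h₁, cod_ηhat h₁,
      dom_θ hg h h', cod_θ hg h h', cod_θ hg k k', dom_ηhat h, cod_ηhat h₂, cod_ηhat h, hs, ht,
      twist, twist]
    simp only [base_η j, top_η j, ind_η j, foot_η j, top_η j', ind_η j',
      base_η h, top_η h, ind_η h, pt_η h, top_η k, ind_η k, pt_η k, top_η (base_η' h h'),
      ind_η (base_η' h h'), top_η (base_η' k k'), ind_η (base_η' k k'), 𝒬.proj_m _ _ h',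
      𝒬.proj_m _ _ h, 𝒬.proj_m _ _ k, hπ₁, hπ₂, ← foot_congr (base_dom l), ← h, ← h']
    grind

theorem coherence_θ {z : F.Z} {y₃₄ y₂₃ y₁₂ : 𝒬.Q.Y} (h : F.base z = (𝒬.Q.π y₃₄).2)
    (h' : (𝒬.Q.π y₃₄).1 = (𝒬.Q.π y₂₃).2) (h'' : (𝒬.Q.π y₂₃).1 = (𝒬.Q.π y₁₂).2) :
    mul (F.θ hg (η z y₃₄) y₂₃ y₁₂) (mul (F.θ hg z y₃₄ (𝒬.m y₂₃ y₁₂))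
      (ηhat (F.unit hg z) (𝒬.a y₃₄ y₂₃ y₁₂))) =
      mul (ηhat (F.θ hg z y₃₄ y₂₃) (𝒬.Q.e y₁₂)) (F.θ hg z (𝒬.m y₃₄ y₂₃) y₁₂) := by
  have b₁ := base_η' h h'
  have b₂ := base_m h h'
  have c₁ : (𝒬.Q.π (𝒬.m y₃₄ y₂₃)).1 = (𝒬.Q.π y₁₂).2 := by rw [𝒬.proj_m _ _ h', h'']
  have c₂ : (𝒬.Q.π y₃₄).1 = (𝒬.Q.π (𝒬.m y₂₃ y₁₂)).2 := by rw [𝒬.proj_m _ _ h'', h']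
  have b₃ := base_m h c₂
  have b₄ := base_m b₁ h''
  have b₅ := base_m b₂ c₁
  have b₆ := base_η' b₁ h''
  have b₇ := base_η' b₂ c₁
  have b₈ : (𝒬.Q.π (𝒬.m (F.pt z) y₃₄)).1 = (𝒬.Q.π y₂₃).2 := by rw [𝒬.proj_m _ _ h, h']
  obtain ⟨hs, ht⟩ := 𝒬.proj_a _ _ _ h' h''
  have h₁ : F.base (dom (F.unit hg z)) = (𝒬.Q.π (𝒬.Q.src (𝒬.a y₃₄ y₂₃ y₁₂))).2 := by
    rw [dom_unit, hs, b₅]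
  have h₂ : F.base (dom (F.θ hg z y₃₄ y₂₃)) = (𝒬.Q.π (𝒬.Q.src (𝒬.Q.e y₁₂))).2 := by
    rw [dom_θ hg h h', src_e, b₇]
  have m₁ : dom (F.θ hg z y₃₄ (𝒬.m y₂₃ y₁₂)) =
      cod (ηhat (F.unit hg z) (𝒬.a y₃₄ y₂₃ y₁₂)) := by
    rw [dom_θ hg h c₂, cod_ηhat h₁, cod_unit, ht]
  have m₂ : dom (F.θ hg (η z y₃₄) y₂₃ y₁₂) = cod (mul (F.θ hg z y₃₄ (𝒬.m y₂₃ y₁₂))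
      (ηhat (F.unit hg z) (𝒬.a y₃₄ y₂₃ y₁₂))) := by
    rw [cod_mul m₁, dom_θ hg b₁ h'', cod_θ hg h c₂]
  have m₃ : dom (ηhat (F.θ hg z y₃₄ y₂₃) (𝒬.Q.e y₁₂)) = cod (F.θ hg z (𝒬.m y₃₄ y₂₃) y₁₂) := by
    rw [dom_ηhat h₂, dom_θ hg h h', src_e, cod_θ hg b₂ c₁]
  refine ext_phase ?_ ?_ ?_
  · rw [dom_mul m₂, dom_mul m₁, dom_mul m₃, dom_ηhat h₁, dom_unit, hs, dom_θ hg b₂ c₁]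
  · rw [cod_mul m₂, cod_mul m₃, cod_θ hg b₁ h'', cod_ηhat h₂, cod_θ hg h h', tgt_e]
  · have q₂ : 𝒬.π (𝒬.Q.π y₁₂).1 = 𝒬.π (𝒬.Q.π y₂₃).1 := by rw [𝒬.π_fst_eq, h'']
    have q₃ : 𝒬.π (𝒬.Q.π y₁₂).1 = 𝒬.π (𝒬.Q.π y₃₄).1 := by rw [q₂, 𝒬.π_fst_eq, h']
    have q₄ : 𝒬.π (𝒬.Q.π y₁₂).1 = 𝒬.π (F.base z) := by rw [q₃, 𝒬.π_fst_eq, h]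
    have q₅ : 𝒬.π (𝒬.Q.π y₁₂).1 = 𝒬.π (F.top z) := by rw [q₄, π_top, π_base]
    -- `α₁` is the pentagon for `pt z`, `y₃₄`, `y₂₃`, `y₁₂`, the real content of `δ(θ) = a`. In `α₂`
    -- and `α₃` the top is repeated three times; they handle the contributions of the units.
    have α₁ := 𝒬.α_coherence q₂ q₃ q₄ (x₅ := (𝒬.Q.π (F.pt z)).2) (by rw [q₄, π_snd_π_pt, π_base])
    have α₂ := 𝒬.α_coherence q₄ q₅ q₅ q₅
    have α₃ := 𝒬.α_coherence q₂ q₅ q₅ q₅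
    rw [phase_mul m₂, phase_mul m₁, phase_mul m₃, phase_θ hg b₁ h'', phase_θ hg h c₂,
      phase_ηhat h₁, phase_ηhat h₂, phase_unit, phase_θ hg h h', phase_θ hg b₂ c₁,
      phase_a h' h'', phase_a b₁ h'', phase_a h c₂, phase_a h h', phase_a b₂ c₁, phase_e,
      dom_mul m₁, cod_mul m₁, dom_ηhat h₁, cod_ηhat h₁, cod_ηhat h₂, dom_θ hg h h', cod_θ hg h h',
      cod_θ hg b₁ h'', cod_θ hg h c₂, dom_θ hg b₂ c₁, cod_θ hg b₂ c₁, dom_unit, cod_unit, hs, ht,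
      src_e, tgt_e, twist, twist, twist, twist]
    simp only [top_η h, ind_η h, foot_η h, pt_η h, top_η b₁, ind_η b₁, pt_η b₁,
      base_η b₂, top_η b₂, ind_η b₂, pt_η b₂, top_η b₃, ind_η b₃, top_η b₄, ind_η b₄, base_η b₅,
      top_η b₅, ind_η b₅, foot_η b₅, top_η b₆, ind_η b₆, top_η b₇, ind_η b₇, 𝒬.proj_m _ _ h',
      𝒬.proj_m _ _ h'', 𝒬.proj_m _ _ c₁, 𝒬.proj_m _ _ h, 𝒬.proj_m _ _ b₂,
      𝒬.proj_m _ _ b₈, ← h, ← h', ← h'']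
    grind

variable (F) in
/-- The trivialisation of a bundle 2-gerbe given by a trivial cocycle. -/
noncomputable def trivialisation : 𝒬.Trivialisation where
  L := F.gerbe hg
  η := η
  proj_η _ _ h := base_η h
  smooth_η := by
    have h₁ : ContMDiff (F.Z.I.prod 𝒬.Q.Y.I) F.Z.I ∞ (fun w : F.Z × 𝒬.Q.Y => w.1) := contMDiff_fst
    have h₂ : ContMDiff (F.Z.I.prod 𝒬.Q.Y.I) 𝒬.Q.Y.I ∞ (fun w : F.Z × 𝒬.Q.Y => w.2) :=
      contMDiff_snd
    exact contMDiffOn_η h₁.contMDiffOn h₂.contMDiffOn fun _ h => h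
  ηhat := ηhat
  src_ηhat _ _ h := dom_ηhat h
  tgt_ηhat _ _ h := cod_ηhat h
  act_ηhat c _ _ h := act_ηhat h c
  ηhat_act c _ _ h := ηhat_act h c
  smooth_ηhat _ _ _ _ sl su h := smoothInto_ηhat sl su h
  ηhat_mul _ _ _ _ h h' h'' := ηhat_mul h'' h h'
  θ := θ hg
  proj_θ _ _ _ h h' := ⟨dom_θ hg h h', cod_θ hg h h'⟩
  smooth_θ := smooth_θ hg
  descent_θ _ _ _ h h' := descent_θ hg h h'
  coherence_θ _ _ _ _ h h' h'' := coherence_θ hg h h' h''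

end CechData.Frame

end Bundle2Gerbe

theorem mainTheorem1 (M : SmoothManifold.{u}) [FiniteDimensional ℝ M.model]
    [SecondCountableTopology M] (𝒬 : Bundle2Gerbe M) :
    (∃ c : IntegralH4 M, 𝒬.IsFourClass c) ∧
      ∀ c : IntegralH4 M, 𝒬.IsFourClass c → (c = 0 ↔ 𝒬.IsTrivial) := by
  refine ⟨𝒬.exists_isFourClass, fun c hc => ⟨?_, fun h => Bundle2Gerbe.eq_zero_of_isTrivial h hc⟩⟩
  rintro rfl
  obtain ⟨𝒰, D, hg⟩ := Bundle2Gerbe.exists_cechData_g_eq_one hc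
  obtain ⟨F⟩ := D.nonempty_frame
  exact ⟨F.trivialisation hg⟩
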